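/- \textbf{Setting.} Let $M_1,\dots,M_R$ be the sizes of a uniform $R$-D array, $M=\prod_r M_r$, let $1\le L_r\le M_r$ be the numbers of maximally overlapping subarrays, $L=\prod_r L_r$, and $M_{\mathrm{sub},r}=M_r-L_r+1$, $M_{\mathrm{sub}}=\prod_r M_{\mathrm{sub},r}$. There are $d$ strictly non-circular sources with pairwise distinct frequency vectors $(\mu_i^{(1)},\dots,\mu_i^{(R)})$, $\mu_i^{(r)}\in(-\pi,\pi)$. The measurements are $X=X_0+W\in\mathbb C^{M\times N}$ with $X_0=\bar A\,\Xi\,S_0$, where the $i$-th column of $\bar A$ is the Kronecker product over $r$ of the vectors $\big(e^{j(m-(M_r-1)/2)\mu_i^{(r)}}\big)_{m=0}^{M_r-1}$, $\Xi=\mathrm{diag}\{e^{j(\varphi_i+\sum_r\delta^{(r)}\mu_i^{(r)})}\}$, $S_0\in\mathbb R^{d\times N}$, and $W$ is noise. Let $\Pi_p$ be the $p\times p$ exchange matrix, let $J_{\underline\ell}$ be the Kronecker product over $r$ of the selection matrices $[0_{M_{\mathrm{sub},r}\times(\ell_r-1)}\ I_{M_{\mathrm{sub},r}}\ 0]$,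 and put $X^{(nc)}=\begin{bmatrix}X\\ \Pi_M X^*\end{bmatrix}$ and $X_{SS}^{(nc)}=\big[(I_2\otimes J_{\underline\ell})X^{(nc)}\big]_{\underline\ell}\in\mathbb C^{2M_{\mathrm{sub}}\times NL}$, the blocks being in lexicographic order of $\underline\ell$. Write $W_{SS}^{(nc)}$ for the same construction applied to $W$, and $\nu=\|W_{SS}^{(nc)}\|_F$. Let $J_1^{(r)},J_2^{(r)}$ be $I_2\otimes I\otimes J\otimes I$, where $J$ drops the last, respectively the first, of the $M_{\mathrm{sub},r}$ elements of the $r$-th mode. As usual it is assumed that the noise-free $X_{SS}^{(nc)}$ has rank $d$, and that $J_1^{(r)}\bar A_{SS}^{(nc)}$ has rank $d$ for every $r$, where $\bar A_{SS}^{(nc)}=(I_2\otimes J_{1,\dots,1})\begin{bmatrix}\bar A\\ \bar A\,\Xi^*\Xi^*\end{bmatrix}$. \textbf{Algorithms.} \emph{NC Standard ESPRIT} takes $d$ dominant left singular vectors $\hat U$ of $X_{SS}^{(nc)}$, forms $\hat\Gamma^{(r)}=(J_1^{(r)}\hat U)^+J_2^{(r)}\hat U$, and outputs $\hat\mu_i^{(r)}=\arg\hat\lambda_i^{(r)}$,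 where $\hat\lambda_i^{(r)}$ are the joint eigenvalues of $\hat\Gamma^{(1)},\dots,\hat\Gamma^{(R)}$, i.e. the diagonal entries of $T^{-1}\hat\Gamma^{(r)}T$ for a non-singular $T$ with unit-norm columns that minimizes the total energy of the off-diagonal entries of these $R$ matrices. \emph{NC Standard ESPRIT with FBA} does the same with $\tilde X=[X_{SS}^{(nc)},\ \Pi_{2M_{\mathrm{sub}}}X_{SS}^{(nc)*}\Pi_{NL}]$. \emph{NC Unitary ESPRIT} takes $d$ dominant left singular vectors $\hat E$ (real) of the real matrix $Q_{2M_{\mathrm{sub}}}^H\tilde X Q_{2NL}$, where $Q_{2n}=\frac1{\sqrt2}\begin{bmatrix}I_n& jI_n\\ \Pi_n&-j\Pi_n\end{bmatrix}$, forms the real matrices $\hat\Upsilon^{(r)}=(K_1^{(r)}\hat E)^+K_2^{(r)}\hat E$ with $K_1^{(r)}=2\,\mathrm{Re}\{Q^HJ_2^{(r)}Q\}$ and $K_2^{(r)}=2\,\mathrm{Im}\{Q^HJ_2^{(r)}Q\}$ (each $Q$ of the appropriate order), and outputs $\hat\mu_i^{(r)}=2\arctan\hat\omega_i^{(r)}$,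 where $\hat\omega_i^{(r)}$ are the joint eigenvalues of the $\hat\Upsilon^{(r)}$ (defined as above, with real $T$). Outputs are numbered so that the total squared error $\sum_{r,i}(\hat\mu_i^{(r)}-\mu_i^{(r)})^2$ is minimal. \textbf{Theorem 2.} Spatially smoothed $R$-D NC Unitary ESPRIT, spatially smoothed $R$-D NC Standard ESPRIT with FBA preprocessing, and hence also (FBA having no effect on the signal subspace estimate) spatially smoothed $R$-D NC Standard ESPRIT perform asymptotically identically in the high effective SNR regime. That is, there are real-linear functionals $\ell_i^{(r)}$ of the noise, the same for the three algorithms, such that: (a) for all sufficiently small $\nu$ each algorithm has an output, and the estimation errors of every output satisfy $\hat\mu_i^{(r)}-\mu_i^{(r)}=\ell_i^{(r)}(W)+\mathcal O(\nu^2)$ for all $r,i$; (b) if $W=\sigma n$ with a random matrix $n$ with entries of finite second moment, otherwise of arbitrary distribution, then for each algorithm (with arbitrary angles in $[-\pi,\pi]$ reported on realizations for which it has no output) $\mathbb E\{(\hat\mu_i^{(r)}-\mu_i^{(r)})^2\}/\sigma^2\to\mathbb E\{\ell_i^{(r)}(n)^2\}<\infty$ as $\sigma\to0$; so the first-order mean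 square errors of the three algorithms coincide. -/

import Mathlib

open MeasureTheory Filter Topology

namespace NCEsprit

noncomputable section

/-- Multi-indices of an `R`-dimensional grid of size `M 0 × ⋯ × M (R-1)` (0-based). They index the
rows and columns of `R`-fold Kronecker products; the Kronecker order is the lexicographic one. -/
abbrev Idx {R : ℕ} (M : Fin R → ℕ) : Type := (r : Fin R) → Fin (M r)

/-- The reversal of the lexicographic order of multi-indices: it reverses every coordinate. -/
def revIdx {R : ℕ} {M : Fin R → ℕ} (m : Idx M) : Idx M := fun r => (m r).rev

/-- The permutation matrix of a map `ρ`. With `ρ` an order reversal it is the exchange matrix. -/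
def exch {ι : Type} [DecidableEq ι] (ρ : ι → ι) : Matrix ι ι ℂ :=
  Matrix.of fun i j => if j = ρ i then 1 else 0

/-- Entrywise complex conjugation. -/
def conjM {ι κ : Type} (X : Matrix ι κ ℂ) : Matrix ι κ ℂ := X.map (starRingEnd ℂ)

/-- Order reversal on two stacked copies of `ι`. -/
def revSum {ι : Type} (ρ : ι → ι) : ι ⊕ ι → ι ⊕ ι := fun x => (x.map ρ ρ).swap

/-- `I₂ ⊗ B`. -/
def dbl {ι κ : Type} (B : Matrix ι κ ℂ) : Matrix (ι ⊕ ι) (κ ⊕ κ) ℂ := Matrix.fromBlocks B 0 0 B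

/-- Kronecker product `B 0 ⊗ ⋯ ⊗ B (R-1)`. -/
def kron {R : ℕ} {P M : Fin R → ℕ} (B : (r : Fin R) → Matrix (Fin (P r)) (Fin (M r)) ℂ) :
    Matrix (Idx P) (Idx M) ℂ :=
  Matrix.of fun m k => ∏ r, B r (m r) (k r)

/-- The `p × q` selection matrix `[0_{p×a}  I_p  0]`. -/
def sel (p q a : ℕ) : Matrix (Fin p) (Fin q) ℂ :=
  Matrix.of fun i j => if (j : ℕ) = i + a then 1 else 0

/-- Frobenius norm. -/
def frob {ι κ : Type} [Fintype ι] [Fintype κ] (X : Matrix ι κ ℂ) : ℝ :=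
  Real.sqrt (∑ i, ∑ j, ‖X i j‖ ^ 2)

/-! ### Data model -/

/-- Steering matrix of the `R`-D uniform array, phase reference at the centroid of every mode:
the Khatri-Rao product of the matrices with entries `exp (j (m - (M_r - 1)/2) μ_i^{(r)})`. -/
def steering {R d : ℕ} (M : Fin R → ℕ) (μ : Fin R → Fin d → ℝ) : Matrix (Idx M) (Fin d) ℂ :=
  Matrix.of fun m i =>
    ∏ r, Complex.exp (Complex.I * ((((m r : ℕ) : ℝ) - ((M r : ℝ) - 1) / 2) * μ r i : ℝ))

/-- `Ξ = Δ Ψ`: phase-reference shifts `δ^{(r)}` and rotation phases `φ_i` of the rectilinear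
(strictly non-circular) sources. -/
def phases {R d : ℕ} (μ : Fin R → Fin d → ℝ) (δ : Fin R → ℝ) (φ : Fin d → ℝ) :
    Matrix (Fin d) (Fin d) ℂ :=
  Matrix.diagonal fun i => Complex.exp (Complex.I * (φ i + ∑ r, δ r * μ r i : ℝ))

/-- Noise-free measurements `A S = Ā Δ Ψ S₀` with a real symbol matrix `S₀`. -/
def signal {R d N : ℕ} (M : Fin R → ℕ) (μ : Fin R → Fin d → ℝ) (δ : Fin R → ℝ) (φ : Fin d → ℝ)
    (S₀ : Matrix (Fin d) (Fin N) ℝ) : Matrix (Idx M) (Fin N) ℂ :=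
  steering M μ * phases μ δ φ * S₀.map (fun x : ℝ => (x : ℂ))

/-- The augmented (non-circular) measurement matrix `[X; Π X*]`. -/
def augment {R N : ℕ} {M : Fin R → ℕ} (X : Matrix (Idx M) (Fin N) ℂ) :
    Matrix (Idx M ⊕ Idx M) (Fin N) ℂ :=
  Matrix.fromRows X (exch revIdx * conjM X)

/-! ### Spatial smoothing -/

/-- Subarray sizes `M_r - L_r + 1`. -/
def subSize {R : ℕ} (M L : Fin R → ℕ) : Fin R → ℕ := fun r => M r - L r + 1

/-- Selection matrix of the `ℓ`-th subarray (`ℓ` is 0-based). -/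
def subarray {R : ℕ} (M L : Fin R → ℕ) (ℓ : Idx L) : Matrix (Idx (subSize M L)) (Idx M) ℂ :=
  kron fun r => sel (subSize M L r) (M r) (ℓ r)

/-- The spatially smoothed version `[ (I₂ ⊗ J_ℓ) Z ]_ℓ` of an augmented matrix `Z`. The columns are
indexed by the pairs (subarray, snapshot), the subarray being the more significant index. -/
def smooth {R N : ℕ} (M L : Fin R → ℕ) (Z : Matrix (Idx M ⊕ Idx M) (Fin N) ℂ) :
    Matrix (Idx (subSize M L) ⊕ Idx (subSize M L)) (Idx L × Fin N) ℂ :=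
  Matrix.of fun p c => (dbl (subarray M L c.1) * Z) p c.2

/-- The spatially smoothed non-circular data matrix computed from the measurements `X`. -/
def ssnc {R N : ℕ} (M L : Fin R → ℕ) (X : Matrix (Idx M) (Fin N) ℂ) :
    Matrix (Idx (subSize M L) ⊕ Idx (subSize M L)) (Idx L × Fin N) ℂ :=
  smooth M L (augment X)

/-- Grid sizes when the `r`-th mode of the grid `m` loses one element. -/
def shorten {R : ℕ} (m : Fin R → ℕ) (r : Fin R) : Fin R → ℕ := Function.update m r (m r - 1)

/-- `I ⊗ J_k^{(r)} ⊗ I` on a grid of size `m`, selecting in the `r`-th mode all elements but the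
last (`k = 0`), respectively all elements but the first (`k = 1`). -/
def shiftSel {R : ℕ} (m : Fin R → ℕ) (r : Fin R) (k : ℕ) :
    Matrix (Idx (shorten m r)) (Idx m) ℂ :=
  kron fun s => sel (shorten m r s) (m s) (if s = r then k else 0)

/-- The steering matrix of the augmented first subarray, `(I₂ ⊗ J_{1,…,1}) [Ā; Ā Ξ* Ξ*]`. -/
def steeringSS {R d : ℕ} (M L : Fin R → ℕ) (μ : Fin R → Fin d → ℝ) (δ : Fin R → ℝ)
    (φ : Fin d → ℝ) : Matrix (Idx (subSize M L) ⊕ Idx (subSize M L)) (Fin d) ℂ :=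
  dbl (kron fun r => sel (subSize M L r) (M r) 0) *
    Matrix.fromRows (steering M μ)
      (steering M μ * conjM (phases μ δ φ) * conjM (phases μ δ φ))

/-! ### Forward-backward averaging and the real-valued transformation -/

/-- FBA: `[X, Π X* Π]`. -/
def fba {ι κ : Type} [Fintype ι] [DecidableEq ι] [Fintype κ] [DecidableEq κ]
    (ρ : ι → ι) (τ : κ → κ) (X : Matrix ι κ ℂ) : Matrix ι (κ ⊕ κ) ℂ :=
  Matrix.fromCols X (exch ρ * conjM X * exch τ)

/-- FBA of the spatially smoothed non-circular data matrix. -/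
def ssncFBA {R N : ℕ} (M L : Fin R → ℕ) (X : Matrix (Idx M) (Fin N) ℂ) :
    Matrix (Idx (subSize M L) ⊕ Idx (subSize M L)) ((Idx L × Fin N) ⊕ (Idx L × Fin N)) ℂ :=
  fba (revSum revIdx) (Prod.map revIdx Fin.rev) (ssnc M L X)

/-- The sparse unitary left-`Π`-real matrix `2^{-1/2} [I, j I; Π, -j Π]` of even order, where `Π` is
the exchange matrix of `ρ`. -/
def leftReal {ι : Type} [DecidableEq ι] (ρ : ι → ι) : Matrix (ι ⊕ ι) (ι ⊕ ι) ℂ :=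
  ((Real.sqrt 2 : ℝ) : ℂ)⁻¹ •
    Matrix.fromBlocks 1 (Complex.I • (1 : Matrix ι ι ℂ)) (exch ρ) ((-Complex.I) • exch ρ)

/-- The transformed selection matrix `Qᴴ (I₂ ⊗ J₂^{(r)}) Q`. -/
def transSel {R : ℕ} (m : Fin R → ℕ) (r : Fin R) :
    Matrix (Idx (shorten m r) ⊕ Idx (shorten m r)) (Idx m ⊕ Idx m) ℂ :=
  (leftReal (revIdx : Idx (shorten m r) → Idx (shorten m r))).conjTranspose *
    dbl (shiftSel m r 1) * leftReal (revIdx : Idx m → Idx m)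

/-- `K₁^{(r)} = 2 Re (Qᴴ J₂ Q)`. -/
def realSel₁ {R : ℕ} (m : Fin R → ℕ) (r : Fin R) :
    Matrix (Idx (shorten m r) ⊕ Idx (shorten m r)) (Idx m ⊕ Idx m) ℝ :=
  (2 : ℝ) • (transSel m r).map Complex.re

/-- `K₂^{(r)} = 2 Im (Qᴴ J₂ Q)`. -/
def realSel₂ {R : ℕ} (m : Fin R → ℕ) (r : Fin R) :
    Matrix (Idx (shorten m r) ⊕ Idx (shorten m r)) (Idx m ⊕ Idx m) ℝ :=
  (2 : ℝ) • (transSel m r).map Complex.im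

/-! ### The building blocks of ESPRIT -/

section Blocks

variable {𝕜 : Type} [RCLike 𝕜]

/-- The columns of `U` are `d` dominant left singular vectors of `X`: they are orthonormal left
singular vectors with singular values `s i`, and no unit vector orthogonal to them has a gain
`‖Xᴴ w‖` above any `s i`. -/
def IsDominantLeftSingular {ι κ : Type} [Fintype ι] [Fintype κ] {d : ℕ}
    (X : Matrix ι κ 𝕜) (U : Matrix ι (Fin d) 𝕜) : Prop :=
  U.conjTranspose * U = 1 ∧
  ∃ s : Fin d → ℝ, (∀ i, 0 ≤ s i) ∧
    X * X.conjTranspose * U = U * Matrix.diagonal (fun i => ((s i ^ 2 : ℝ) : 𝕜)) ∧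
    ∀ w : ι → 𝕜, U.conjTranspose.mulVec w = 0 →
      ∀ i, ∑ k, ‖X.conjTranspose.mulVec w k‖ ^ 2 ≤ s i ^ 2 * ∑ k, ‖w k‖ ^ 2

/-- `B` is the Moore-Penrose pseudo-inverse of `A`. -/
def IsPseudoInverse {ι κ : Type} [Fintype ι] [Fintype κ]
    (A : Matrix ι κ 𝕜) (B : Matrix κ ι 𝕜) : Prop :=
  A * B * A = A ∧ B * A * B = B ∧
    (A * B).conjTranspose = A * B ∧ (B * A).conjTranspose = B * A

/-- `G` is the least squares solution `(J₁ U)⁺ J₂ U` of the shift invariance equation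
`J₁ U G ≈ J₂ U`. -/
def IsLSSolution {ι κ : Type} [Fintype ι] [Fintype κ] {d : ℕ}
    (J₁ J₂ : Matrix κ ι 𝕜) (U : Matrix ι (Fin d) 𝕜) (G : Matrix (Fin d) (Fin d) 𝕜) : Prop :=
  ∃ B : Matrix (Fin d) κ 𝕜, IsPseudoInverse (J₁ * U) B ∧ G = B * (J₂ * U)

/-- Non-singular matrices with columns of unit Euclidean norm. -/
def IsNormalizedBasis {d : ℕ} (T : Matrix (Fin d) (Fin d) 𝕜) : Prop :=
  IsUnit T.det ∧ ∀ j, ∑ i, ‖T i j‖ ^ 2 = 1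

/-- Energy of the off-diagonal entries of the matrices `T⁻¹ G_r T`. -/
def offEnergy {R d : ℕ} (G : Fin R → Matrix (Fin d) (Fin d) 𝕜) (T : Matrix (Fin d) (Fin d) 𝕜) :
    ℝ :=
  ∑ r, ∑ i, ∑ j, if i = j then 0 else ‖(T⁻¹ * G r * T) i j‖ ^ 2

/-- `lam r i` are the (automatically paired) eigenvalues of `G_1, …, G_R` delivered by a joint
eigendecomposition: the diagonals of `T⁻¹ G_r T`, where the common normalized basis `T` minimizes
the total off-diagonal energy. -/
def IsJointEigenvalues {R d : ℕ} (G : Fin R → Matrix (Fin d) (Fin d) 𝕜) (lam : Fin R → Fin d → 𝕜) :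
    Prop :=
  ∃ T : Matrix (Fin d) (Fin d) 𝕜, IsNormalizedBasis T ∧
    (∀ T' : Matrix (Fin d) (Fin d) 𝕜, IsNormalizedBasis T' → offEnergy G T ≤ offEnergy G T') ∧
    ∀ r i, lam r i = (T⁻¹ * G r * T) i i

end Blocks

/-! ### The algorithms

Each is the relation between the measurements `X` and the possible outputs `e` (`e r i` is the
estimate of the `i`-th frequency in the `r`-th mode, the order of the sources being arbitrary). -/

/-- Standard ESPRIT for a data matrix `Y` whose rows are those of the augmented subarray of
size `m`. -/
def StandardESPRIT {R d : ℕ} {κ : Type} [Fintype κ] (m : Fin R → ℕ)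
    (Y : Matrix (Idx m ⊕ Idx m) κ ℂ) (e : Fin R → Fin d → ℝ) : Prop :=
  ∃ (U : Matrix (Idx m ⊕ Idx m) (Fin d) ℂ) (G : Fin R → Matrix (Fin d) (Fin d) ℂ)
    (lam : Fin R → Fin d → ℂ),
    IsDominantLeftSingular Y U ∧
    (∀ r, IsLSSolution (dbl (shiftSel m r 0)) (dbl (shiftSel m r 1)) U (G r)) ∧
    IsJointEigenvalues G lam ∧
    ∀ r i, e r i = (lam r i).arg

/-- Spatially smoothed `R`-D NC Standard ESPRIT. -/
def NCStandardESPRIT {R d N : ℕ} (M L : Fin R → ℕ) (X : Matrix (Idx M) (Fin N) ℂ)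
    (e : Fin R → Fin d → ℝ) : Prop :=
  StandardESPRIT (subSize M L) (ssnc M L X) e

/-- Spatially smoothed `R`-D NC Standard ESPRIT with FBA preprocessing. -/
def NCStandardESPRITwithFBA {R d N : ℕ} (M L : Fin R → ℕ) (X : Matrix (Idx M) (Fin N) ℂ)
    (e : Fin R → Fin d → ℝ) : Prop :=
  StandardESPRIT (subSize M L) (ssncFBA M L X) e

/-- Spatially smoothed `R`-D NC Unitary ESPRIT: FBA, transformation of the resulting
centro-Hermitian matrix into the real matrix `Y = Qᴴ [X, Π X* Π] Q`, real subspace estimate, real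
shift invariance equations `K₁ E Υ ≈ K₂ E`, whose solution has the eigenvalues `tan (μ / 2)`. -/
def NCUnitaryESPRIT {R d N : ℕ} (M L : Fin R → ℕ) (X : Matrix (Idx M) (Fin N) ℂ)
    (e : Fin R → Fin d → ℝ) : Prop :=
  ∃ (Y : Matrix (Idx (subSize M L) ⊕ Idx (subSize M L)) ((Idx L × Fin N) ⊕ (Idx L × Fin N)) ℝ)
    (E : Matrix (Idx (subSize M L) ⊕ Idx (subSize M L)) (Fin d) ℝ)
    (G : Fin R → Matrix (Fin d) (Fin d) ℝ) (om : Fin R → Fin d → ℝ),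
    Y.map (fun x : ℝ => (x : ℂ)) =
      (leftReal (revIdx : Idx (subSize M L) → Idx (subSize M L))).conjTranspose *
        ssncFBA M L X *
        leftReal (Prod.map revIdx Fin.rev : Idx L × Fin N → Idx L × Fin N) ∧
    IsDominantLeftSingular Y E ∧
    (∀ r, IsLSSolution (realSel₁ (subSize M L) r) (realSel₂ (subSize M L) r) E (G r)) ∧
    IsJointEigenvalues G om ∧
    ∀ r i, e r i = 2 * Real.arctan (om r i)

/-! ### Asymptotic performance -/

/-- The sources in `e` are numbered so that the total squared error with respect to the true
frequencies `μ` is smallest. -/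
def IsMatched {R d : ℕ} (μ e : Fin R → Fin d → ℝ) : Prop :=
  ∀ p : Equiv.Perm (Fin d),
    ∑ r, ∑ i, (e r i - μ r i) ^ 2 ≤ ∑ r, ∑ i, (e r (p i) - μ r i) ^ 2

/-- `ν`: the norm of the spatially smoothed augmented noise. -/
def noiseLevel {R N : ℕ} (M L : Fin R → ℕ) (W : Matrix (Idx M) (Fin N) ℂ) : ℝ :=
  frob (ssnc M L W)

/-- The algorithm `alg` succeeds for all sufficiently small noise `W` on top of the noise-free
measurements `X₀`, and all its estimation errors are `l r i W + O(ν²)`. -/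
def HasFirstOrderError {R d N : ℕ} (M L : Fin R → ℕ) (μ : Fin R → Fin d → ℝ)
    (X₀ : Matrix (Idx M) (Fin N) ℂ)
    (alg : Matrix (Idx M) (Fin N) ℂ → (Fin R → Fin d → ℝ) → Prop)
    (l : Fin R → Fin d → Matrix (Idx M) (Fin N) ℂ →ₗ[ℝ] ℝ) : Prop :=
  ∃ ε > 0, ∃ C : ℝ, ∀ W : Matrix (Idx M) (Fin N) ℂ, noiseLevel M L W < ε →
    (∃ e, alg (X₀ + W) e) ∧
    ∀ e, alg (X₀ + W) e → IsMatched μ e →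
      ∀ r i, |e r i - μ r i - l r i W| ≤ C * noiseLevel M L W ^ 2

/-- `est` reports what `alg` delivers from the measurements `X`; should `alg` deliver nothing, the
reported angles are arbitrary. -/
def Reports {R d N : ℕ} {M : Fin R → ℕ} (μ : Fin R → Fin d → ℝ)
    (alg : Matrix (Idx M) (Fin N) ℂ → (Fin R → Fin d → ℝ) → Prop)
    (X : Matrix (Idx M) (Fin N) ℂ) (est : Fin R → Fin d → ℝ) : Prop :=
  (∀ r i, |est r i| ≤ Real.pi) ∧ ((∃ e, alg X e) → alg X est ∧ IsMatched μ est)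

/-- With measurements `X₀ + σ n`, where `n` is random, the mean square errors of the estimates
delivered by `alg` satisfy `E[(Δμ_i^{(r)})²] / σ² → v r i` as `σ → 0`. -/
def HasScaledMSE {R d N : ℕ} {M : Fin R → ℕ} (μ : Fin R → Fin d → ℝ)
    (X₀ : Matrix (Idx M) (Fin N) ℂ)
    (alg : Matrix (Idx M) (Fin N) ℂ → (Fin R → Fin d → ℝ) → Prop)
    {Ω : Type*} [MeasurableSpace Ω] (P : Measure Ω) (n : Ω → Matrix (Idx M) (Fin N) ℂ)
    (v : Fin R → Fin d → ENNReal) : Prop :=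
  ∀ est : ℝ → Ω → Fin R → Fin d → ℝ,
    (∀ σ > 0, ∀ ω, Reports μ alg (X₀ + σ • n ω) (est σ ω)) →
    ∀ r i, Tendsto
      (fun σ : ℝ => (∫⁻ ω, ENNReal.ofReal ((est σ ω r i - μ r i) ^ 2) ∂P) / ENNReal.ofReal (σ ^ 2))
      (𝓝[>] 0) (𝓝 (v r i))

end

end NCEsprit

open NCEsprit

/-! The noise-free smoothed data factor as `A B`, where `A = ncSteering` and `B = smoothedSymbols`
have rank `d`, and `J₂ A = J₁ A Λ` with `Λ = diag (exp (j μ))` in every mode. One perturbation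
analysis over an `RCLike` field serves the complex and the real algorithms (`esprit_expansion`). For
data `A B + W` the dominant subspace is spanned by the columns of `A + W B⁺ + O(ν²)`
(`dominant_subspace_expansion`). In that basis the least squares solution is `Λ + Δ`, where `Δ = (J₁
A)⁺ (J₂ W B⁺ - J₁ W B⁺ Λ) + O(ν²)` (`shift_invariance_expansion`). The choice of singular vectors
enters only through a well-conditioned change of basis `K`.

The normalized columns of `K⁻¹` have off-diagonal energy `O(ν²)`, hence so does every minimizer `T`.
Then `S = K T` intertwines `Λ + Δ` with nearly diagonal matrices. Since any two sources are
separated in some mode, `S` has one large entry per column and is `O(ν)` elsewhere, and the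
diagonals of `T⁻¹ G T` are `λ_i + Δ_ii + O(ν²)` up to numbering (`joint_eigenvalues_expansion`). The
derivative of `arg` or of `2 arctan` turns this into frequency errors, and minimality of the total
squared error fixes the numbering.

The augmented array is centro-symmetric, so forward-backward averaging only appends a column
permutation of the data and doubles the Gram matrix (`ssncFBA_eq`, `ssncFBA_gram`); the algorithm
with averaging is the same relation as the one without. The real-valued problem of NC Unitary ESPRIT
is the complex one seen through unitary matrices, with `z = exp (j μ)` replaced by its Cayley
transform `tan (μ / 2)`. Its first-order terms are multiplied by the derivative of that transform
(`shiftPerturbation_cayley`), and `2 arctan` undoes this by the chain rule (`im_div_exp_eq`). Both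
functionals are therefore `frequencyPerturbation`.

The mean square errors follow by dominated convergence: reported angles are bounded, and large noise
is charged to the second moment of `ν` (`tendsto_lintegral_sq_div_sq`).

Constants must be uniform over all possible outputs. This is achieved by stating the asymptotics
along arbitrary filters and applying them to the type of all runs of an algorithm, with the filter
pulled back by `comap`. -/

namespace NCEsprit

open Asymptotics Matrix

/-! ### Entrywise asymptotics of matrices -/

section EntrywiseBigO

variable {α ι κ τ 𝕜 : Type*} [RCLike 𝕜]

/-- All entries of `A` are `O(f)`. -/
def EntrywiseBigO (l : Filter α) (A : α → Matrix ι κ 𝕜) (f : α → ℝ) : Prop :=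
  ∀ i j, (fun x => A x i j) =O[l] f

namespace EntrywiseBigO

variable {l : Filter α} {A A' : α → Matrix ι κ 𝕜} {B : α → Matrix κ τ 𝕜} {f g : α → ℝ}

theorem const (A : Matrix ι κ 𝕜) : EntrywiseBigO l (fun _ => A) (fun _ => 1) :=
  fun _ _ => isBigO_const_const _ one_ne_zero _

theorem add (hA : EntrywiseBigO l A f) (hA' : EntrywiseBigO l A' f) :
    EntrywiseBigO l (fun x => A x + A' x) f :=
  fun i j => (hA i j).add (hA' i j)

theorem sub (hA : EntrywiseBigO l A f) (hA' : EntrywiseBigO l A' f) :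
    EntrywiseBigO l (fun x => A x - A' x) f :=
  fun i j => (hA i j).sub (hA' i j)

theorem mul [Fintype κ] (hA : EntrywiseBigO l A f) (hB : EntrywiseBigO l B g) :
    EntrywiseBigO l (fun x => A x * B x) (fun x => f x * g x) := fun i j => by
  simp only [Matrix.mul_apply]
  exact IsBigO.fun_sum fun k _ => (hA i k).mul (hB k j)

theorem mul_one_left [Fintype κ] (hA : EntrywiseBigO l A (fun _ => 1))
    (hB : EntrywiseBigO l B g) : EntrywiseBigO l (fun x => A x * B x) g := by
  simpa using hA.mul hB

theorem mul_one_right [Fintype κ] (hA : EntrywiseBigO l A f)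
    (hB : EntrywiseBigO l B (fun _ => 1)) : EntrywiseBigO l (fun x => A x * B x) f := by
  simpa using hA.mul hB

theorem conjTranspose (hA : EntrywiseBigO l A f) :
    EntrywiseBigO l (fun x => (A x)ᴴ) f := fun i j => by
  refine IsBigO.of_norm_left ?_
  simp only [conjTranspose_apply, norm_star]
  exact (hA j i).norm_left

theorem trans (hA : EntrywiseBigO l A f) (h : f =O[l] g) : EntrywiseBigO l A g :=
  fun i j => (hA i j).trans h

theorem congr' (hA : EntrywiseBigO l A f) (h : ∀ᶠ x in l, A x = A' x) : EntrywiseBigO l A' f :=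
  fun i j => (hA i j).congr' (h.mono fun x hx => by simp only [hx]) EventuallyEq.rfl

theorem diagonal [DecidableEq ι] {a : α → ι → 𝕜} (h : ∀ i, (fun x => a x i) =O[l] f) :
    EntrywiseBigO l (fun x => Matrix.diagonal (a x)) f := fun i j => by
  by_cases hij : i = j
  · subst hij; simpa using h i
  · simp only [Matrix.diagonal_apply_ne _ hij]; exact isBigO_zero _ _

/-- The row may depend on the point `x`; the sum over all rows dominates it. -/
theorem row_varying [Fintype ι] (hA : EntrywiseBigO l A f) (p : α → ι) (j : κ) :
    (fun x => A x (p x) j) =O[l] f := by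
  refine IsBigO.trans (IsBigO.of_bound 1 (Eventually.of_forall fun x => ?_))
    (IsBigO.fun_sum (s := Finset.univ) fun i _ => (hA i j).norm_left)
  rw [one_mul, Real.norm_of_nonneg (Finset.sum_nonneg fun i _ => norm_nonneg _)]
  exact Finset.single_le_sum (f := fun i => ‖A x i j‖) (fun i _ => norm_nonneg _)
    (Finset.mem_univ (p x))

theorem bounded_of_sub {A₀ : Matrix ι κ 𝕜} (hf : Tendsto f l (𝓝 0))
    (hA : EntrywiseBigO l (fun x => A x - A₀) f) : EntrywiseBigO l A (fun _ => 1) := by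
  have h := (hA.trans (hf.isBigO_one ℝ)).add (const A₀)
  simpa using h

theorem tendsto {A₀ : Matrix ι κ 𝕜} (hf : Tendsto f l (𝓝 0))
    (hA : EntrywiseBigO l (fun x => A x - A₀) f) : Tendsto A l (𝓝 A₀) := by
  refine tendsto_pi_nhds.2 fun i => tendsto_pi_nhds.2 fun j => ?_
  have h := (hA i j).trans_tendsto hf
  simp only [Matrix.sub_apply] at h
  exact tendsto_sub_nhds_zero_iff.1 h

variable [Fintype ι] [DecidableEq ι]

theorem eventually_isUnit_det {M : α → Matrix ι ι 𝕜} {M₀ : Matrix ι ι 𝕜} (hf : Tendsto f l (𝓝 0))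
    (hM : EntrywiseBigO l (fun x => M x - M₀) f) (h0 : IsUnit M₀.det) :
    ∀ᶠ x in l, IsUnit (M x).det := by
  have h := ((Continuous.matrix_det continuous_id).tendsto M₀).comp (hM.tendsto hf)
  filter_upwards [h.eventually_ne h0.ne_zero] with x hx
  exact isUnit_iff_ne_zero.2 hx

theorem inv_bounded {M : α → Matrix ι ι 𝕜} {M₀ : Matrix ι ι 𝕜} (hf : Tendsto f l (𝓝 0))
    (hM : EntrywiseBigO l (fun x => M x - M₀) f) (h0 : IsUnit M₀.det) :
    EntrywiseBigO l (fun x => (M x)⁻¹) (fun _ => 1) := fun i j => by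
  have hc : ContinuousAt Ring.inverse M₀.det := by
    simp only [Ring.inverse_eq_inv']
    exact continuousAt_inv₀ h0.ne_zero
  have h : Tendsto (fun x => (M x)⁻¹) l (𝓝 M₀⁻¹) :=
    (continuousAt_matrix_inv M₀ hc).tendsto.comp (hM.tendsto hf)
  exact ((tendsto_pi_nhds.1 ((tendsto_pi_nhds.1 h) i)) j).isBigO_one ℝ

/-- From `M⁻¹ - M₀⁻¹ = M⁻¹ (M - M₀) (-M₀⁻¹)`, valid as soon as `M x` is invertible. -/
theorem inv_sub {M : α → Matrix ι ι 𝕜} {M₀ : Matrix ι ι 𝕜} (hf : Tendsto f l (𝓝 0))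
    (hM : EntrywiseBigO l (fun x => M x - M₀) f) (h0 : IsUnit M₀.det) :
    EntrywiseBigO l (fun x => (M x)⁻¹ - M₀⁻¹) f := by
  have h := ((inv_bounded hf hM h0).mul_one_left hM).mul_one_right (const (-M₀⁻¹))
  refine h.congr' ?_
  filter_upwards [eventually_isUnit_det hf hM h0] with x hx
  rw [mul_sub, nonsing_inv_mul _ hx, sub_mul, mul_assoc, mul_neg, mul_neg, mul_nonsing_inv _ h0]
  simp [sub_eq_add_neg, add_comm]

end EntrywiseBigO

/-- The numbering of the eigenvalues varies with the point `x` but takes finitely many values, so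
estimates may be proved along each of its level sets. -/
theorem isBigO_of_finite_cases {β E F : Type*} [Finite β] [Norm E] [SeminormedAddCommGroup F]
    {l : Filter α} {f : α → E} {g : α → F} (p : α → β)
    (h : ∀ b, f =O[l ⊓ 𝓟 {x | p x = b}] g) : f =O[l] g := by
  cases nonempty_fintype β
  choose c hc using fun b => (h b).bound
  refine IsBigO.of_bound (∑ b, |c b|) ?_
  have h2 : ∀ᶠ x in l, ∀ b, p x = b → ‖f x‖ ≤ c b * ‖g x‖ :=
    eventually_all.2 fun b => eventually_inf_principal.1 (hc b)
  filter_upwards [h2] with x hx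
  refine (hx _ rfl).trans (mul_le_mul_of_nonneg_right ((le_abs_self _).trans ?_) (norm_nonneg _))
  exact Finset.single_le_sum (f := fun b => |c b|) (fun b _ => abs_nonneg _) (Finset.mem_univ _)

theorem isBigO_inv_one {E : Type*} [NormedDivisionRing E] {l : Filter α} {f : α → E}
    (h : (fun _ => (1 : ℝ)) =O[l] f) : (fun x => (f x)⁻¹) =O[l] fun _ => (1 : ℝ) := by
  have := h.inv_rev (Eventually.of_forall fun x hx => absurd hx one_ne_zero)
  simpa using this

end EntrywiseBigO

/-! ### Perturbation of joint eigenvalues -/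

section JointEigenvalues

variable {α : Type*} {𝕜 : Type} [RCLike 𝕜] {l : Filter α} {ν : α → ℝ} {R d : ℕ}

/-- Telescoping: the error of a product of nearly diagonal factors is `M_b (∏ - D) + (M_b - D_b) D`.
Boundedness of the diagonal products is carried along because the induction needs it. -/
theorem list_prod_sub_diagonal {β : Type*} (hν : Tendsto ν l (𝓝 0))
    (M : α → β → Matrix (Fin d) (Fin d) 𝕜) (a : α → β → Fin d → 𝕜) (L : List β)
    (ha : ∀ b k, (fun x => a x b k) =O[l] fun _ => (1 : ℝ))
    (hM : ∀ b, EntrywiseBigO l (fun x => M x b - diagonal (a x b)) ν) :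
    EntrywiseBigO l (fun x => (L.map (M x)).prod -
      diagonal fun k => (L.map fun b => a x b k).prod) ν ∧
    ∀ k, (fun x => (L.map fun b => a x b k).prod) =O[l] fun _ => (1 : ℝ) := by
  induction L with
  | nil =>
    refine ⟨fun i j => ?_, fun k => by
      simpa using isBigO_const_const (1 : 𝕜) (one_ne_zero (α := ℝ)) l⟩
    simp only [List.map_nil, List.prod_nil, Matrix.diagonal_one, sub_self, Matrix.zero_apply]
    exact isBigO_zero _ _
  | cons b L ih =>
    obtain ⟨ih1, ih2⟩ := ih
    have ih2' : ∀ k, (fun x => ((b :: L).map fun b => a x b k).prod) =O[l] fun _ => (1 : ℝ) := by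
      intro k
      simpa using (ha b k).mul (ih2 k)
    refine ⟨?_, ih2'⟩
    have hMb : EntrywiseBigO l (fun x => M x b) fun _ => 1 := by
      have := ((hM b).trans (hν.isBigO_one ℝ)).add (EntrywiseBigO.diagonal (ha b))
      simpa using this
    have h := (hMb.mul_one_left ih1).add ((hM b).mul_one_right (EntrywiseBigO.diagonal ih2))
    refine h.congr' (Eventually.of_forall fun x => ?_)
    simp only [List.map_cons, List.prod_cons, mul_sub, sub_mul, diagonal_mul_diagonal]
    abel

theorem list_prod_mul_intertwine {ι β : Type*} [Fintype ι] [DecidableEq ι]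
    (M M' : β → Matrix ι ι 𝕜) (S : Matrix ι ι 𝕜)
    (h : ∀ b, M b * S = S * M' b) (L : List β) :
    (L.map M).prod * S = S * (L.map M').prod := by
  induction L with
  | nil => simp
  | cons b L ih => simp only [List.map_cons, List.prod_cons]; rw [mul_assoc, ih, ← mul_assoc, h,
      mul_assoc]

/-- Off-diagonal part of `T⁻¹ G T`. -/
theorem entry_sq_le_offEnergy (G : Fin R → Matrix (Fin d) (Fin d) 𝕜)
    (T : Matrix (Fin d) (Fin d) 𝕜) (r : Fin R) {i j : Fin d} (hij : i ≠ j) :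
    ‖(T⁻¹ * G r * T) i j‖ ^ 2 ≤ offEnergy G T := by
  have hn : ∀ r i j, 0 ≤ (if i = j then (0 : ℝ) else ‖(T⁻¹ * G r * T) i j‖ ^ 2) := by
    intro r i j; split_ifs <;> positivity
  calc ‖(T⁻¹ * G r * T) i j‖ ^ 2 = (if i = j then (0 : ℝ) else ‖(T⁻¹ * G r * T) i j‖ ^ 2) := by
        simp [hij]
    _ ≤ ∑ j, (if i = j then (0 : ℝ) else ‖(T⁻¹ * G r * T) i j‖ ^ 2) :=
        Finset.single_le_sum (f := fun j => if i = j then (0 : ℝ) else ‖(T⁻¹ * G r * T) i j‖ ^ 2)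
          (fun j _ => hn r i j) (Finset.mem_univ j)
    _ ≤ ∑ i, ∑ j, (if i = j then (0 : ℝ) else ‖(T⁻¹ * G r * T) i j‖ ^ 2) :=
        Finset.single_le_sum
          (f := fun i => ∑ j, if i = j then (0 : ℝ) else ‖(T⁻¹ * G r * T) i j‖ ^ 2)
          (fun i _ => Finset.sum_nonneg fun j _ => hn r i j) (Finset.mem_univ i)
    _ ≤ _ := Finset.single_le_sum
          (f := fun r => ∑ i, ∑ j, if i = j then (0 : ℝ) else ‖(T⁻¹ * G r * T) i j‖ ^ 2)
          (fun r _ => Finset.sum_nonneg fun i _ => Finset.sum_nonneg fun j _ => hn r i j)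
          (Finset.mem_univ r)

theorem isBigO_one_comp {β : Type*} [Finite β] (c : β → 𝕜) (p : α → β) :
    (fun x => c (p x)) =O[l] fun _ => (1 : ℝ) := by
  cases nonempty_fintype β
  refine IsBigO.of_bound (∑ b, ‖c b‖) (Eventually.of_forall fun x => ?_)
  simpa using Finset.single_le_sum (f := fun b => ‖c b‖) (fun b _ => norm_nonneg _)
    (Finset.mem_univ (p x))

/-- If matrices with small off-diagonal parts are similar to a perturbation of diagonal matrices
with distinct joint eigenvalues, and their diagonals are close to selected joint eigenvalues, then
every joint eigenvalue is selected. -/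
theorem eventually_surjective_of_similar (hν : Tendsto ν l (𝓝 0)) {lam : Fin R → Fin d → 𝕜}
    (hsep : ∀ i j, (∀ r, lam r i = lam r j) → i = j)
    {H H' : α → Fin R → Matrix (Fin d) (Fin d) 𝕜} {S : α → Matrix (Fin d) (Fin d) 𝕜}
    (hS : ∀ᶠ x in l, IsUnit (S x).det) (hHS : ∀ r, ∀ᶠ x in l, H x r * S x = S x * H' x r)
    (hH : ∀ r, EntrywiseBigO l (fun x => H x r - diagonal (lam r)) ν) (p : α → Fin d → Fin d)
    (hH' : ∀ r, EntrywiseBigO l (fun x => H' x r - diagonal fun j => lam r (p x j)) ν) :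
    ∀ᶠ x in l, Function.Surjective (p x) := by
  have key : ∀ i', ∀ᶠ x in l, ∃ j, p x j = i' := by
    intro i'
    -- Each other source `b` differs from `i'` in some mode `r b`. The product over `b` of `H_{r b}
    -- - λ_{r b, b}` acts as a joint Lagrange polynomial: on the unperturbed diagonals it vanishes
    -- at every index but `i'`.
    have hex : ∀ b : {i // i ≠ i'}, ∃ r, lam r i' ≠ lam r b := by
      intro b
      by_contra! hcon
      exact b.2 (hsep _ _ fun r => (hcon r).symm)
    choose r hr using hex
    set L : List {i // i ≠ i'} := Finset.univ.toList
    have h1 := (list_prod_sub_diagonal (l := l) hν (fun x (b : {i // i ≠ i'}) => H x (r b) -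
      diagonal fun _ => lam (r b) b) (fun _ b k => lam (r b) k - lam (r b) b) L
      (fun b k => isBigO_const_const _ one_ne_zero _) (fun b => by
        refine (hH (r b)).congr' (Eventually.of_forall fun x => ?_)
        rw [sub_sub, diagonal_add]
        simp)).1
    have h2 := (list_prod_sub_diagonal (l := l) hν (fun x (b : {i // i ≠ i'}) => H' x (r b) -
      diagonal fun _ => lam (r b) b) (fun x b k => lam (r b) (p x k) - lam (r b) b) L
      (fun b k => (isBigO_one_comp (lam (r b)) fun x => p x k).sub
        (isBigO_const_const _ one_ne_zero _)) (fun b => by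
        refine (hH' (r b)).congr' (Eventually.of_forall fun x => ?_)
        rw [sub_sub, diagonal_add]
        simp)).1
    set c : 𝕜 := (L.map fun b => lam (r b) i' - lam (r b) b).prod with hc
    have hc0 : c ≠ 0 := by
      refine List.prod_ne_zero fun h => ?_
      obtain ⟨b, -, hb⟩ := List.mem_map.1 h
      exact hr b (sub_eq_zero.1 hb)
    -- The trace of this product is invariant under the similarity `S`: it is near `c` on one side,
    -- and near the sum over the selected indices `p x j` on the other.
    have htr : (fun x => c - ∑ j, (L.map fun b => lam (r b) (p x j) - lam (r b) b).prod)
        =O[l] ν := by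
      have h3 : (fun x => ∑ i, (((L.map fun b => H' x (r b) - diagonal fun _ => lam (r b) b).prod -
          diagonal fun k => (L.map fun b => lam (r b) (p x k) - lam (r b) b).prod) i i -
          ((L.map fun b => H x (r b) - diagonal fun _ => lam (r b) b).prod -
          diagonal fun k => (L.map fun b => lam (r b) k - lam (r b) b).prod) i i)) =O[l] ν :=
        IsBigO.fun_sum fun i _ => (h2 i i).sub (h1 i i)
      refine h3.congr' ?_ EventuallyEq.rfl
      filter_upwards [hS, eventually_all.2 hHS] with x hx hx2
      have h4 := list_prod_mul_intertwine (fun b : {i // i ≠ i'} => H x (r b) -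
        diagonal fun _ => lam (r b) b) (fun b => H' x (r b) - diagonal fun _ => lam (r b) b) (S x)
        (fun b => by
          rw [sub_mul, mul_sub, hx2]
          congr 1
          ext i j
          simp [mul_comm]) L
      have h5 : (L.map fun b => H x (r b) - diagonal fun _ => lam (r b) b).prod.trace =
          (L.map fun b => H' x (r b) - diagonal fun _ => lam (r b) b).prod.trace := by
        rw [← mul_nonsing_inv_cancel_right (S x) (L.map fun b => H x (r b) -
          diagonal fun _ => lam (r b) b).prod hx, h4, mul_assoc, trace_mul_comm, mul_assoc,
          nonsing_inv_mul _ hx, mul_one]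
      have h6 : ∑ k, (L.map fun b => lam (r b) k - lam (r b) b).prod = c := by
        refine Finset.sum_eq_single i' (fun k _ hk => ?_) (by simp)
        refine List.prod_eq_zero (List.mem_map.2 ⟨⟨k, hk⟩, by simp [L], by simp⟩)
      simp only [Matrix.trace, Matrix.diag] at h5
      simp only [Matrix.sub_apply, diagonal_apply_eq, Finset.sum_sub_distrib, h5, h6]
      ring
    have h7 : Tendsto (fun x => ∑ j, (L.map fun b => lam (r b) (p x j) - lam (r b) b).prod) l
        (𝓝 c) := by
      have := (htr.trans_tendsto hν).const_sub c
      simpa using this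
    -- A nonzero sum has a nonzero term, and the `j`-th term vanishes unless `p x j = i'`.
    filter_upwards [h7.eventually_ne hc0] with x hx
    obtain ⟨j, -, hj⟩ := Finset.exists_ne_zero_of_sum_ne_zero hx
    refine ⟨j, ?_⟩
    by_contra hne
    exact hj (List.prod_eq_zero (List.mem_map.2 ⟨⟨p x j, hne⟩, by simp [L], by simp⟩))
  exact eventually_all.2 key

end JointEigenvalues
end NCEsprit

namespace NCEsprit

open Asymptotics Matrix
-- First-order expansion of approximate joint eigenvalues.
section JointEigenvalues

variable {α : Type*} {𝕜 : Type} [RCLike 𝕜] {l : Filter α} {ν : α → ℝ} {R d : ℕ}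

theorem entrywiseBigO_of_isNormalizedBasis {T : α → Matrix (Fin d) (Fin d) 𝕜}
    (hT : ∀ᶠ x in l, IsNormalizedBasis (T x)) : EntrywiseBigO l T fun _ => 1 := by
  intro i j
  refine IsBigO.of_bound 1 (hT.mono fun x hx => ?_)
  have h := hx.2 j
  have h2 := Finset.single_le_sum (f := fun i => ‖T x i j‖ ^ 2) (fun i _ => by positivity)
    (Finset.mem_univ i)
  simp only [h] at h2
  rw [norm_one, mul_one]
  exact (sq_le_one_iff₀ (norm_nonneg _)).1 h2

/-- In every column of `S = K T`, with `T` normalized, some entry is bounded away from zero. -/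
theorem exists_pivot {K T : α → Matrix (Fin d) (Fin d) 𝕜}
    (hKu : ∀ᶠ x in l, IsUnit (K x).det) (hK' : EntrywiseBigO l (fun x => (K x)⁻¹) fun _ => 1)
    (hT : ∀ᶠ x in l, IsNormalizedBasis (T x)) :
    ∃ p : α → Fin d → Fin d, ∀ j,
      (fun _ => (1 : ℝ)) =O[l] fun x => (K x * T x) (p x j) j := by
  have hex : ∀ x j, ∃ i, ∀ k, ‖(K x * T x) k j‖ ≤ ‖(K x * T x) i j‖ := fun x j =>
    haveI : Nonempty (Fin d) := ⟨j⟩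
    Finite.exists_max fun k => ‖(K x * T x) k j‖
  choose p hp using hex
  refine ⟨p, fun j => ?_⟩
  have hS : ∀ k, (fun x => (K x * T x) k j) =O[l] fun x => (K x * T x) (p x j) j := fun k =>
    IsBigO.of_bound 1 (Eventually.of_forall fun x => by simpa using hp x j k)
  -- The pivot is the entry of largest modulus in its column of `S = K T`. It dominates the column
  -- of `T = K⁻¹ S`, which has norm one.
  have hTS : ∀ i, (fun x => T x i j) =O[l] fun x => (K x * T x) (p x j) j := by
    intro i
    have h : (fun x => ∑ k, (K x)⁻¹ i k * (K x * T x) k j) =O[l]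
        fun x => (K x * T x) (p x j) j := by
      refine IsBigO.fun_sum fun k _ => ?_
      have := (hK' i k).norm_right.mul (hS k).norm_right
      simpa using this
    refine h.congr' ?_ EventuallyEq.rfl
    filter_upwards [hKu] with x hx
    rw [← Matrix.mul_apply, nonsing_inv_mul_cancel_left _ _ hx]
  have hsum : (fun x => ∑ i, ‖T x i j‖ ^ 2) =O[l] fun x => ‖(K x * T x) (p x j) j‖ ^ 2 :=
    IsBigO.fun_sum fun i _ => ((hTS i).norm_norm).pow 2
  have h1 : (fun _ => (1 : ℝ) ^ 2) =O[l] fun x => ‖(K x * T x) (p x j) j‖ ^ 2 :=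
    hsum.congr' (hT.mono fun x hx => by simpa using hx.2 j) EventuallyEq.rfl
  exact (h1.of_pow two_ne_zero).of_norm_right

theorem mul_split_entry {A B : Matrix (Fin d) (Fin d) 𝕜} (i j k : Fin d) :
    (A * B) i j = A i k * B k j + ∑ k' ∈ Finset.univ.erase k, A i k' * B k' j := by
  rw [Matrix.mul_apply]
  exact (Finset.add_sum_erase _ (fun k => A i k * B k j) (Finset.mem_univ k)).symm

/-- First-order expansion of approximate joint eigenvalues: let `K G_r K⁻¹` be a perturbation `Δ_r`
of the diagonal matrices of pairwise distinct joint eigenvalues. If the off-diagonal energy of the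
matrices `T⁻¹ G_r T` is of second order, then `T⁻¹` is bounded, and the diagonals are, up to
numbering, the perturbed eigenvalues up to a second-order error. -/
theorem joint_eigenvalues_expansion (hν : Tendsto ν l (𝓝 0)) {lam : Fin R → Fin d → 𝕜}
    (hsep : ∀ i j, (∀ r, lam r i = lam r j) → i = j)
    {K T : α → Matrix (Fin d) (Fin d) 𝕜} {G Δ : α → Fin R → Matrix (Fin d) (Fin d) 𝕜}
    (hKu : ∀ᶠ x in l, IsUnit (K x).det) (hK : EntrywiseBigO l K fun _ => 1)
    (hK' : EntrywiseBigO l (fun x => (K x)⁻¹) fun _ => 1)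
    (hG : ∀ r, ∀ᶠ x in l, K x * G x r = (diagonal (lam r) + Δ x r) * K x)
    (hΔ : ∀ r, EntrywiseBigO l (fun x => Δ x r) ν)
    (hT : ∀ᶠ x in l, IsNormalizedBasis (T x))
    (hE : (fun x => offEnergy (G x) (T x)) =O[l] fun x => ν x ^ 2) :
    EntrywiseBigO l (fun x => (T x)⁻¹) (fun _ => 1) ∧
    ∃ p : α → Fin d → Fin d, (∀ᶠ x in l, Function.Bijective (p x)) ∧
      ∀ r j, (fun x => ((T x)⁻¹ * G x r * T x) j j - lam r (p x j) - Δ x r (p x j) (p x j))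
        =O[l] fun x => ν x ^ 2 := by
  obtain ⟨p, hp1⟩ := exists_pivot hKu hK' hT
  have hp := fun j => isBigO_inv_one (hp1 j)
  have hTb := entrywiseBigO_of_isNormalizedBasis hT
  set S : α → Matrix (Fin d) (Fin d) 𝕜 := fun x => K x * T x with hS
  set H : α → Fin R → Matrix (Fin d) (Fin d) 𝕜 := fun x r => (T x)⁻¹ * G x r * T x with hH
  set E : α → Fin R → Matrix (Fin d) (Fin d) 𝕜 :=
    fun x r => H x r - diagonal fun j => H x r j j with hEdef
  have hSb : EntrywiseBigO l S fun _ => 1 := hK.mul_one_left hTb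
  have hE1 : ∀ r, EntrywiseBigO l (fun x => E x r) ν := by
    intro r i j
    by_cases hij : i = j
    · subst hij
      simp only [E, Matrix.sub_apply, diagonal_apply_eq, sub_self]
      exact isBigO_zero _ _
    · simp only [E, Matrix.sub_apply, diagonal_apply_ne _ hij, sub_zero]
      refine IsBigO.of_pow two_ne_zero (IsBigO.trans (IsBigO.of_bound 1
        (Eventually.of_forall fun x => ?_)) hE)
      simp only [Pi.pow_apply, norm_pow, one_mul]
      exact (entry_sq_le_offEnergy (G x) (T x) r hij).trans (le_abs_self _)
  have hSu : ∀ᶠ x in l, IsUnit (S x).det := by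
    filter_upwards [hKu, hT] with x hx hx2
    rw [hS, det_mul]
    exact hx.mul hx2.1
  have hint : ∀ r, ∀ᶠ x in l, (diagonal (lam r) + Δ x r) * S x = S x * H x r := by
    intro r
    filter_upwards [hG r, hT] with x hx hx2
    simp only [hS, hH]
    rw [← mul_assoc, ← hx, mul_assoc (K x) (T x), ← mul_assoc (T x), mul_nonsing_inv_cancel_left _ _
      hx2.1, mul_assoc]
  -- the entries of the intertwining relation
  have hent : ∀ r, ∀ᶠ x in l, ∀ i j, (H x r j j - lam r i) * S x i j =
      (Δ x r * S x) i j - (S x * E x r) i j := by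
    intro r
    filter_upwards [hint r] with x hx i j
    have h := congrFun (congrFun hx i) j
    have h2 : H x r = (diagonal fun j => H x r j j) + E x r := by simp [E]
    rw [h2] at h
    rw [add_mul, mul_add, Matrix.add_apply, Matrix.add_apply, diagonal_mul, mul_diagonal] at h
    linear_combination -h
  have hΔS : ∀ r, EntrywiseBigO l (fun x => Δ x r * S x) ν := fun r => (hΔ r).mul_one_right hSb
  have hSE : ∀ r, EntrywiseBigO l (fun x => S x * E x r) ν := fun r => hSb.mul_one_left (hE1 r)
  have hne : ∀ᶠ x in l, ∀ j, S x (p x j) j ≠ 0 :=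
    eventually_all.2 fun j => (hp1 j).eq_zero_imp.mono fun x hx h0 => one_ne_zero (hx h0)
  -- Dividing the entry relation by the pivot, which is bounded below, puts each diagonal entry of
  -- `H` within `O(ν)` of the eigenvalue selected by `p`.
  have hD : ∀ r j, (fun x => H x r j j - lam r (p x j)) =O[l] ν := by
    intro r j
    have h := (((hΔS r).sub (hSE r)).row_varying (fun x => p x j) j).mul (hp j)
    refine h.congr' ?_ (Eventually.of_forall fun x => mul_one _)
    filter_upwards [hent r, hne] with x hx hx2
    rw [Matrix.sub_apply, ← hx, mul_inv_cancel_right₀ (hx2 j)]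
  have hbij : ∀ᶠ x in l, Function.Bijective (p x) := by
    have h := eventually_surjective_of_similar (H := fun x r => diagonal (lam r) + Δ x r) (H' := H)
      hν hsep hSu hint (fun r => by simpa using hΔ r) p (fun r => by
        refine ((hE1 r).add (EntrywiseBigO.diagonal (hD r))).congr'
          (Eventually.of_forall fun x => ?_)
        simp only [E, ← diagonal_sub]
        abel)
    exact h.mono fun x hx => ⟨Finite.injective_iff_surjective.2 hx, hx⟩
  -- fix the numbering
  have hcase : ∀ q : Fin d → Fin d, ∀ᶠ x in l ⊓ 𝓟 {x | p x = q}, p x = q := fun q =>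
    eventually_inf_principal.2 (Eventually.of_forall fun _ h => h)
  have hle : ∀ q : Fin d → Fin d, l ⊓ 𝓟 {x | p x = q} ≤ l := fun q => inf_le_left
  -- Some mode separates `i` from `q j`. There `H_jj - λ_i` tends to a nonzero limit, so the entry
  -- relation makes `S i j` of order `ν`.
  have hoff : ∀ q i j, i ≠ q j → (fun x => S x i j) =O[l ⊓ 𝓟 {x | p x = q}] ν := by
    intro q i j hij
    obtain ⟨r, hr⟩ : ∃ r, lam r i ≠ lam r (q j) := by
      by_contra! h
      exact hij (hsep _ _ h)
    have hlim : Tendsto (fun x => H x r j j - lam r i) (l ⊓ 𝓟 {x | p x = q})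
        (𝓝 (lam r (q j) - lam r i)) := by
      have h := (((hD r j).mono (hle q)).trans_tendsto (hν.mono_left (hle q))).add_const
        (lam r (q j) - lam r i)
      rw [zero_add] at h
      refine h.congr' ((hcase q).mono fun x hx => ?_)
      simp only [hx]
      ring
    have hne' : lam r (q j) - lam r i ≠ 0 := sub_ne_zero.2 hr.symm
    have h := ((((hΔS r).sub (hSE r)) i j).mono (hle q)).mul ((hlim.inv₀ hne').isBigO_one ℝ)
    refine h.congr' ?_ (Eventually.of_forall fun x => mul_one _)
    filter_upwards [(hent r).filter_mono (hle q), hlim.eventually_ne hne'] with x hx hx2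
    rw [Matrix.sub_apply, ← hx, mul_comm, inv_mul_cancel_left₀ hx2]
  have hqbij : ∀ q : Fin d → Fin d, ∀ᶠ x in l ⊓ 𝓟 {x | p x = q}, Function.Bijective q := fun q => by
    filter_upwards [hbij.filter_mono (hle q), hcase q] with x hx hx2
    rwa [← hx2]
  refine ⟨fun i j => isBigO_of_finite_cases p fun q => ?_, p, hbij, fun r j =>
    isBigO_of_finite_cases p fun q => ?_⟩
  -- A numbering `q` that is not bijective is eventually excluded, so its case is vacuous.
  · by_cases hq : Function.Bijective q
    swap
    · refine IsBigO.of_bound 1 ((hqbij q).mono fun x hx => absurd hx hq)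
    have hpq : ∀ j, (fun x => (S x (q j) j)⁻¹) =O[l ⊓ 𝓟 {x | p x = q}] fun _ => (1 : ℝ) :=
      fun j => ((hp j).mono (hle q)).congr' ((hcase q).mono fun x hx => by simp only [S, hx])
        EventuallyEq.rfl
    -- The rows of `K`, permuted by `q` and divided by the pivots, form an approximate left inverse
    -- of `T`; this bounds `T⁻¹`.
    have hND : EntrywiseBigO (l ⊓ 𝓟 {x | p x = q}) (fun x => diagonal (fun j => (S x (q j) j)⁻¹) *
        (K x).submatrix q id) fun _ => 1 :=
      (EntrywiseBigO.diagonal hpq).mul_one_left fun i j => (hK (q i) j).mono (hle q)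
    have hM : EntrywiseBigO (l ⊓ 𝓟 {x | p x = q}) (fun x =>
        (diagonal (fun j => (S x (q j) j)⁻¹) * (K x).submatrix q id) * T x - 1) ν := by
      have hent' : ∀ x i j, ((diagonal (fun j => (S x (q j) j)⁻¹) * (K x).submatrix q id) * T x) i j
          = (S x (q i) i)⁻¹ * S x (q i) j := by
        intro x i j
        rw [mul_assoc, diagonal_mul]
        simp [S, Matrix.mul_apply]
      intro i j
      by_cases hij : i = j
      · subst hij
        refine IsBigO.congr' (isBigO_zero (E' := 𝕜) ν _) ?_ EventuallyEq.rfl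
        filter_upwards [hne.filter_mono (hle q), hcase q] with x hx hx2
        have := hx i
        rw [hx2] at this
        rw [Matrix.sub_apply, hent', one_apply_eq, inv_mul_cancel₀ this, sub_self]
      · simp only [Matrix.sub_apply, hent', one_apply_ne hij, sub_zero]
        have h := (hpq i).mul (hoff q (q i) j fun h => hij (hq.1 h))
        simpa using h
    have hinv := (EntrywiseBigO.inv_bounded (hν.mono_left (hle q)) hM (by simp)).mul_one_left hND
    have hu := EntrywiseBigO.eventually_isUnit_det (hν.mono_left (hle q)) hM (by simp)
    refine (hinv i j).congr' ?_ EventuallyEq.rfl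
    filter_upwards [hu, hT.filter_mono (hle q)] with x hx hx2
    rw [← mul_nonsing_inv_cancel_right (T x) ((diagonal (fun j => (S x (q j) j)⁻¹) *
      (K x).submatrix q id * T x)⁻¹ * _) hx2.1, mul_assoc _ _ (T x), nonsing_inv_mul _ hx, one_mul]
  · by_cases hq : Function.Bijective q
    swap
    · refine IsBigO.of_bound 1 ((hqbij q).mono fun x hx => absurd hx hq)
    set l' := l ⊓ 𝓟 {x | p x = q} with hl'
    -- In the relation at the pivot position `(q j, j)`, the diagonal entry of `Δ` is split off and
    -- `E` has zero diagonal. Every remaining product has two factors of order `ν`.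
    have h1 : (fun x => ∑ k ∈ Finset.univ.erase (q j), Δ x r (q j) k * S x k j) =O[l']
        fun x => ν x * ν x :=
      IsBigO.fun_sum fun k hk => ((hΔ r _ _).mono (hle q)).mul (hoff q _ _ (Finset.ne_of_mem_erase hk))
    have h2 : (fun x => ∑ k ∈ Finset.univ.erase j, S x (q j) k * E x r k j) =O[l']
        fun x => ν x * ν x :=
      IsBigO.fun_sum fun k hk => (hoff q _ _ fun h => Finset.ne_of_mem_erase hk (hq.1 h.symm)).mul
        ((hE1 r _ _).mono (hle q))
    have h3 := (h1.sub h2).mul ((hp j).mono (hle q))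
    refine h3.congr' ?_ (Eventually.of_forall fun x => by ring)
    filter_upwards [(hent r).filter_mono (hle q), hne.filter_mono (hle q), hcase q] with x hx hx2 hx3
    have hx4 := hx2 j
    have h4 := hx (q j) j
    rw [hx3] at hx4 ⊢
    rw [mul_split_entry (q j) j (q j), mul_split_entry (q j) j j] at h4
    have h5 : E x r j j = 0 := by simp [E]
    rw [h5, mul_zero, zero_add] at h4
    have h6 : ∑ k ∈ Finset.univ.erase (q j), Δ x r (q j) k * S x k j -
        ∑ k ∈ Finset.univ.erase j, S x (q j) k * E x r k j =
        (H x r j j - lam r (q j) - Δ x r (q j) (q j)) * S x (q j) j := by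
      linear_combination -h4
    rw [h6]
    exact mul_inv_cancel_right₀ hx4 _

end JointEigenvalues
end NCEsprit

namespace NCEsprit

open Asymptotics Matrix
-- Existence and expansion of the minimizers of the off-diagonal energy.
section JointEigenvalues

variable {α : Type*} {𝕜 : Type} [RCLike 𝕜] {l : Filter α} {ν : α → ℝ} {R d : ℕ}

theorem offEnergy_nonneg (G : Fin R → Matrix (Fin d) (Fin d) 𝕜) (T : Matrix (Fin d) (Fin d) 𝕜) :
    0 ≤ offEnergy G T :=
  Finset.sum_nonneg fun r _ => Finset.sum_nonneg fun i _ => Finset.sum_nonneg fun j _ => by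
    split_ifs <;> positivity

/-- The normalized columns of `K⁻¹` have an off-diagonal energy of second order. -/
theorem exists_small_offEnergy {lam : Fin R → Fin d → 𝕜}
    {K : α → Matrix (Fin d) (Fin d) 𝕜} {G Δ : α → Fin R → Matrix (Fin d) (Fin d) 𝕜}
    (hKu : ∀ᶠ x in l, IsUnit (K x).det) (hK : EntrywiseBigO l K fun _ => 1)
    (hK' : EntrywiseBigO l (fun x => (K x)⁻¹) fun _ => 1)
    (hG : ∀ r, ∀ᶠ x in l, K x * G x r = (diagonal (lam r) + Δ x r) * K x)
    (hΔ : ∀ r, EntrywiseBigO l (fun x => Δ x r) ν) :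
    ∃ T₀ : α → Matrix (Fin d) (Fin d) 𝕜, (∀ᶠ x in l, IsNormalizedBasis (T₀ x)) ∧
      (fun x => offEnergy (G x) (T₀ x)) =O[l] fun x => ν x ^ 2 := by
  set c : α → Fin d → ℝ := fun x j => Real.sqrt (∑ i, ‖(K x)⁻¹ i j‖ ^ 2) with hc
  have hle : ∀ x i j, ‖(K x)⁻¹ i j‖ ≤ c x j := fun x i j => by
    refine Real.le_sqrt_of_sq_le ?_
    exact Finset.single_le_sum (f := fun i => ‖(K x)⁻¹ i j‖ ^ 2) (fun i _ => by positivity)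
      (Finset.mem_univ i)
  have hc1 : ∀ j, (fun x => c x j) =O[l] fun _ => (1 : ℝ) := by
    intro j
    refine IsBigO.of_pow two_ne_zero ?_
    have h : (fun x => ∑ i, ‖(K x)⁻¹ i j‖ ^ 2) =O[l] fun _ => (1 : ℝ) ^ 2 :=
      IsBigO.fun_sum fun i _ => (hK' i j).norm_left.pow 2
    refine h.congr' (Eventually.of_forall fun x => ?_) EventuallyEq.rfl
    simp only [hc, Pi.pow_apply]
    rw [Real.sq_sqrt (by positivity)]
  -- The diagonal entry `1 = (K K⁻¹)_jj` bounds the column norms of `K⁻¹` from below.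
  have hc2 : ∀ j, (fun _ => (1 : ℝ)) =O[l] fun x => c x j := by
    intro j
    have h : (fun x => ∑ i, K x j i * (K x)⁻¹ i j) =O[l] fun x => c x j := by
      refine IsBigO.fun_sum fun i _ => ?_
      have := (hK j i).mul (IsBigO.of_bound 1 (Eventually.of_forall fun x => by
        simpa using (hle x i j).trans (le_abs_self _)) : (fun x => (K x)⁻¹ i j) =O[l] fun x => c x j)
      simpa using this
    refine (h.norm_left).congr' ?_ EventuallyEq.rfl
    filter_upwards [hKu] with x hx
    rw [← Matrix.mul_apply, mul_nonsing_inv _ hx, one_apply_eq, norm_one]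
  have hc3 : ∀ᶠ x in l, ∀ j, c x j ≠ 0 :=
    eventually_all.2 fun j => (hc2 j).eq_zero_imp.mono fun x hx h0 => one_ne_zero (hx h0)
  have hc4 := fun j => isBigO_inv_one (hc2 j)
  set T₀ : α → Matrix (Fin d) (Fin d) 𝕜 :=
    fun x => (K x)⁻¹ * diagonal fun j => ((c x j : ℝ) : 𝕜)⁻¹ with hT₀
  have hu : ∀ᶠ x in l, IsUnit (T₀ x).det := by
    filter_upwards [hKu, hc3] with x hx hx2
    rw [hT₀, det_mul, det_diagonal]
    refine (isUnit_nonsing_inv_det _ hx).mul (isUnit_iff_ne_zero.2 ?_)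
    exact Finset.prod_ne_zero_iff.2 fun j _ => inv_ne_zero (by exact_mod_cast hx2 j)
  refine ⟨T₀, ?_, ?_⟩
  · filter_upwards [hu, hc3] with x hx hx2
    refine ⟨hx, fun j => ?_⟩
    simp only [hT₀, mul_diagonal, norm_mul, mul_pow, ← Finset.sum_mul, norm_inv,
      RCLike.norm_ofReal, inv_pow, sq_abs]
    have h : ∑ i, ‖(K x)⁻¹ i j‖ ^ 2 = c x j ^ 2 := by
      simp only [hc]
      rw [Real.sq_sqrt (by positivity)]
    rw [h, mul_inv_cancel₀ (pow_ne_zero 2 (hx2 j))]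
  · refine IsBigO.fun_sum fun r _ => IsBigO.fun_sum fun i _ => IsBigO.fun_sum fun j _ => ?_
    by_cases hij : i = j
    · simp only [hij, if_true]; exact isBigO_zero _ _
    simp only [hij, if_false]
    -- Conjugation by the normalized columns gives off-diagonal entries of modulus `c_i |Δ_ij| /
    -- c_j`.
    have h : (fun x => c x i * ‖Δ x r i j‖ * (c x j)⁻¹) =O[l] ν := by
      have := ((hc1 i).mul (hΔ r i j).norm_left).mul (hc4 j)
      simpa using this
    refine (h.pow 2).congr' ?_ EventuallyEq.rfl
    filter_upwards [hKu, hc3, hG r] with x hx hx2 hx3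
    have hinv : (T₀ x)⁻¹ = (diagonal fun j => ((c x j : ℝ) : 𝕜)) * K x := by
      refine inv_eq_right_inv ?_
      rw [hT₀, mul_assoc, ← mul_assoc (diagonal _) (diagonal _), diagonal_mul_diagonal]
      have : (diagonal fun i => ((c x i : ℝ) : 𝕜)⁻¹ * ((c x i : ℝ) : 𝕜)) = 1 := by
        rw [← diagonal_one]
        congr 1
        ext i
        exact inv_mul_cancel₀ (by exact_mod_cast hx2 i)
      rw [this, one_mul, nonsing_inv_mul _ hx]
    rw [hinv, mul_assoc (diagonal _), hx3, hT₀, ← mul_assoc, ← mul_assoc,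
      mul_nonsing_inv_cancel_right _ _ hx, mul_diagonal, diagonal_mul, Matrix.add_apply,
      diagonal_apply_ne _ hij, zero_add, norm_mul, norm_mul, norm_inv, RCLike.norm_ofReal,
      RCLike.norm_ofReal, abs_of_nonneg (Real.sqrt_nonneg _), abs_of_nonneg (Real.sqrt_nonneg _)]

/-- A minimizer exists if the inverses of all candidates of low energy are bounded. -/
theorem exists_minimizer_of_bounded (G : Fin R → Matrix (Fin d) (Fin d) 𝕜)
    {T₀ : Matrix (Fin d) (Fin d) 𝕜} (hT₀ : IsNormalizedBasis T₀) {C : ℝ}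
    (hC : ∀ T, IsNormalizedBasis T → offEnergy G T ≤ offEnergy G T₀ → ∀ i j, ‖T⁻¹ i j‖ ≤ C) :
    ∃ T, IsNormalizedBasis T ∧ ∀ T', IsNormalizedBasis T' → offEnergy G T ≤ offEnergy G T' := by
  -- Minimizing over pairs `(T, V)` with `V T = 1` keeps invertibility in the limit: bounded pairs
  -- form a compact set, and the energy is continuous in the pair.
  set s : Set (Matrix (Fin d) (Fin d) 𝕜 × Matrix (Fin d) (Fin d) 𝕜) :=
    ({T | ∀ i, T i ∈ {v : Fin d → 𝕜 | ∀ j, v j ∈ Metric.closedBall (0 : 𝕜) 1}} ×ˢ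
      {V | ∀ i, V i ∈ {v : Fin d → 𝕜 | ∀ j, v j ∈ Metric.closedBall (0 : 𝕜) C}}) ∩
      ({y | y.2 * y.1 = 1} ∩ {y | ∀ j, ∑ i, ‖y.1 i j‖ ^ 2 = 1}) with hs
  have hcomp : ∀ c : ℝ, IsCompact {T : Matrix (Fin d) (Fin d) 𝕜 |
      ∀ i, T i ∈ {v : Fin d → 𝕜 | ∀ j, v j ∈ Metric.closedBall (0 : 𝕜) c}} := fun c =>
    isCompact_pi_infinite fun _ => isCompact_pi_infinite fun _ => isCompact_closedBall _ _
  have hentry : ∀ i j, Continuous fun y : Matrix (Fin d) (Fin d) 𝕜 × Matrix (Fin d) (Fin d) 𝕜 =>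
      y.1 i j := fun i j => continuous_fst.matrix_elem i j
  have hscomp : IsCompact s := by
    refine ((hcomp 1).prod (hcomp C)).inter_right (IsClosed.inter ?_ ?_)
    · exact isClosed_eq (continuous_snd.matrix_mul continuous_fst) continuous_const
    · rw [show {y : Matrix (Fin d) (Fin d) 𝕜 × Matrix (Fin d) (Fin d) 𝕜 |
          ∀ j, ∑ i, ‖y.1 i j‖ ^ 2 = 1} = ⋂ j, {y | ∑ i, ‖y.1 i j‖ ^ 2 = 1} by ext; simp]
      exact isClosed_iInter fun j =>
        isClosed_eq (continuous_finsetSum _ fun i _ => (hentry i j).norm.pow 2) continuous_const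
  have hmem : ∀ T, IsNormalizedBasis T → offEnergy G T ≤ offEnergy G T₀ → (T, T⁻¹) ∈ s := by
    intro T hT hle
    refine ⟨⟨fun i j => ?_, fun i j => by simpa using hC T hT hle i j⟩, nonsing_inv_mul _ hT.1, hT.2⟩
    have h2 := Finset.single_le_sum (f := fun i => ‖T i j‖ ^ 2) (fun i _ => by positivity)
      (Finset.mem_univ i)
    simp only [hT.2 j] at h2
    simpa using (sq_le_one_iff₀ (norm_nonneg _)).1 h2
  have hcont : Continuous fun y : Matrix (Fin d) (Fin d) 𝕜 × Matrix (Fin d) (Fin d) 𝕜 =>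
      ∑ r, ∑ i, ∑ j, if i = j then (0 : ℝ) else ‖(y.2 * G r * y.1) i j‖ ^ 2 := by
    refine continuous_finsetSum _ fun r _ => continuous_finsetSum _ fun i _ =>
      continuous_finsetSum _ fun j _ => ?_
    split_ifs
    · exact continuous_const
    · exact ((((continuous_snd.matrix_mul continuous_const).matrix_mul
        continuous_fst).matrix_elem i j).norm).pow 2
  obtain ⟨y, hy, hmin⟩ := hscomp.exists_isMinOn ⟨_, hmem T₀ hT₀ le_rfl⟩ hcont.continuousOn
  have hinv : ∀ y ∈ s, y.1⁻¹ = y.2 := fun y hy => inv_eq_left_inv hy.2.1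
  have hval : ∀ y ∈ s, (∑ r, ∑ i, ∑ j, if i = j then (0 : ℝ) else ‖(y.2 * G r * y.1) i j‖ ^ 2) =
      offEnergy G y.1 := fun y hy => by rw [← hinv y hy]; rfl
  have hle : ∀ T', IsNormalizedBasis T' → offEnergy G T' ≤ offEnergy G T₀ →
      offEnergy G y.1 ≤ offEnergy G T' := fun T' hT' hT'0 => by
    have h := hmin (hmem T' hT' hT'0)
    simp only [Set.mem_ofPred_eq] at h
    rwa [hval y hy, hval _ (hmem T' hT' hT'0)] at h
  refine ⟨y.1, ⟨?_, hy.2.2⟩, fun T' hT' => ?_⟩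
  · exact isUnit_det_of_left_inverse hy.2.1
  · rcases le_total (offEnergy G T') (offEnergy G T₀) with h | h
    · exact hle T' hT' h
    · exact (hle T₀ hT₀ le_rfl).trans h

/-- The joint eigenvalues of a perturbation of matrices with pairwise distinct joint eigenvalues
exist, and they have the first-order expansion known from the simultaneous diagonalization. -/
theorem isJointEigenvalues_expansion (hν : Tendsto ν l (𝓝 0)) {lam : Fin R → Fin d → 𝕜}
    (hsep : ∀ i j, (∀ r, lam r i = lam r j) → i = j)
    {K : α → Matrix (Fin d) (Fin d) 𝕜} {G Δ : α → Fin R → Matrix (Fin d) (Fin d) 𝕜}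
    (hKu : ∀ᶠ x in l, IsUnit (K x).det) (hK : EntrywiseBigO l K fun _ => 1)
    (hK' : EntrywiseBigO l (fun x => (K x)⁻¹) fun _ => 1)
    (hG : ∀ r, ∀ᶠ x in l, K x * G x r = (diagonal (lam r) + Δ x r) * K x)
    (hΔ : ∀ r, EntrywiseBigO l (fun x => Δ x r) ν) :
    (∀ᶠ x in l, ∃ z : Fin R → Fin d → 𝕜, IsJointEigenvalues (G x) z) ∧
    ∀ z : α → Fin R → Fin d → 𝕜, (∀ᶠ x in l, IsJointEigenvalues (G x) (z x)) →
      ∃ p : α → Fin d → Fin d, (∀ᶠ x in l, Function.Bijective (p x)) ∧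
      ∀ r j, (fun x => z x r j - lam r (p x j) - Δ x r (p x j) (p x j)) =O[l] fun x => ν x ^ 2 := by
  obtain ⟨T₀, hT₀, hE₀⟩ := exists_small_offEnergy hKu hK hK' hG hΔ
  constructor
  -- The points of `α'` are all competitors no worse than `T₀`. The expansion along the pulled-back
  -- filter bounds their inverses uniformly, as the compactness argument requires.
  · set α' := {y : α × Matrix (Fin d) (Fin d) 𝕜 //
      IsNormalizedBasis y.2 ∧ offEnergy (G y.1) y.2 ≤ offEnergy (G y.1) (T₀ y.1)}
    set φ : α' → α := fun y => y.1.1 with hφ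
    have ht : Tendsto φ (comap φ l) l := tendsto_comap
    have h := (joint_eigenvalues_expansion (l := comap φ l) (ν := ν ∘ φ) (K := K ∘ φ)
      (T := fun y : α' => y.1.2) (G := G ∘ φ) (Δ := Δ ∘ φ) (hν.comp ht) hsep (ht.eventually hKu)
      (fun i j => (hK i j).comp_tendsto ht) (fun i j => (hK' i j).comp_tendsto ht)
      (fun r => ht.eventually (hG r)) (fun r i j => (hΔ r i j).comp_tendsto ht)
      (Eventually.of_forall fun y => y.2.1)
      (IsBigO.trans (IsBigO.of_bound 1 (Eventually.of_forall fun y => by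
        rw [one_mul, Real.norm_of_nonneg (offEnergy_nonneg _ _)]
        refine le_trans ?_ (le_abs_self _)
        exact y.2.2)) (hE₀.comp_tendsto ht))).1
    choose c hc using fun i j => (h i j).bound
    have hb : ∀ᶠ y in comap φ l, ∀ i j, ‖(y.1.2)⁻¹ i j‖ ≤ ∑ i, ∑ j, |c i j| := by
      refine eventually_all.2 fun i => eventually_all.2 fun j => (hc i j).mono fun y hy => ?_
      rw [norm_one, mul_one] at hy
      refine (hy.trans (le_abs_self _)).trans ?_
      exact (Finset.single_le_sum (f := fun j => |c i j|) (fun j _ => abs_nonneg _)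
        (Finset.mem_univ j)).trans (Finset.single_le_sum (f := fun i => ∑ j, |c i j|)
        (fun i _ => Finset.sum_nonneg fun j _ => abs_nonneg _) (Finset.mem_univ i))
    filter_upwards [eventually_comap.1 hb, hT₀] with x hx hx2
    obtain ⟨T, hT, hmin⟩ := exists_minimizer_of_bounded (G x) hx2
      fun T hT hle => hx ⟨(x, T), hT, hle⟩ rfl
    exact ⟨fun r i => (T⁻¹ * G x r * T) i i, T, hT, hmin, fun _ _ => rfl⟩
  · intro z hz
    choose! T hT' using fun x (h : IsJointEigenvalues (G x) (z x)) => h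
    have hT := hz.mono hT'
    -- A minimizer is no worse than `T₀`, so its energy is `O(ν²)` as well.
    obtain ⟨-, p, hp, hexp⟩ := joint_eigenvalues_expansion hν hsep hKu hK hK' hG hΔ
      (hT.mono fun x hx => hx.1) (IsBigO.trans (IsBigO.of_bound 1 (by
        filter_upwards [hT, hT₀] with x hx hx2
        rw [one_mul, Real.norm_of_nonneg (offEnergy_nonneg _ _)]
        refine le_trans ?_ (le_abs_self _)
        exact hx.2.1 _ hx2)) hE₀)
    refine ⟨p, hp, fun r j => (hexp r j).congr' ?_ EventuallyEq.rfl⟩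
    filter_upwards [hT] with x hx
    rw [hx.2.2]

end JointEigenvalues
end NCEsprit

namespace NCEsprit

open Asymptotics Matrix

/-! ### Dominant left singular vectors -/

section SingularVectors

variable {𝕜 : Type} [RCLike 𝕜] {ι κ : Type} [Fintype ι] [Fintype κ] {d : ℕ}

theorem sum_norm_sq_eq_dotProduct {β : Type*} [Fintype β] (v : β → 𝕜) :
    ((∑ k, ‖v k‖ ^ 2 : ℝ) : 𝕜) = star v ⬝ᵥ v := by
  simp [dotProduct, RCLike.conj_mul]

theorem sum_norm_sq_conjTranspose_mulVec (X : Matrix ι κ 𝕜) (w : ι → 𝕜) :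
    ((∑ k, ‖(Xᴴ *ᵥ w) k‖ ^ 2 : ℝ) : 𝕜) = star w ⬝ᵥ (X * Xᴴ) *ᵥ w := by
  rw [sum_norm_sq_eq_dotProduct, star_mulVec, conjTranspose_conjTranspose, ← mulVec_mulVec,
    ← dotProduct_mulVec]

/-- The gain of a vector in the span of the complement and of a single dominant left singular
vector. -/
theorem gain_le_of_orthogonal {X : Matrix ι κ 𝕜} {U : Matrix ι (Fin d) 𝕜} (hU : Uᴴ * U = 1)
    {s : Fin d → ℝ} (hs : X * Xᴴ * U = U * diagonal fun i => ((s i ^ 2 : ℝ) : 𝕜))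
    (hdom : ∀ w : ι → 𝕜, Uᴴ *ᵥ w = 0 →
      ∀ i, ∑ k, ‖(Xᴴ *ᵥ w) k‖ ^ 2 ≤ s i ^ 2 * ∑ k, ‖w k‖ ^ 2)
    (i : Fin d) (w : ι → 𝕜) (hw : ∀ j, j ≠ i → (Uᴴ *ᵥ w) j = 0) :
    ∑ k, ‖(Xᴴ *ᵥ w) k‖ ^ 2 ≤ s i ^ 2 * ∑ k, ‖w k‖ ^ 2 := by
  set a : Fin d → 𝕜 := Uᴴ *ᵥ w with ha
  set u := U *ᵥ a with hu
  -- The vector `w` splits into `w'`, orthogonal to all dominant vectors, and `u` along the `i`-th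
  -- of them. Since `X Xᴴ u = s_i² u`, norms and gains add without cross terms.
  set w' := w - u with hw'
  have hUw' : Uᴴ *ᵥ w' = 0 := by
    rw [hw', mulVec_sub, hu, mulVec_mulVec, hU, one_mulVec, sub_self]
  have hMu : (X * Xᴴ) *ᵥ u = ((s i ^ 2 : ℝ) : 𝕜) • u := by
    rw [hu, mulVec_mulVec, hs, ← mulVec_mulVec, ← mulVec_smul]
    congr 1
    ext j
    rw [mulVec_diagonal, Pi.smul_apply, smul_eq_mul]
    by_cases hj : j = i
    · rw [hj]
    · rw [hw j hj, mul_zero, mul_zero]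
  have h1 : star w' ⬝ᵥ u = 0 := by
    rw [hu, dotProduct_mulVec, ← conjTranspose_conjTranspose U, ← star_mulVec, hUw']
    simp
  have h2 : star u ⬝ᵥ w' = 0 := by
    rw [star_dotProduct, h1, star_zero]
  have h3 : star u ⬝ᵥ (X * Xᴴ) *ᵥ w' = 0 := by
    have : (X * Xᴴ)ᴴ = X * Xᴴ := by simp
    rw [dotProduct_mulVec, ← this, ← star_mulVec, hMu, star_smul, smul_dotProduct, h2, smul_zero]
  have hww : w = w' + u := by rw [hw']; abel
  have e1 : ((∑ k, ‖(Xᴴ *ᵥ w) k‖ ^ 2 : ℝ) : 𝕜) = ((∑ k, ‖(Xᴴ *ᵥ w') k‖ ^ 2 : ℝ) : 𝕜) +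
      ((s i ^ 2 * ∑ k, ‖u k‖ ^ 2 : ℝ) : 𝕜) := by
    rw [RCLike.ofReal_mul, sum_norm_sq_conjTranspose_mulVec, sum_norm_sq_conjTranspose_mulVec,
      sum_norm_sq_eq_dotProduct]
    rw [congrArg (fun v => star v ⬝ᵥ (X * Xᴴ) *ᵥ v) hww]
    rw [star_add, mulVec_add, dotProduct_add, add_dotProduct, add_dotProduct, h3, hMu,
      dotProduct_smul, dotProduct_smul, h1, smul_zero, add_zero, zero_add, smul_eq_mul]
  have e2 : ((∑ k, ‖w k‖ ^ 2 : ℝ) : 𝕜) = ((∑ k, ‖w' k‖ ^ 2 : ℝ) : 𝕜) +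
      ((∑ k, ‖u k‖ ^ 2 : ℝ) : 𝕜) := by
    rw [sum_norm_sq_eq_dotProduct, sum_norm_sq_eq_dotProduct, sum_norm_sq_eq_dotProduct]
    rw [congrArg (fun v => star v ⬝ᵥ v) hww]
    rw [star_add, dotProduct_add, add_dotProduct, add_dotProduct, h1, h2, add_zero, zero_add]
  have e1' : ∑ k, ‖(Xᴴ *ᵥ w) k‖ ^ 2 = ∑ k, ‖(Xᴴ *ᵥ w') k‖ ^ 2 + s i ^ 2 * ∑ k, ‖u k‖ ^ 2 := by
    exact_mod_cast e1
  have e2' : ∑ k, ‖w k‖ ^ 2 = ∑ k, ‖w' k‖ ^ 2 + ∑ k, ‖u k‖ ^ 2 := by exact_mod_cast e2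
  rw [e1', e2', mul_add]
  exact add_le_add (hdom w' hUw' i) le_rfl

variable {α : Type*} {l : Filter α} {ν : α → ℝ}

theorem entrywiseBigO_of_orthonormal {U : α → Matrix ι (Fin d) 𝕜}
    (hU : ∀ᶠ x in l, (U x)ᴴ * U x = 1) : EntrywiseBigO l U fun _ => 1 := by
  intro i j
  refine IsBigO.of_bound 1 (hU.mono fun x hx => ?_)
  have h : ((∑ i, ‖U x i j‖ ^ 2 : ℝ) : 𝕜) = 1 := by
    rw [sum_norm_sq_eq_dotProduct fun i => U x i j]
    have := congrFun (congrFun hx j) j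
    rw [one_apply_eq] at this
    rw [← this]
    rfl
  have h' : ∑ i, ‖U x i j‖ ^ 2 = 1 := by exact_mod_cast h
  have h2 := Finset.single_le_sum (f := fun i => ‖U x i j‖ ^ 2) (fun i _ => by positivity)
    (Finset.mem_univ i)
  simp only [h'] at h2
  rw [norm_one, mul_one]
  exact (sq_le_one_iff₀ (norm_nonneg _)).1 h2

/-- The dominant singular values of a perturbation of `A B`, both factors of full rank `d`, stay
away from zero. -/
theorem dominant_singularValue_inv_bounded [DecidableEq ι] (hν : Tendsto ν l (𝓝 0))
    {A : Matrix ι (Fin d) 𝕜} {B : Matrix (Fin d) κ 𝕜}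
    (hA : IsUnit (Aᴴ * A).det) (hB : IsUnit (B * Bᴴ).det) {W : α → Matrix ι κ 𝕜}
    (hW : EntrywiseBigO l W ν) {U : α → Matrix ι (Fin d) 𝕜} {s : α → Fin d → ℝ}
    (hU : ∀ᶠ x in l, (U x)ᴴ * U x = 1) (hs0 : ∀ᶠ x in l, ∀ i, 0 ≤ s x i)
    (hs : ∀ᶠ x in l, (A * B + W x) * (A * B + W x)ᴴ * U x =
      U x * diagonal fun i => ((s x i ^ 2 : ℝ) : 𝕜))
    (hdom : ∀ᶠ x in l, ∀ w : ι → 𝕜, (U x)ᴴ *ᵥ w = 0 →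
      ∀ i, ∑ k, ‖((A * B + W x)ᴴ *ᵥ w) k‖ ^ 2 ≤ s x i ^ 2 * ∑ k, ‖w k‖ ^ 2) (i : Fin d) :
    (fun _ => (1 : ℝ)) =O[l] fun x => s x i := by
  -- As in the Courant-Fischer principle: the `d - 1` orthogonality conditions on `d` unknowns have
  -- a unit solution `y`. Zeroing row `i` of `Uᴴ A` gives a singular square matrix whose kernel
  -- consists of these solutions.
  have hex : ∀ x, ∃ y : Matrix (Fin d) Unit 𝕜, ∑ k, ‖y k ()‖ ^ 2 = 1 ∧
      ∀ j, j ≠ i → ((U x)ᴴ *ᵥ (A *ᵥ fun k => y k ())) j = 0 := by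
    intro x
    have hdet : (((U x)ᴴ * A).updateRow i 0).det = 0 :=
      det_eq_zero_of_row_eq_zero i (by simp)
    obtain ⟨v, hv0, hv⟩ := exists_mulVec_eq_zero_iff.2 hdet
    set c := ∑ k, ‖v k‖ ^ 2 with hc
    have hcpos : 0 < c := by
      obtain ⟨k, hk⟩ := Function.ne_iff.1 hv0
      exact Finset.sum_pos' (fun k _ => by positivity) ⟨k, Finset.mem_univ _, by
        have : 0 < ‖v k‖ := norm_pos_iff.2 hk
        positivity⟩
    refine ⟨Matrix.of fun k _ => ((Real.sqrt c)⁻¹ : 𝕜) * v k, ?_, fun j hj => ?_⟩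
    · simp only [of_apply, norm_mul, mul_pow, norm_inv, RCLike.norm_ofReal, inv_pow, sq_abs,
        ← Finset.mul_sum]
      rw [Real.sq_sqrt hcpos.le, ← hc, inv_mul_cancel₀ hcpos.ne']
    · have h := congrFun hv j
      have h2 : (fun k => (Matrix.of fun k (_ : Unit) => ((Real.sqrt c)⁻¹ : 𝕜) * v k) k ()) =
          ((Real.sqrt c)⁻¹ : 𝕜) • v := rfl
      rw [h2, mulVec_smul, mulVec_smul, mulVec_mulVec, Pi.smul_apply]
      have h3 : (((U x)ᴴ * A) *ᵥ v) j = 0 := by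
        refine Eq.trans ?_ h
        simp only [mulVec, updateRow_ne hj]
      rw [h3, smul_zero]
  choose y hy1 hy2 using hex
  set X : α → Matrix ι κ 𝕜 := fun x => A * B + W x with hX
  have hyb : EntrywiseBigO l y fun _ => 1 := by
    intro k j
    refine IsBigO.of_bound 1 (Eventually.of_forall fun x => ?_)
    have h2 := Finset.single_le_sum (f := fun i => ‖y x i ()‖ ^ 2) (fun i _ => by positivity)
      (Finset.mem_univ k)
    simp only [hy1 x] at h2
    rw [norm_one, mul_one]
    exact (sq_le_one_iff₀ (norm_nonneg _)).1 h2
  have hAy : EntrywiseBigO l (fun x => A * y x) fun _ => 1 :=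
    (EntrywiseBigO.const A).mul_one_left hyb
  have hsq : (fun x => ∑ k, ‖(A * y x) k ()‖ ^ 2) =O[l] fun _ => (1 : ℝ) := by
    have : (fun x => ∑ k, ‖(A * y x) k ()‖ ^ 2) =O[l] fun _ => (1 : ℝ) ^ 2 :=
      IsBigO.fun_sum fun k _ => (hAy k ()).norm_left.pow 2
    simpa using this
  have hXw : EntrywiseBigO l (fun x => (X x)ᴴ * (A * y x)) fun x => s x i := by
    intro k j
    refine IsBigO.of_pow two_ne_zero ?_
    have h1 : (fun x => s x i ^ 2 * ∑ k, ‖(A * y x) k ()‖ ^ 2) =O[l] fun x => s x i ^ 2 := by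
      simpa using (isBigO_refl (fun x => s x i ^ 2) l).mul hsq
    refine IsBigO.trans (IsBigO.of_bound 1 ?_) h1
    filter_upwards [hU, hs, hdom] with x hx1 hx2 hx3
    have h := gain_le_of_orthogonal hx1 hx2 hx3 i (A *ᵥ fun k => y x k ()) (hy2 x)
    rw [one_mul, Pi.pow_apply, norm_pow, Real.norm_of_nonneg
      (mul_nonneg (sq_nonneg _) (Finset.sum_nonneg fun _ _ => sq_nonneg _))]
    exact (Finset.single_le_sum (f := fun k => ‖((X x)ᴴ *ᵥ (A *ᵥ fun k => y x k ())) k‖ ^ 2)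
      (fun i _ => by positivity) (Finset.mem_univ k)).trans h
  -- `H` is a left inverse of `(A B)ᴴ A`, so `y = H Xᴴ A y - H Wᴴ A y` is `O(s_i + ν)`. As `y` has
  -- norm one and `ν` tends to zero, `s_i` stays away from zero.
  set H : Matrix (Fin d) κ 𝕜 := (Aᴴ * A)⁻¹ * ((B * Bᴴ)⁻¹ * B) with hH
  have hHX : ∀ x, y x = H * ((X x)ᴴ * (A * y x)) - H * ((W x)ᴴ * (A * y x)) := by
    intro x
    rw [← Matrix.mul_sub, ← Matrix.sub_mul]
    have : (X x)ᴴ - (W x)ᴴ = Bᴴ * Aᴴ := by simp [hX]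
    rw [this, hH]
    have h2 : (Aᴴ * A)⁻¹ * ((B * Bᴴ)⁻¹ * B) * (Bᴴ * Aᴴ * (A * y x)) =
        (Aᴴ * A)⁻¹ * ((B * Bᴴ)⁻¹ * ((B * Bᴴ) * ((Aᴴ * A) * y x))) := by
      simp only [Matrix.mul_assoc]
    rw [h2, nonsing_inv_mul_cancel_left _ _ hB, nonsing_inv_mul_cancel_left _ _ hA]
  have hsle : (fun x => s x i) =O[l] fun x => s x i + ‖ν x‖ :=
    IsBigO.of_bound 1 (hs0.mono fun x hx => by
      rw [one_mul, Real.norm_of_nonneg (hx i),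
        Real.norm_of_nonneg (add_nonneg (hx i) (norm_nonneg _))]
      exact le_add_of_nonneg_right (norm_nonneg _))
  have hνle : ν =O[l] fun x => s x i + ‖ν x‖ :=
    IsBigO.of_bound 1 (hs0.mono fun x hx => by
      rw [one_mul, Real.norm_of_nonneg (add_nonneg (hx i) (norm_nonneg _))]
      exact le_add_of_nonneg_left (hx i))
  have hy : EntrywiseBigO l y fun x => s x i + ‖ν x‖ := by
    have h1 := ((EntrywiseBigO.const H).mul_one_left hXw).trans hsle
    have h2 := ((EntrywiseBigO.const H).mul_one_left (hW.conjTranspose.mul_one_right hAy)).trans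
      hνle
    exact (h1.sub h2).congr' (Eventually.of_forall fun x => (hHX x).symm)
  have h1 : (fun _ => (1 : ℝ)) =O[l] fun x => s x i + ‖ν x‖ := by
    refine IsBigO.of_pow two_ne_zero ?_
    have h : (fun x => ∑ k, ‖y x k ()‖ ^ 2) =O[l] fun x => (s x i + ‖ν x‖) ^ 2 :=
      IsBigO.fun_sum fun k _ => (hy k ()).norm_left.pow 2
    refine h.congr' (Eventually.of_forall fun x => ?_) EventuallyEq.rfl
    simp only [hy1 x, Pi.pow_apply, one_pow]
  obtain ⟨c, hc, hb⟩ := h1.exists_pos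
  -- Once `‖ν‖ < 1 / (2 c)`, the bound `1 ≤ c (s_i + ‖ν‖)` leaves `1 / 2 ≤ c s_i`.
  refine IsBigO.of_bound (2 * c) ?_
  have hν' : ∀ᶠ x in l, ‖ν x‖ < 1 / (2 * c) :=
    (tendsto_zero_iff_norm_tendsto_zero.1 hν).eventually_lt_const (by positivity)
  filter_upwards [hb.bound, hν', hs0] with x hx1 hx2 hx3
  rw [Real.norm_of_nonneg (add_nonneg (hx3 i) (norm_nonneg _)), norm_one, mul_add] at hx1
  rw [norm_one, Real.norm_of_nonneg (hx3 i)]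
  have h3 : c * ‖ν x‖ < 1 / 2 := by
    calc c * ‖ν x‖ < c * (1 / (2 * c)) := mul_lt_mul_of_pos_left hx2 hc
      _ = 1 / 2 := by field_simp
  linarith

end SingularVectors
end NCEsprit

namespace NCEsprit

open Asymptotics Matrix
-- Existence and first-order expansion of the dominant subspace.
section SingularVectors

variable {𝕜 : Type} [RCLike 𝕜] {ι κ : Type} [Fintype ι] [Fintype κ] {d : ℕ}
variable {α : Type*} {l : Filter α} {ν : α → ℝ}

/-- The columns are eigenvectors of `X Xᴴ` for its `d` largest eigenvalues. A vector orthogonal to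
them has components only along the remaining eigenvectors, whose eigenvalues exceed none of the
chosen ones. -/
theorem exists_isDominantLeftSingular (X : Matrix ι κ 𝕜) (hd : d ≤ Fintype.card ι) :
    ∃ U : Matrix ι (Fin d) 𝕜, IsDominantLeftSingular X U := by
  classical
  have hH : (X * Xᴴ).IsHermitian := isHermitian_mul_conjTranspose_self X
  have hnn : ∀ k, 0 ≤ hH.eigenvalues k := by
    open scoped ComplexOrder in exact (posSemidef_self_mul_conjTranspose X).eigenvalues_nonneg
  set V : Matrix ι ι 𝕜 := hH.eigenvectorUnitary.1 with hV
  have hV1 : Vᴴ * V = 1 := Unitary.coe_star_mul_self hH.eigenvectorUnitary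
  have hV2 : V * Vᴴ = 1 := Unitary.coe_mul_star_self hH.eigenvectorUnitary
  have hMV : X * Xᴴ * V = V * diagonal fun k => (hH.eigenvalues k : 𝕜) := by
    ext i j
    have h := congrFun (hH.mulVec_eigenvectorBasis j) i
    rw [mul_diagonal]
    refine Eq.trans ?_ (h.trans ?_)
    · rfl
    · rw [Pi.smul_apply, RCLike.real_smul_eq_coe_mul, mul_comm]
      rfl
  set en : Fin (Fintype.card ι) ≃ ι := Fintype.equivOfCardEq (Fintype.card_fin _) with hen
  have hanti : ∀ a b, a ≤ b → hH.eigenvalues (en b) ≤ hH.eigenvalues (en a) := by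
    intro a b hab
    simp only [IsHermitian.eigenvalues, hen, Equiv.symm_apply_apply]
    exact hH.eigenvalues₀_antitone hab
  set e : Fin d → ι := fun i => en (Fin.castLE hd i) with he
  have heinj : Function.Injective e := en.injective.comp (Fin.castLE_injective hd)
  have hrange : ∀ i k, hH.eigenvalues (e i) < hH.eigenvalues k → ∃ j, e j = k := by
    intro i k hk
    by_contra! hcon
    refine absurd hk (not_lt.2 ?_)
    rw [← en.apply_symm_apply k]
    refine hanti _ _ ?_
    by_contra! hlt
    refine hcon ⟨(en.symm k : ℕ), lt_trans hlt (by simp)⟩ ?_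
    simp [he]
  refine ⟨V.submatrix id e, ?_, fun i => Real.sqrt (hH.eigenvalues (e i)),
    fun i => Real.sqrt_nonneg _, ?_, ?_⟩
  · refine Eq.trans (b := (Vᴴ * V).submatrix e e) rfl ?_
    rw [hV1, submatrix_one e heinj]
  · ext i j
    have h := congrFun (congrFun hMV i) (e j)
    rw [mul_diagonal] at h ⊢
    rw [Real.sq_sqrt (hnn _)]
    exact h
  · intro w hw i
    set b := Vᴴ *ᵥ w with hb
    have hwb : w = V *ᵥ b := by rw [hb, mulVec_mulVec, hV2, one_mulVec]
    have hbe : ∀ j, b (e j) = 0 := fun j => congrFun hw j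
    have h1 : ((∑ k, ‖(Xᴴ *ᵥ w) k‖ ^ 2 : ℝ) : 𝕜) =
        ((∑ k, hH.eigenvalues k * ‖b k‖ ^ 2 : ℝ) : 𝕜) := by
      rw [sum_norm_sq_conjTranspose_mulVec]
      rw [congrArg (fun v => star w ⬝ᵥ (X * Xᴴ) *ᵥ v) hwb]
      rw [mulVec_mulVec, hMV, ← mulVec_mulVec, dotProduct_mulVec, ← conjTranspose_conjTranspose V,
        ← star_mulVec, ← hb]
      simp only [dotProduct, mulVec_diagonal, Pi.star_apply, RCLike.star_def]
      push_cast
      refine Finset.sum_congr rfl fun k _ => ?_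
      rw [← RCLike.conj_mul]
      ring
    have h2 : ((∑ k, ‖w k‖ ^ 2 : ℝ) : 𝕜) = ((∑ k, ‖b k‖ ^ 2 : ℝ) : 𝕜) := by
      rw [sum_norm_sq_eq_dotProduct, sum_norm_sq_eq_dotProduct]
      rw [congrArg (fun v => star w ⬝ᵥ v) hwb]
      rw [dotProduct_mulVec, ← conjTranspose_conjTranspose V, ← star_mulVec, ← hb]
    have h1' : ∑ k, ‖(Xᴴ *ᵥ w) k‖ ^ 2 = ∑ k, hH.eigenvalues k * ‖b k‖ ^ 2 := by exact_mod_cast h1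
    have h2' : ∑ k, ‖w k‖ ^ 2 = ∑ k, ‖b k‖ ^ 2 := by exact_mod_cast h2
    rw [h1', h2', Real.sq_sqrt (hnn _), Finset.mul_sum]
    refine Finset.sum_le_sum fun k _ => ?_
    rcases le_or_gt (hH.eigenvalues k) (hH.eigenvalues (e i)) with h | h
    · exact mul_le_mul_of_nonneg_right h (by positivity)
    · obtain ⟨j, rfl⟩ := hrange i k h
      rw [hbe j]
      simp

/-- First-order expansion of the subspace spanned by the dominant left singular vectors of the
perturbation `A B + W` of a matrix of rank `d`: up to the choice `K` of a basis, it is spanned by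
the columns of `A + W B⁺ + O(ν²)`. -/
theorem dominant_subspace_expansion (hν : Tendsto ν l (𝓝 0))
    {A : Matrix ι (Fin d) 𝕜} {B : Matrix (Fin d) κ 𝕜}
    (hA : IsUnit (Aᴴ * A).det) (hB : IsUnit (B * Bᴴ).det) {W : α → Matrix ι κ 𝕜}
    (hW : EntrywiseBigO l W ν) {U : α → Matrix ι (Fin d) 𝕜}
    (hU : ∀ᶠ x in l, IsDominantLeftSingular (A * B + W x) (U x)) :
    ∃ (K : α → Matrix (Fin d) (Fin d) 𝕜) (Y : α → Matrix κ (Fin d) 𝕜),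
      (∀ᶠ x in l, IsUnit (K x).det) ∧ EntrywiseBigO l K (fun _ => 1) ∧
      EntrywiseBigO l (fun x => (K x)⁻¹) (fun _ => 1) ∧
      (∀ᶠ x in l, U x = (A + W x * Y x) * K x) ∧
      EntrywiseBigO l (fun x => Y x - Bᴴ * (B * Bᴴ)⁻¹) ν := by
  classical
  choose! s hs using fun x (h : IsDominantLeftSingular (A * B + W x) (U x)) => h.2
  have hUu : ∀ᶠ x in l, (U x)ᴴ * U x = 1 := hU.mono fun x hx => hx.1
  have hs' := hU.mono hs
  have hs1 := dominant_singularValue_inv_bounded hν hA hB hW hUu (hs'.mono fun x hx => hx.1)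
    (hs'.mono fun x hx => hx.2.1) (hs'.mono fun x hx => hx.2.2)
  have hsne : ∀ᶠ x in l, ∀ i, s x i ≠ 0 :=
    eventually_all.2 fun i => (hs1 i).eq_zero_imp.mono fun x hx h0 => one_ne_zero (hx h0)
  set D : α → Matrix (Fin d) (Fin d) 𝕜 := fun x => diagonal fun i => ((s x i ^ 2 : ℝ) : 𝕜)⁻¹ with hD
  have hDb : EntrywiseBigO l D fun _ => 1 := by
    refine EntrywiseBigO.diagonal fun i => ?_
    have h := (isBigO_inv_one (hs1 i)).norm_left.pow 2
    refine IsBigO.of_norm_left (h.congr (fun x => ?_) fun x => one_pow 2)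
    simp
  have hUb := entrywiseBigO_of_orthonormal hUu
  have hW1 : EntrywiseBigO l W fun _ => 1 := hW.trans (hν.isBigO_one ℝ)
  set X : α → Matrix ι κ 𝕜 := fun x => A * B + W x with hX
  have hXb : EntrywiseBigO l X fun _ => 1 := (EntrywiseBigO.const (A * B)).add hW1
  -- `D` inverts the squared singular values, so `X Z = U`. Hence `U = A (B Z) + W Z`, which
  -- dictates the change of basis `K = B Z`.
  set Z : α → Matrix κ (Fin d) 𝕜 := fun x => (X x)ᴴ * (U x * D x) with hZ
  have hZb : EntrywiseBigO l Z fun _ => 1 := hXb.conjTranspose.mul_one_left (hUb.mul_one_left hDb)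
  have hXZ : ∀ᶠ x in l, X x * Z x = U x := by
    filter_upwards [hs', hsne] with x hx hx2
    rw [hZ, ← Matrix.mul_assoc, ← Matrix.mul_assoc, hx.2.1, Matrix.mul_assoc, hD,
      diagonal_mul_diagonal]
    have : (diagonal fun i => ((s x i ^ 2 : ℝ) : 𝕜) * ((s x i ^ 2 : ℝ) : 𝕜)⁻¹) = 1 := by
      rw [← diagonal_one]
      congr 1
      ext i
      exact mul_inv_cancel₀ (by exact_mod_cast pow_ne_zero 2 (hx2 i))
    rw [this, Matrix.mul_one]
  set K : α → Matrix (Fin d) (Fin d) 𝕜 := fun x => B * Z x with hK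
  have hKb : EntrywiseBigO l K fun _ => 1 := (EntrywiseBigO.const B).mul_one_left hZb
  have hUAB : ∀ᶠ x in l, U x = A * K x + W x * Z x := by
    filter_upwards [hXZ] with x hx
    rw [← hx, hX, Matrix.add_mul, hK, Matrix.mul_assoc]
  -- Since `Uᴴ U = 1`, the splitting of `U` shows that `Uᴴ A` is an approximate left inverse of `K`;
  -- this bounds `K⁻¹`.
  have hM : EntrywiseBigO l (fun x => (U x)ᴴ * A * K x - 1) ν := by
    have h := (EntrywiseBigO.const (l := l) (-1 : Matrix (Fin d) (Fin d) 𝕜)).mul_one_left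
      (hUb.conjTranspose.mul_one_left (hW.mul_one_right hZb))
    refine h.congr' ?_
    filter_upwards [hUAB, hUu] with x hx hx2
    have h1 : (U x)ᴴ * (A * K x) = 1 - (U x)ᴴ * (W x * Z x) := by
      rw [eq_sub_iff_add_eq, ← Matrix.mul_add, ← hx, hx2]
    rw [Matrix.mul_assoc (U x)ᴴ, h1, neg_mul, one_mul]
    abel
  have hMu := EntrywiseBigO.eventually_isUnit_det hν hM (by simp)
  have hKu : ∀ᶠ x in l, IsUnit (K x).det := hMu.mono fun x hx => by
    rw [det_mul] at hx
    exact isUnit_of_mul_isUnit_right hx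
  have hKi : EntrywiseBigO l (fun x => (K x)⁻¹) fun _ => 1 := by
    have h := (EntrywiseBigO.inv_bounded hν hM (by simp)).mul_one_left
      (hUb.conjTranspose.mul_one_left (EntrywiseBigO.const A))
    refine h.congr' ?_
    filter_upwards [hMu, hKu] with x hx hx2
    refine (inv_eq_left_inv ?_).symm
    rw [mul_assoc, nonsing_inv_mul _ hx]
  -- Here `Y = Z K⁻¹ = Bᴴ Aᴴ F + Wᴴ F` and `B Y = 1`. Solving the second relation for `Aᴴ F` gives
  -- `Y = B⁺ + (1 - B⁺ B) Wᴴ F`.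
  set F : α → Matrix ι (Fin d) 𝕜 := fun x => U x * D x * (K x)⁻¹ with hF
  have hFb : EntrywiseBigO l F fun _ => 1 := (hUb.mul_one_left hDb).mul_one_left hKi
  refine ⟨K, fun x => Z x * (K x)⁻¹, hKu, hKb, hKi, ?_, ?_⟩
  · filter_upwards [hUAB, hKu] with x hx hx2
    rw [hx, Matrix.add_mul, Matrix.mul_assoc (W x), Matrix.mul_assoc (Z x), nonsing_inv_mul _ hx2,
      Matrix.mul_one]
  · have hWF : EntrywiseBigO l (fun x => (W x)ᴴ * F x) ν := hW.conjTranspose.mul_one_right hFb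
    have h := hWF.sub ((EntrywiseBigO.const (l := l) (Bᴴ * (B * Bᴴ)⁻¹ * B)).mul_one_left hWF)
    refine h.congr' ?_
    filter_upwards [hKu] with x hx
    have h1 : Z x * (K x)⁻¹ = Bᴴ * (Aᴴ * F x) + (W x)ᴴ * F x := by
      have : (X x)ᴴ = Bᴴ * Aᴴ + (W x)ᴴ := by simp [hX]
      rw [hZ, hF, Matrix.mul_assoc (X x)ᴴ, this, Matrix.add_mul, Matrix.mul_assoc Bᴴ]
    have h2 : B * (Z x * (K x)⁻¹) = 1 := by
      rw [← Matrix.mul_assoc, ← mul_nonsing_inv _ hx]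
    have h3 : (B * Bᴴ) * (Aᴴ * F x) = 1 - B * ((W x)ᴴ * F x) := by
      rw [eq_sub_iff_add_eq, ← h2, h1, Matrix.mul_add, Matrix.mul_assoc]
    have h4 : Aᴴ * F x = (B * Bᴴ)⁻¹ - (B * Bᴴ)⁻¹ * (B * ((W x)ᴴ * F x)) := by
      rw [← nonsing_inv_mul_cancel_left _ (Aᴴ * F x) hB, h3, mul_sub, mul_one]
    rw [h1, h4, Matrix.mul_sub]
    simp only [Matrix.mul_assoc]
    abel

end SingularVectors
end NCEsprit

namespace NCEsprit

open Asymptotics Matrix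

/-! ### Least squares shift invariance and the generic expansion -/

section Expansion

variable {𝕜 : Type} [RCLike 𝕜] {ι κ : Type} [Fintype ι] [Fintype κ] {d : ℕ}

/-- With full column rank the pseudo-inverse is `(Mᴴ M)⁻¹ Mᴴ`. The normal equations eliminate it and
transform simply under a change of basis of the subspace. -/
theorem isLSSolution_iff {τ : Type} [Fintype τ] {J₁ J₂ : Matrix τ ι 𝕜} {U : Matrix ι (Fin d) 𝕜}
    {G : Matrix (Fin d) (Fin d) 𝕜} (h : IsUnit ((J₁ * U)ᴴ * (J₁ * U)).det) :
    IsLSSolution J₁ J₂ U G ↔ (J₁ * U)ᴴ * (J₁ * U) * G = (J₁ * U)ᴴ * (J₂ * U) := by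
  unfold IsLSSolution IsPseudoInverse
  generalize J₁ * U = M at h ⊢
  constructor
  · rintro ⟨P, ⟨h1, -, h3, -⟩, rfl⟩
    rw [← Matrix.mul_assoc, Matrix.mul_assoc Mᴴ, ← h3, ← conjTranspose_mul, h1]
  · intro hG
    refine ⟨(Mᴴ * M)⁻¹ * Mᴴ, ⟨?_, ?_, ?_, ?_⟩, ?_⟩
    · rw [Matrix.mul_assoc, Matrix.mul_assoc, nonsing_inv_mul _ h, Matrix.mul_one]
    · rw [Matrix.mul_assoc _ _ M, nonsing_inv_mul _ h, Matrix.one_mul]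
    · rw [conjTranspose_mul, conjTranspose_mul, conjTranspose_nonsing_inv, conjTranspose_mul,
        conjTranspose_conjTranspose, Matrix.mul_assoc]
    · rw [Matrix.mul_assoc, nonsing_inv_mul _ h, conjTranspose_one]
    · rw [Matrix.mul_assoc, ← hG, nonsing_inv_mul_cancel_left _ _ h]

/-- First-order perturbation of the shift invariance matrix of mode `(J₁, J₂)` in the eigenbasis of
the noise-free one, for the data `A B` perturbed by `W`. -/
noncomputable def shiftPerturbation {τ : Type} [Fintype τ] (J₁ J₂ : Matrix τ ι 𝕜)
    (A : Matrix ι (Fin d) 𝕜) (B : Matrix (Fin d) κ 𝕜) (lam : Fin d → 𝕜) (W : Matrix ι κ 𝕜) :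
    Matrix (Fin d) (Fin d) 𝕜 :=
  ((J₁ * A)ᴴ * (J₁ * A))⁻¹ * ((J₁ * A)ᴴ * (J₂ * (W * (Bᴴ * (B * Bᴴ)⁻¹)) -
    J₁ * (W * (Bᴴ * (B * Bᴴ)⁻¹)) * diagonal lam))

variable {α : Type*} {l : Filter α} {ν : α → ℝ} {R : ℕ} {τ : Fin R → Type} [∀ r, Fintype (τ r)]
  {J₁ J₂ : (r : Fin R) → Matrix (τ r) ι 𝕜} {A : Matrix ι (Fin d) 𝕜} {B : Matrix (Fin d) κ 𝕜}
  {lam : Fin R → Fin d → 𝕜}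

/-- In a suitable basis of the estimated signal subspace the shift invariance equations have
solutions which are perturbations of diagonal matrices, with explicit first-order terms. -/
theorem shift_invariance_expansion (hν : Tendsto ν l (𝓝 0))
    (hA : IsUnit (Aᴴ * A).det) (hB : IsUnit (B * Bᴴ).det)
    (hJ : ∀ r, IsUnit ((J₁ r * A)ᴴ * (J₁ r * A)).det)
    (hshift : ∀ r, J₂ r * A = J₁ r * A * diagonal (lam r)) {W : α → Matrix ι κ 𝕜}
    (hW : EntrywiseBigO l W ν) {U : α → Matrix ι (Fin d) 𝕜}
    (hU : ∀ᶠ x in l, IsDominantLeftSingular (A * B + W x) (U x)) :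
    ∃ (K : α → Matrix (Fin d) (Fin d) 𝕜) (Δ : α → Fin R → Matrix (Fin d) (Fin d) 𝕜),
      (∀ᶠ x in l, IsUnit (K x).det) ∧ EntrywiseBigO l K (fun _ => 1) ∧
      EntrywiseBigO l (fun x => (K x)⁻¹) (fun _ => 1) ∧
      (∀ᶠ x in l, ∀ r, IsUnit ((J₁ r * U x)ᴴ * (J₁ r * U x)).det) ∧
      (∀ r, ∀ᶠ x in l, ∀ G, IsLSSolution (J₁ r) (J₂ r) (U x) G →
        K x * G = (diagonal (lam r) + Δ x r) * K x) ∧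
      (∀ r, EntrywiseBigO l (fun x => Δ x r) ν) ∧
      ∀ r, EntrywiseBigO l (fun x => Δ x r - shiftPerturbation (J₁ r) (J₂ r) A B (lam r) (W x))
        fun x => ν x ^ 2 := by
  obtain ⟨K, Y, hKu, hK, hKi, hUV, hY⟩ := dominant_subspace_expansion hν hA hB hW hU
  have hYb : EntrywiseBigO l Y fun _ => 1 := EntrywiseBigO.bounded_of_sub hν hY
  have hWY : EntrywiseBigO l (fun x => W x * Y x) ν := hW.mul_one_right hYb
  obtain ⟨V, hV⟩ : ∃ V : α → Matrix ι (Fin d) 𝕜, V = fun x => A + W x * Y x := ⟨_, rfl⟩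
  replace hUV : ∀ᶠ x in l, U x = V x * K x := by rw [hV]; exact hUV
  have hM : ∀ r, EntrywiseBigO l (fun x => J₁ r * V x - J₁ r * A) ν := fun r =>
    ((EntrywiseBigO.const (J₁ r)).mul_one_left hWY).congr' (Eventually.of_forall fun x => by
      rw [hV, Matrix.mul_add, add_sub_cancel_left])
  have hMb : ∀ r, EntrywiseBigO l (fun x => J₁ r * V x) fun _ => 1 := fun r =>
    EntrywiseBigO.bounded_of_sub hν (hM r)
  have hMt : ∀ r, EntrywiseBigO l (fun x => (J₁ r * V x)ᴴ - (J₁ r * A)ᴴ) ν := fun r =>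
    (hM r).conjTranspose.congr' (Eventually.of_forall fun x => conjTranspose_sub _ _)
  have hgram : ∀ r, EntrywiseBigO l (fun x => (J₁ r * V x)ᴴ * (J₁ r * V x) -
      (J₁ r * A)ᴴ * (J₁ r * A)) ν := by
    intro r
    refine (((hMt r).mul_one_right (hMb r)).add
      ((EntrywiseBigO.const (J₁ r * A)ᴴ).mul_one_left (hM r))).congr'
      (Eventually.of_forall fun x => ?_)
    rw [Matrix.sub_mul, Matrix.mul_sub]
    abel
  have hgu := fun r => EntrywiseBigO.eventually_isUnit_det hν (hgram r) (hJ r)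
  have hgi := fun r => EntrywiseBigO.inv_bounded hν (hgram r) (hJ r)
  have hgs := fun r => EntrywiseBigO.inv_sub hν (hgram r) (hJ r)
  -- `Q` is the shift invariance defect `J₂ V - J₁ V Λ` of the perturbed basis `V`; the noise-free
  -- part cancels. In this basis the least squares solution is `Λ + (J₁ V)⁺ Q`.
  obtain ⟨Q, hQ⟩ : ∃ Q : α → (r : Fin R) → Matrix (τ r) (Fin d) 𝕜,
      Q = fun x r => J₂ r * (W x * Y x) - J₁ r * (W x * Y x) * diagonal (lam r) := ⟨_, rfl⟩
  have hQb : ∀ r, EntrywiseBigO l (fun x => Q x r) ν := fun r => hQ ▸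
    ((EntrywiseBigO.const (J₂ r)).mul_one_left hWY).sub
      (((EntrywiseBigO.const (J₁ r)).mul_one_left hWY).mul_one_right
        (EntrywiseBigO.const (diagonal (lam r))))
  set Y₀ := Bᴴ * (B * Bᴴ)⁻¹ with hY₀
  have hWYs : EntrywiseBigO l (fun x => W x * Y x - W x * Y₀) fun x => ν x ^ 2 :=
    (hW.mul hY).congr' (Eventually.of_forall fun x => by rw [Matrix.mul_sub]) |>.trans
      ((isBigO_refl _ _).congr_right fun x => (sq (ν x)).symm)
  have hQs : ∀ r, EntrywiseBigO l (fun x => Q x r - (J₂ r * (W x * Y₀) -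
      J₁ r * (W x * Y₀) * diagonal (lam r))) fun x => ν x ^ 2 := by
    intro r
    refine (((EntrywiseBigO.const (J₂ r)).mul_one_left hWYs).sub
      (((EntrywiseBigO.const (J₁ r)).mul_one_left hWYs).mul_one_right
        (EntrywiseBigO.const (diagonal (lam r))))).congr' (Eventually.of_forall fun x => ?_)
    simp only [hQ, Matrix.mul_sub, Matrix.sub_mul]
    abel
  have hgramU : ∀ᶠ x in l, ∀ r, (J₁ r * U x)ᴴ * (J₁ r * U x) =
      (K x)ᴴ * ((J₁ r * V x)ᴴ * (J₁ r * V x)) * K x := by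
    filter_upwards [hUV] with x hx r
    rw [hx, ← Matrix.mul_assoc (J₁ r), conjTranspose_mul (J₁ r * V x)]
    simp only [Matrix.mul_assoc]
  have hunit : ∀ᶠ x in l, ∀ r, IsUnit ((J₁ r * U x)ᴴ * (J₁ r * U x)).det := by
    filter_upwards [hgramU, hKu, eventually_all.2 hgu] with x hx hx2 hx3 r
    rw [hx r, det_mul, det_mul, det_conjTranspose]
    exact (hx2.star.mul (hx3 r)).mul hx2
  refine ⟨K, fun x r => ((J₁ r * V x)ᴴ * (J₁ r * V x))⁻¹ * ((J₁ r * V x)ᴴ * Q x r), hKu, hK, hKi,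
    hunit, fun r => ?_, fun r => (hgi r).mul_one_left ((hMb r).conjTranspose.mul_one_left (hQb r)),
    fun r => ?_⟩
  · filter_upwards [hgramU, hunit, hKu, hgu r, hUV] with x hx1 hx2 hx3 hx4 hx5 G hG
    have h := (isLSSolution_iff (hx2 r)).1 hG
    have hKt : IsUnit (K x)ᴴ.det := by rw [det_conjTranspose]; exact hx3.star
    have h1 : (K x)ᴴ * (((J₁ r * V x)ᴴ * (J₁ r * V x)) * (K x * G)) =
        (K x)ᴴ * ((J₁ r * V x)ᴴ * (J₂ r * V x) * K x) := by
      rw [hx1 r] at h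
      rw [← Matrix.mul_assoc, ← Matrix.mul_assoc, h, hx5, ← Matrix.mul_assoc (J₁ r),
        ← Matrix.mul_assoc (J₂ r), conjTranspose_mul (J₁ r * V x)]
      simp only [Matrix.mul_assoc]
    have h2 : ((J₁ r * V x)ᴴ * (J₁ r * V x)) * (K x * G) =
        (J₁ r * V x)ᴴ * (J₂ r * V x) * K x := by
      rw [← nonsing_inv_mul_cancel_left _ (((J₁ r * V x)ᴴ * (J₁ r * V x)) * (K x * G)) hKt, h1,
        nonsing_inv_mul_cancel_left _ _ hKt]
    have h3 : J₂ r * V x = J₁ r * V x * diagonal (lam r) + Q x r := by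
      simp only [hV, hQ, Matrix.mul_add, Matrix.add_mul, hshift r]
      abel
    rw [← nonsing_inv_mul_cancel_left _ (K x * G) hx4, h2, h3]
    generalize J₁ r * V x = M at hx4 ⊢
    have h4 : Mᴴ * (M * diagonal (lam r) + Q x r) * K x =
        (Mᴴ * M) * (diagonal (lam r) * K x) + Mᴴ * Q x r * K x := by
      rw [Matrix.mul_add, Matrix.add_mul]
      simp only [Matrix.mul_assoc]
    rw [h4, mul_add, nonsing_inv_mul_cancel_left _ _ hx4, add_mul, mul_assoc (Mᴴ * M)⁻¹]
  -- Replacing `J₁ V` by `J₁ A`, in the Gram inverse and in the factor beside it, costs `O(ν²)`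
  -- because `Q` is already `O(ν)`. Replacing `Y` by `B⁺` inside `Q` costs `O(ν²)` too.
  · have h1 := (hgs r).mul ((hMb r).conjTranspose.mul_one_left (hQb r))
    have h2 := (EntrywiseBigO.const ((J₁ r * A)ᴴ * (J₁ r * A))⁻¹).mul_one_left
      ((hMt r).mul (hQb r))
    have h3 := (EntrywiseBigO.const ((J₁ r * A)ᴴ * (J₁ r * A))⁻¹).mul_one_left
      ((EntrywiseBigO.const (J₁ r * A)ᴴ).mul_one_left (hQs r))
    have h12 := (h1.add h2).trans ((isBigO_refl _ _).congr_right fun x => (sq (ν x)).symm)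
    refine (h12.add h3).congr' (Eventually.of_forall fun x => ?_)
    simp only [shiftPerturbation, ← hY₀, Matrix.mul_sub, Matrix.sub_mul]
    abel

/-- The generic first-order analysis of ESPRIT: for small perturbations `W` of the data `A B` the
algorithm succeeds, and the joint eigenvalues which it delivers have, up to numbering, explicit
first-order errors. -/
theorem esprit_expansion (hν : Tendsto ν l (𝓝 0))
    (hA : IsUnit (Aᴴ * A).det) (hB : IsUnit (B * Bᴴ).det)
    (hJ : ∀ r, IsUnit ((J₁ r * A)ᴴ * (J₁ r * A)).det)
    (hshift : ∀ r, J₂ r * A = J₁ r * A * diagonal (lam r))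
    (hsep : ∀ i j, (∀ r, lam r i = lam r j) → i = j) {W : α → Matrix ι κ 𝕜}
    (hW : EntrywiseBigO l W ν) :
    ∃ C : ℝ, ∀ᶠ x in l,
      (∃ (U : Matrix ι (Fin d) 𝕜) (G : Fin R → Matrix (Fin d) (Fin d) 𝕜) (z : Fin R → Fin d → 𝕜),
        IsDominantLeftSingular (A * B + W x) U ∧
        (∀ r, IsLSSolution (J₁ r) (J₂ r) U (G r)) ∧ IsJointEigenvalues G z) ∧
      ∀ U G z, IsDominantLeftSingular (A * B + W x) U →
        (∀ r, IsLSSolution (J₁ r) (J₂ r) U (G r)) → IsJointEigenvalues G z →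
        ∃ p : Fin d → Fin d, Function.Bijective p ∧ ∀ r j, ‖z r j - lam r (p j) -
          shiftPerturbation (J₁ r) (J₂ r) A B (lam r) (W x) (p j) (p j)‖ ≤ C * ν x ^ 2 := by
  -- Full column rank of `A` forces at least `d` rows, so that `d` singular vectors exist.
  have hd : d ≤ Fintype.card ι := by
    have h := rank_of_isUnit (Aᴴ * A) ((isUnit_iff_isUnit_det _).2 hA)
    rw [Fintype.card_fin] at h
    rw [← h]
    exact (rank_mul_le_right _ _).trans (rank_le_card_height A)
  have hexist : ∀ᶠ x in l, ∃ (U : Matrix ι (Fin d) 𝕜)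
      (G : Fin R → Matrix (Fin d) (Fin d) 𝕜) (z : Fin R → Fin d → 𝕜), IsDominantLeftSingular (A * B + W x) U ∧
      (∀ r, IsLSSolution (J₁ r) (J₂ r) U (G r)) ∧ IsJointEigenvalues G z := by
    choose U hU using fun x => exists_isDominantLeftSingular (A * B + W x) hd
    obtain ⟨K, Δ, hKu, hK, hKi, hunit, hG, hΔ, -⟩ := shift_invariance_expansion hν hA hB hJ hshift hW
      (Eventually.of_forall hU)
    set G : α → Fin R → Matrix (Fin d) (Fin d) 𝕜 := fun x r =>
      ((J₁ r * U x)ᴴ * (J₁ r * U x))⁻¹ * ((J₁ r * U x)ᴴ * (J₂ r * U x)) with hGdef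
    have hLS : ∀ᶠ x in l, ∀ r, IsLSSolution (J₁ r) (J₂ r) (U x) (G x r) :=
      hunit.mono fun x hx r => (isLSSolution_iff (hx r)).2 (by
        rw [hGdef, mul_nonsing_inv_cancel_left _ _ (hx r)])
    have h := (isJointEigenvalues_expansion (G := G) hν hsep hKu hK hKi
      (fun r => by filter_upwards [hG r, hLS] with x hx hx2 using hx _ (hx2 r)) hΔ).1
    filter_upwards [h, hLS] with x ⟨z, hz⟩ hx
    exact ⟨U x, G x, z, hU x, hx, hz⟩
  -- A point of `α'` is a whole run of the algorithm. Expanding along the pulled-back filter makes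
  -- the constant independent of the choice of singular vectors and minimizer.
  set α' := {y : α × Matrix ι (Fin d) 𝕜 × (Fin R → Matrix (Fin d) (Fin d) 𝕜) × (Fin R → Fin d → 𝕜) //
    IsDominantLeftSingular (A * B + W y.1) y.2.1 ∧
    (∀ r, IsLSSolution (J₁ r) (J₂ r) y.2.1 (y.2.2.1 r)) ∧ IsJointEigenvalues y.2.2.1 y.2.2.2}
  set ψ : α' → α := fun y => y.1.1 with hψ
  have ht : Tendsto ψ (comap ψ l) l := tendsto_comap
  obtain ⟨K, Δ, hKu, hK, hKi, -, hG, hΔ, hΔs⟩ := shift_invariance_expansion (W := W ∘ ψ)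
    (U := fun y : α' => y.1.2.1) (hν.comp ht) hA hB hJ hshift
    (fun i j => (hW i j).comp_tendsto ht) (Eventually.of_forall fun y => y.2.1)
  obtain ⟨p, hp, hexp⟩ := (isJointEigenvalues_expansion (G := fun y : α' => y.1.2.2.1)
    (hν.comp ht) hsep hKu hK hKi (fun r => (hG r).mono fun y hy => hy _ (y.2.2.1 r)) hΔ).2
    (fun y => y.1.2.2.2) (Eventually.of_forall fun y => y.2.2.2)
  have hfin : ∀ r j, (fun y : α' => y.1.2.2.2 r j - lam r (p y j) -
      shiftPerturbation (J₁ r) (J₂ r) A B (lam r) (W (ψ y)) (p y j) (p y j)) =O[comap ψ l]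
      fun y => (ν (ψ y)) ^ 2 := by
    intro r j
    have h2 : (fun y : α' => (Δ y r - shiftPerturbation (J₁ r) (J₂ r) A B (lam r) (W (ψ y)))
        (p y j) (p y j)) =O[comap ψ l] fun y => (ν (ψ y)) ^ 2 := by
      refine isBigO_of_finite_cases (fun y => p y j) fun b => ?_
      refine ((hΔs r b b).mono inf_le_left).congr' ?_ EventuallyEq.rfl
      exact eventually_inf_principal.2 (Eventually.of_forall fun y hy => by
        have hy' : p y j = b := hy
        simp only [hy']; rfl)
    refine ((hexp r j).add h2).congr_left fun y => ?_
    rw [Matrix.sub_apply]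
    ring
  choose c hc using fun r j => (hfin r j).bound
  refine ⟨∑ r, ∑ j, |c r j|, ?_⟩
  have hev : ∀ᶠ y in comap ψ l, Function.Bijective (p y) ∧ ∀ r j, ‖y.1.2.2.2 r j - lam r (p y j) -
      shiftPerturbation (J₁ r) (J₂ r) A B (lam r) (W (ψ y)) (p y j) (p y j)‖ ≤
      (∑ r, ∑ j, |c r j|) * ν (ψ y) ^ 2 := by
    refine hp.and (eventually_all.2 fun r => eventually_all.2 fun j => (hc r j).mono fun y hy => ?_)
    refine hy.trans ?_
    rw [Real.norm_of_nonneg (sq_nonneg _)]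
    refine mul_le_mul_of_nonneg_right ((le_abs_self _).trans ?_) (sq_nonneg _)
    exact (Finset.single_le_sum (f := fun j => |c r j|) (fun j _ => abs_nonneg _)
      (Finset.mem_univ j)).trans (Finset.single_le_sum (f := fun r => ∑ j, |c r j|)
      (fun r _ => Finset.sum_nonneg fun j _ => abs_nonneg _) (Finset.mem_univ r))
  filter_upwards [hexist, eventually_comap.1 hev] with x hx hx2
  exact ⟨hx, fun U G z hU hG hz => ⟨_, hx2 ⟨(x, U, G, z), hU, hG, hz⟩ rfl⟩⟩

end Expansion
end NCEsprit

namespace NCEsprit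

open Matrix

/-! ### The structure of the noise-free data -/

section Structure

variable {R d N : ℕ}

theorem isUnit_gram_of_le_rank {𝕜 τ : Type*} [RCLike 𝕜] [Fintype τ] {A : Matrix τ (Fin d) 𝕜}
    (h : d ≤ A.rank) : IsUnit (Aᴴ * A).det := by
  open scoped ComplexOrder in
  have h1 : d ≤ (Aᴴ * A).rank := by rwa [rank_conjTranspose_mul_self]
  have h2 : LinearMap.range (Aᴴ * A).mulVecLin = ⊤ := by
    refine Submodule.eq_top_of_finrank_eq (le_antisymm (Submodule.finrank_le _) ?_)
    rw [Module.finrank_fin_fun]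
    exact h1
  rw [← isUnit_iff_isUnit_det, ← mulVec_surjective_iff_isUnit]
  exact LinearMap.range_eq_top.1 h2

theorem exch_mul_apply {ι κ : Type} [Fintype ι] [DecidableEq ι] (ρ : ι → ι) (Z : Matrix ι κ ℂ)
    (i : ι) (k : κ) : (exch ρ * Z) i k = Z (ρ i) k := by
  simp [exch, Matrix.mul_apply]

theorem kron_sel_apply {P M : Fin R → ℕ} {a : Fin R → ℕ} {p : Idx P} {q : Idx M}
    (hq : ∀ r, (q r : ℕ) = p r + a r) (k : Idx M) :
    kron (fun r => sel (P r) (M r) (a r)) p k = if k = q then 1 else 0 := by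
  simp only [kron, sel, of_apply, Finset.prod_ite_zero, Finset.prod_const_one]
  congr 1
  simp [funext_iff, Fin.ext_iff, hq]

theorem dbl_mul_inl {ι κ τ : Type} [Fintype κ] (B : Matrix ι κ ℂ) (Z : Matrix (κ ⊕ κ) τ ℂ)
    (i : ι) (t : τ) : (dbl B * Z) (Sum.inl i) t = ∑ k, B i k * Z (Sum.inl k) t := by
  simp [dbl, Matrix.mul_apply, Fintype.sum_sum_type]

theorem dbl_mul_inr {ι κ τ : Type} [Fintype κ] (B : Matrix ι κ ℂ) (Z : Matrix (κ ⊕ κ) τ ℂ)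
    (i : ι) (t : τ) : (dbl B * Z) (Sum.inr i) t = ∑ k, B i k * Z (Sum.inr k) t := by
  simp [dbl, Matrix.mul_apply, Fintype.sum_sum_type]

theorem dbl_kron_sel_mul {P M : Fin R → ℕ} {a : Fin R → ℕ} {p : Idx P} {q : Idx M}
    (hq : ∀ r, (q r : ℕ) = p r + a r) {τ : Type} (Z : Matrix (Idx M ⊕ Idx M) τ ℂ) (t : τ) :
    (dbl (kron fun r => sel (P r) (M r) (a r)) * Z) (Sum.inl p) t = Z (Sum.inl q) t ∧
    (dbl (kron fun r => sel (P r) (M r) (a r)) * Z) (Sum.inr p) t = Z (Sum.inr q) t := by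
  rw [dbl_mul_inl, dbl_mul_inr]
  simp [kron_sel_apply hq]

/-- The element of the full array which is the `p`-th element of the `ℓ`-th subarray. -/
def shiftIdx {M L : Fin R → ℕ} (hL : ∀ r, 1 ≤ L r ∧ L r ≤ M r) (p : Idx (subSize M L))
    (ℓ : Idx L) : Idx M :=
  fun r => ⟨p r + ℓ r, by
    have h1 := (p r).2
    have h2 := (ℓ r).2
    have h3 := (hL r).2
    simp only [subSize] at h1
    omega⟩

theorem revIdx_revIdx {M : Fin R → ℕ} (p : Idx M) : revIdx (revIdx p) = p := by
  ext r; simp [revIdx]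

/-- In each mode `(M_sub - 1) + (L - 1) = M - 1`, so reversing the array carries a subarray to its
mirror image with reversed elements. This makes smoothing compatible with forward-backward
averaging. -/
theorem revIdx_shiftIdx {M L : Fin R → ℕ} (hL : ∀ r, 1 ≤ L r ∧ L r ≤ M r)
    (p : Idx (subSize M L)) (ℓ : Idx L) :
    revIdx (shiftIdx hL (revIdx p) (revIdx ℓ)) = shiftIdx hL p ℓ := by
  ext r
  have h1 := (p r).2
  have h2 := (ℓ r).2
  have h3 := (hL r).2
  have h4 : ((p r).rev : ℕ) = M r - L r + 1 - (p r + 1) := Fin.val_rev _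
  simp only [subSize] at h1
  simp only [revIdx, shiftIdx, Fin.val_rev (n := M r), Fin.val_rev (n := L r), h4]
  omega

theorem ssnc_inl {M L : Fin R → ℕ} (hL : ∀ r, 1 ≤ L r ∧ L r ≤ M r) (X : Matrix (Idx M) (Fin N) ℂ)
    (p : Idx (subSize M L)) (c : Idx L × Fin N) :
    ssnc M L X (Sum.inl p) c = X (shiftIdx hL p c.1) c.2 := by
  simp only [ssnc, smooth, of_apply, subarray]
  rw [(dbl_kron_sel_mul (q := shiftIdx hL p c.1) (fun r => rfl) _ _).1]
  rfl

theorem ssnc_inr {M L : Fin R → ℕ} (hL : ∀ r, 1 ≤ L r ∧ L r ≤ M r) (X : Matrix (Idx M) (Fin N) ℂ)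
    (p : Idx (subSize M L)) (c : Idx L × Fin N) :
    ssnc M L X (Sum.inr p) c = starRingEnd ℂ (X (revIdx (shiftIdx hL p c.1)) c.2) := by
  simp only [ssnc, smooth, of_apply, subarray]
  rw [(dbl_kron_sel_mul (q := shiftIdx hL p c.1) (fun r => rfl) _ _).2]
  exact exch_mul_apply _ _ _ _

/-- The centroids add up, `(M - 1) / 2 = (M_sub - 1) / 2 + (L - 1) / 2`, so no phase is left over
and the subarray shifts form a centered steering matrix themselves. -/
theorem steering_shiftIdx {M L : Fin R → ℕ} (hL : ∀ r, 1 ≤ L r ∧ L r ≤ M r)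
    (μ : Fin R → Fin d → ℝ) (p : Idx (subSize M L)) (ℓ : Idx L) (i : Fin d) :
    steering M μ (shiftIdx hL p ℓ) i = steering (subSize M L) μ p i * steering L μ ℓ i := by
  simp only [steering, of_apply, ← Finset.prod_mul_distrib, ← Complex.exp_add]
  refine Finset.prod_congr rfl fun r _ => ?_
  have h : ((subSize M L r : ℕ) : ℝ) = M r - L r + 1 := by
    simp only [subSize]
    push_cast [Nat.cast_sub (hL r).2]
    ring
  rw [h]
  congr 1
  simp only [shiftIdx]
  push_cast
  ring

/-- Centered exponents are odd under reversal, so conjugation undoes it. -/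
theorem conj_steering_revIdx (M : Fin R → ℕ) (μ : Fin R → Fin d → ℝ) (p : Idx M) (i : Fin d) :
    starRingEnd ℂ (steering M μ (revIdx p) i) = steering M μ p i := by
  simp only [steering, of_apply, map_prod, ← Complex.exp_conj]
  refine Finset.prod_congr rfl fun r _ => ?_
  have h : (((p r).rev : ℕ) : ℝ) = M r - 1 - (p r : ℕ) := by
    rw [Fin.val_rev, Nat.cast_sub (p r).2]
    push_cast
    ring
  simp only [revIdx, map_mul, Complex.conj_I, Complex.conj_ofReal, h]
  congr 1
  push_cast
  ring

theorem steering_succ {m : Fin R → ℕ} (μ : Fin R → Fin d → ℝ) (r : Fin R) {p q : Idx m}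
    (h : ∀ s, (q s : ℕ) = p s + if s = r then 1 else 0) (i : Fin d) :
    steering m μ q i = steering m μ p i * Complex.exp (Complex.I * μ r i) := by
  simp only [steering, of_apply]
  have h1 : Complex.exp (Complex.I * μ r i) =
      ∏ s, if s = r then Complex.exp (Complex.I * μ s i) else 1 := by simp
  rw [h1, ← Finset.prod_mul_distrib]
  refine Finset.prod_congr rfl fun s _ => ?_
  rw [h s]
  split_ifs
  · rw [← Complex.exp_add]
    congr 1
    push_cast
    ring
  · simp

noncomputable section

/-- Source phases `Ξ`. -/
def sourcePhase (μ : Fin R → Fin d → ℝ) (δ : Fin R → ℝ) (φ : Fin d → ℝ) (i : Fin d) : ℂ :=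
  Complex.exp (Complex.I * (φ i + ∑ r, δ r * μ r i : ℝ))

theorem conj_sourcePhase_mul (μ : Fin R → Fin d → ℝ) (δ : Fin R → ℝ) (φ : Fin d → ℝ) (i : Fin d) :
    starRingEnd ℂ (sourcePhase μ δ φ i) * sourcePhase μ δ φ i = 1 := by
  rw [RCLike.conj_mul, sourcePhase, mul_comm]
  erw [Complex.norm_exp_ofReal_mul_I]
  simp

/-- The centered augmented steering matrix of an array of size `m`. -/
def ncSteering (m : Fin R → ℕ) (μ : Fin R → Fin d → ℝ) (ξ : Fin d → ℂ) :
    Matrix (Idx m ⊕ Idx m) (Fin d) ℂ :=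
  fromRows (Matrix.of fun p i => steering m μ p i * ξ i)
    (Matrix.of fun p i => steering m μ p i * starRingEnd ℂ (ξ i))

/-- The symbols as received by the subarrays. -/
def smoothedSymbols (L : Fin R → ℕ) (μ : Fin R → Fin d → ℝ) (S₀ : Matrix (Fin d) (Fin N) ℝ) :
    Matrix (Fin d) (Idx L × Fin N) ℂ :=
  Matrix.of fun i c => steering L μ c.1 i * S₀ i c.2

end

theorem signal_apply (M : Fin R → ℕ) (μ : Fin R → Fin d → ℝ) (δ : Fin R → ℝ) (φ : Fin d → ℝ)
    (S₀ : Matrix (Fin d) (Fin N) ℝ) (q : Idx M) (t : Fin N) :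
    signal M μ δ φ S₀ q t = ∑ i, steering M μ q i * sourcePhase μ δ φ i * S₀ i t := by
  rw [signal, Matrix.mul_apply]
  simp only [phases, mul_diagonal, map_apply, sourcePhase]

/-- The symbols are real, so the lower half conjugates only the source phases, and both halves share
one symbol matrix. -/
theorem ssnc_signal {M L : Fin R → ℕ} (hL : ∀ r, 1 ≤ L r ∧ L r ≤ M r) (μ : Fin R → Fin d → ℝ)
    (δ : Fin R → ℝ) (φ : Fin d → ℝ) (S₀ : Matrix (Fin d) (Fin N) ℝ) :
    ssnc M L (signal M μ δ φ S₀) =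
      ncSteering (subSize M L) μ (sourcePhase μ δ φ) * smoothedSymbols L μ S₀ := by
  ext p c
  rcases p with p | p
  · rw [ssnc_inl hL, signal_apply, Matrix.mul_apply]
    refine Finset.sum_congr rfl fun i _ => ?_
    simp only [steering_shiftIdx, ncSteering, fromRows_apply_inl, smoothedSymbols, of_apply]
    ring
  · rw [ssnc_inr hL, signal_apply, map_sum, Matrix.mul_apply]
    refine Finset.sum_congr rfl fun i _ => ?_
    rw [map_mul, map_mul, conj_steering_revIdx, Complex.conj_ofReal]
    simp only [steering_shiftIdx, ncSteering, fromRows_apply_inr, smoothedSymbols, of_apply]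
    ring

/-- The two steering matrices differ by a diagonal right factor, so the rank hypothesis on
`steeringSS` bounds the rank of the centered matrix from below. -/
theorem steeringSS_eq {M L : Fin R → ℕ} (hL : ∀ r, 1 ≤ L r ∧ L r ≤ M r) (μ : Fin R → Fin d → ℝ)
    (δ : Fin R → ℝ) (φ : Fin d → ℝ) : steeringSS M L μ δ φ =
      ncSteering (subSize M L) μ (sourcePhase μ δ φ) * diagonal fun i =>
        steering L μ (fun r => ⟨0, (hL r).1⟩) i * starRingEnd ℂ (sourcePhase μ δ φ i) := by
  have hph : ∀ p i, (steering M μ * conjM (phases μ δ φ) * conjM (phases μ δ φ)) p i =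
      steering M μ p i * starRingEnd ℂ (sourcePhase μ δ φ i) *
        starRingEnd ℂ (sourcePhase μ δ φ i) := by
    intro p i
    have : conjM (phases μ δ φ) = diagonal fun i => starRingEnd ℂ (sourcePhase μ δ φ i) := by
      rw [conjM, phases, diagonal_map (map_zero _)]
      rfl
    rw [this, mul_diagonal, mul_diagonal]
  ext p i
  rw [mul_diagonal]
  rcases p with p | p
  · rw [steeringSS, (dbl_kron_sel_mul (q := shiftIdx hL p fun r => ⟨0, (hL r).1⟩)
      (fun r => rfl) _ _).1]
    simp only [steering_shiftIdx, ncSteering, fromRows_apply_inl, of_apply]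
    linear_combination -(steering (subSize M L) μ p i * steering L μ (fun r => ⟨0, (hL r).1⟩) i) *
      conj_sourcePhase_mul μ δ φ i
  · rw [steeringSS, (dbl_kron_sel_mul (q := shiftIdx hL p fun r => ⟨0, (hL r).1⟩)
      (fun r => rfl) _ _).2]
    simp only [ncSteering, fromRows_apply_inr, of_apply, hph, steering_shiftIdx]
    ring

/-- The element of the grid `m` selected by the `p`-th row of `I ⊗ J_k^{(r)} ⊗ I`. -/
def selIdx {m : Fin R → ℕ} (r : Fin R) (k : Fin 2) (p : Idx (shorten m r)) : Idx m :=
  fun s => ⟨p s + if s = r then (k : ℕ) else 0, by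
    have h1 := (p s).2
    have h2 := k.2
    by_cases h : s = r
    · subst h
      simp only [shorten, Function.update_self, if_true] at h1 ⊢
      omega
    · simpa [shorten, Function.update_of_ne h, h] using h1⟩

theorem dbl_shiftSel_mul {m : Fin R → ℕ} (r : Fin R) (k : Fin 2) {τ : Type}
    (Z : Matrix (Idx m ⊕ Idx m) τ ℂ) (p : Idx (shorten m r)) (t : τ) :
    (dbl (shiftSel m r k) * Z) (Sum.inl p) t = Z (Sum.inl (selIdx r k p)) t ∧
    (dbl (shiftSel m r k) * Z) (Sum.inr p) t = Z (Sum.inr (selIdx r k p)) t :=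
  dbl_kron_sel_mul (fun _ => rfl) Z t

/-- In the lower half the reversal undoes the conjugation of the steering vectors, so a shift
multiplies both halves by the same `exp (j μ)`. -/
theorem dbl_shiftSel_mul_ncSteering (m : Fin R → ℕ) (μ : Fin R → Fin d → ℝ) (ξ : Fin d → ℂ)
    (r : Fin R) : dbl (shiftSel m r 1) * ncSteering m μ ξ =
      dbl (shiftSel m r 0) * ncSteering m μ ξ *
        diagonal fun i => Complex.exp (Complex.I * μ r i) := by
  have hs : ∀ (p : Idx (shorten m r)) i, steering m μ (selIdx r 1 p) i =
      steering m μ (selIdx r 0 p) i * Complex.exp (Complex.I * μ r i) := fun p i =>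
    steering_succ μ r (fun s => by simp [selIdx]) i
  ext p i
  rw [mul_diagonal]
  rcases p with p | p
  · erw [(dbl_shiftSel_mul r 1 _ p i).1, (dbl_shiftSel_mul r 0 _ p i).1]
    simp only [ncSteering, fromRows_apply_inl, of_apply, hs]
    ring
  · erw [(dbl_shiftSel_mul r 1 _ p i).2, (dbl_shiftSel_mul r 0 _ p i).2]
    simp only [ncSteering, fromRows_apply_inr, of_apply, hs]
    ring

theorem exp_I_mul_injective {x y : ℝ} (hx : |x| < Real.pi) (hy : |y| < Real.pi)
    (h : Complex.exp (Complex.I * x) = Complex.exp (Complex.I * y)) : x = y := by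
  rw [abs_lt] at hx hy
  have h2 := Complex.exp_inj_of_neg_pi_lt_of_le_pi (x := Complex.I * x) (y := Complex.I * y)
    (by simpa using hx.1) (by simpa using hx.2.le) (by simpa using hy.1) (by simpa using hy.2.le) h
  exact_mod_cast mul_left_cancel₀ Complex.I_ne_zero h2

end Structure
end NCEsprit

namespace NCEsprit

open Matrix Asymptotics

/-! ### From joint eigenvalues to frequencies -/

section Frequencies

variable {R d N : ℕ}

/-- Mean value inequality for `arctan t - t / (1 + x²)` on the ball of radius `|y - x|`. The
constant bounds the factor `|x + t|` in the difference of the derivatives. -/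
theorem abs_arctan_sub_le (x y : ℝ) (h : |y - x| < 1) :
    |Real.arctan y - Real.arctan x - (y - x) / (1 + x ^ 2)| ≤ (2 * |x| + 1) * |y - x| ^ 2 := by
  have hmem : ∀ t ∈ Metric.closedBall x |y - x|, |t - x| ≤ |y - x| := fun t ht => by
    simpa [Real.dist_eq] using ht
  have hd : ∀ t ∈ Metric.closedBall x |y - x|, HasDerivWithinAt
      (fun t => Real.arctan t - t / (1 + x ^ 2)) (1 / (1 + t ^ 2) - 1 / (1 + x ^ 2))
      (Metric.closedBall x |y - x|) t := fun t _ =>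
    ((Real.hasDerivAt_arctan t).sub ((hasDerivAt_id t).div_const _)).hasDerivWithinAt
  have hb : ∀ t ∈ Metric.closedBall x |y - x|, ‖1 / (1 + t ^ 2) - 1 / (1 + x ^ 2)‖ ≤
      (2 * |x| + 1) * |y - x| := by
    intro t ht
    have h1 := hmem t ht
    have h2 : 1 / (1 + t ^ 2) - 1 / (1 + x ^ 2) =
        (x - t) * (x + t) / ((1 + t ^ 2) * (1 + x ^ 2)) := by
      field_simp
      ring
    have h3 : |x + t| ≤ 2 * |x| + 1 := by
      have : x + t = 2 * x + (t - x) := by ring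
      rw [this]
      refine (abs_add_le _ _).trans (add_le_add ?_ (h1.trans h.le))
      rw [abs_mul, abs_two]
    rw [h2, Real.norm_eq_abs, abs_div, abs_mul]
    have h4 : 1 ≤ |(1 + t ^ 2) * (1 + x ^ 2)| := by
      rw [abs_of_nonneg (by positivity)]
      nlinarith [sq_nonneg t, sq_nonneg x, mul_nonneg (sq_nonneg t) (sq_nonneg x)]
    refine (div_le_self (by positivity) h4).trans ?_
    rw [mul_comm, abs_sub_comm]
    exact mul_le_mul h3 h1 (abs_nonneg _) (by positivity)
  have hfin := (convex_closedBall x |y - x|).norm_image_sub_le_of_norm_hasDerivWithin_le hd hb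
    (Metric.mem_closedBall_self (abs_nonneg _)) (by simp [Real.dist_eq] : y ∈ _)
  simp only [Real.norm_eq_abs] at hfin
  calc _ = |Real.arctan y - y / (1 + x ^ 2) - (Real.arctan x - x / (1 + x ^ 2))| := by
        congr 1; ring
    _ ≤ _ := hfin
    _ = _ := by ring

/-- With `w = (z - z₀) / z₀`, the argument is `μ + arg (1 + w)` for small `w` because `z₀` stays off
the branch cut, and `arg (1 + w) = Im log (1 + w) = Im w + O(w²)`. -/
theorem abs_arg_sub_le {μ : ℝ} (hμ : |μ| < Real.pi) :
    ∃ ε > 0, ∀ z : ℂ, ‖z - Complex.exp (Complex.I * μ)‖ < ε →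
      |z.arg - μ - ((z - Complex.exp (Complex.I * μ)) / Complex.exp (Complex.I * μ)).im| ≤
        1 * ‖z - Complex.exp (Complex.I * μ)‖ ^ 2 := by
  set z₀ := Complex.exp (Complex.I * μ) with hz₀
  have hz₀ne : z₀ ≠ 0 := Complex.exp_ne_zero _
  have hnorm : ‖z₀‖ = 1 := by rw [hz₀, mul_comm]; exact Complex.norm_exp_ofReal_mul_I μ
  rw [abs_lt] at hμ
  have harg : z₀.arg = μ := by
    rw [hz₀, mul_comm, Complex.arg_exp_mul_I, toIocMod_eq_self]
    constructor <;> linarith [hμ.1, hμ.2]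
  have hlim : Tendsto (fun w : ℂ => z₀.arg + (1 + w).arg) (𝓝 0) (𝓝 (μ + 0)) := by
    have h1 : ContinuousAt (fun w : ℂ => (1 + w).arg) 0 := by
      refine ContinuousAt.comp (g := Complex.arg) (f := fun w => 1 + w) ?_
        (continuousAt_const.add continuousAt_id)
      exact Complex.continuousAt_arg (by simp)
    have h2 := h1.tendsto
    simp only [add_zero, Complex.arg_one] at h2
    rw [harg]
    exact tendsto_const_nhds.add h2
  have hev : ∀ᶠ w in 𝓝 (0 : ℂ), z₀.arg + (1 + w).arg ∈ Set.Ioc (-Real.pi) Real.pi := by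
    refine hlim.eventually (Filter.mem_of_superset (Ioo_mem_nhds ?_ ?_) Set.Ioo_subset_Ioc_self)
    · linarith [hμ.1]
    · linarith [hμ.2]
  obtain ⟨ε, hε, hball⟩ := Metric.eventually_nhds_iff.1 hev
  -- The radius `1 / 2` bounds `(1 - ‖w‖)⁻¹` by `2`, which makes the constant of the logarithm
  -- estimate equal to one.
  refine ⟨min ε (1 / 2), by positivity, fun z hz => ?_⟩
  set w := (z - z₀) / z₀ with hw
  have hwn : ‖w‖ = ‖z - z₀‖ := by rw [hw, norm_div, hnorm, div_one]
  have hw1 : ‖w‖ < 1 / 2 := hwn ▸ hz.trans_le (min_le_right _ _)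
  have hz' : z = z₀ * (1 + w) := by rw [hw]; field_simp; ring
  have h1w : (1 + w) ≠ 0 := by
    intro h0
    have : w = -1 := by linear_combination h0
    rw [this] at hw1
    norm_num at hw1
  have ha : z.arg = μ + (1 + w).arg := by
    rw [hz', Complex.arg_mul hz₀ne h1w (hball (by
      rw [dist_zero_right, hwn]; exact hz.trans_le (min_le_left _ _))), harg]
  have hlog := Complex.norm_log_one_add_sub_self_le (hw1.trans (by norm_num))
  have him : (1 + w).arg - w.im = (Complex.log (1 + w) - w).im := by
    rw [Complex.sub_im, Complex.log_im]
  rw [ha, ← hwn, add_sub_cancel_left, him, one_mul]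
  refine (Complex.abs_im_le_norm _).trans (hlog.trans ?_)
  have h2 : (1 - ‖w‖)⁻¹ ≤ 2 := by
    rw [inv_le_comm₀ (by linarith) (by norm_num)]
    linarith
  nlinarith [sq_nonneg ‖w‖]

/-- A function which is differentiable with a quadratic remainder maps first-order expansions to
first-order expansions. -/
theorem first_order_transfer {α 𝕜 : Type*} [RCLike 𝕜] {l : Filter α} {ν : α → ℝ}
    (hν : Tendsto ν l (𝓝 0)) {f : 𝕜 → ℝ} {g : 𝕜 →+ ℝ} {z₀ : 𝕜} {c ε C₀ : ℝ}
    (hg : ∀ w, |g w| ≤ c * ‖w‖) (hε : 0 < ε)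
    (hf : ∀ z, ‖z - z₀‖ < ε → |f z - f z₀ - g (z - z₀)| ≤ C₀ * ‖z - z₀‖ ^ 2)
    {δ : α → 𝕜} (hδ : δ =O[l] ν) (C : ℝ) :
    ∃ C', ∀ᶠ x in l, ∀ z, ‖z - z₀ - δ x‖ ≤ C * ν x ^ 2 →
      |f z - f z₀ - g (δ x)| ≤ C' * ν x ^ 2 := by
  obtain ⟨b, hb, hbd⟩ := hδ.exists_pos
  refine ⟨|C₀| * (b + |C|) ^ 2 + |c| * |C|, ?_⟩
  -- For `‖ν‖ < 1` the distance `‖z - z₀‖` is at most `(b + |C|) ‖ν‖`; the second bound brings this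
  -- below `ε`.
  have h1 : ∀ᶠ x in l, ‖ν x‖ < min 1 (ε / (b + |C|)) :=
    (tendsto_zero_iff_norm_tendsto_zero.1 hν).eventually_lt_const (by positivity)
  filter_upwards [hbd.bound, h1] with x hx hx2 z hz
  have hn1 : ‖ν x‖ < 1 := hx2.trans_le (min_le_left _ _)
  have hn2 : (b + |C|) * ‖ν x‖ < ε := by
    have := hx2.trans_le (min_le_right _ _)
    rwa [lt_div_iff₀ (by positivity), mul_comm] at this
  have hz' : ‖z - z₀ - δ x‖ ≤ |C| * ‖ν x‖ ^ 2 := by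
    rw [Real.norm_eq_abs, sq_abs]
    exact hz.trans (mul_le_mul_of_nonneg_right (le_abs_self _) (sq_nonneg _))
  have hzn : ‖z - z₀‖ ≤ (b + |C|) * ‖ν x‖ := by
    calc ‖z - z₀‖ = ‖(z - z₀ - δ x) + δ x‖ := by rw [sub_add_cancel]
      _ ≤ |C| * ‖ν x‖ ^ 2 + b * ‖ν x‖ := (norm_add_le _ _).trans (add_le_add hz' hx)
      _ ≤ |C| * ‖ν x‖ + b * ‖ν x‖ := by
          refine add_le_add (mul_le_mul_of_nonneg_left ?_ (abs_nonneg _)) le_rfl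
          rw [sq]
          exact mul_le_of_le_one_left (norm_nonneg _) hn1.le
      _ = _ := by ring
  have h2 := hf z (hzn.trans_lt hn2)
  have h3 : |g (z - z₀) - g (δ x)| ≤ |c| * (|C| * ‖ν x‖ ^ 2) := by
    rw [← map_sub]
    exact (hg _).trans (mul_le_mul (le_abs_self _) hz' (norm_nonneg _) (abs_nonneg _))
  calc |f z - f z₀ - g (δ x)| = |(f z - f z₀ - g (z - z₀)) + (g (z - z₀) - g (δ x))| := by
        congr 1; ring
    _ ≤ C₀ * ‖z - z₀‖ ^ 2 + |c| * (|C| * ‖ν x‖ ^ 2) := (abs_add_le _ _).trans (add_le_add h2 h3)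
    _ ≤ |C₀| * ((b + |C|) * ‖ν x‖) ^ 2 + |c| * (|C| * ‖ν x‖ ^ 2) := by
        refine add_le_add (mul_le_mul (le_abs_self _) ?_ (by positivity) (abs_nonneg _)) le_rfl
        exact pow_le_pow_left₀ (norm_nonneg _) hzn 2
    _ = _ := by rw [Real.norm_eq_abs, mul_pow, sq_abs]; ring

/-- For small errors the numbering of minimal total squared error is the true one. -/
theorem eventually_matched_eq_id {α : Type*} {l : Filter α} {η : α → ℝ} (hη : Tendsto η l (𝓝 0))
    {μ : Fin R → Fin d → ℝ} (hdist : ∀ i j, (∀ r, μ r i = μ r j) → i = j) :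
    ∀ᶠ x in l, ∀ (e : Fin R → Fin d → ℝ) (p : Fin d → Fin d), IsMatched μ e →
      Function.Bijective p → (∀ r j, |e r j - μ r (p j)| ≤ η x) → p = id := by
  have hgap : ∀ᶠ x in l, ∀ i j, i ≠ j →
      ∃ r, η x + Real.sqrt (∑ _ : Fin R, ∑ _ : Fin d, η x ^ 2) < |μ r i - μ r j| := by
    refine eventually_all.2 fun i => eventually_all.2 fun j => ?_
    by_cases hij : i = j
    · exact Eventually.of_forall fun x h => absurd hij h
    obtain ⟨r, hr⟩ : ∃ r, μ r i ≠ μ r j := by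
      by_contra! h
      exact hij (hdist _ _ h)
    have hlim : Tendsto (fun x => η x + Real.sqrt (∑ _ : Fin R, ∑ _ : Fin d, η x ^ 2)) l (𝓝 0) := by
      have h1 : Tendsto (fun x => ∑ _ : Fin R, ∑ _ : Fin d, η x ^ 2) l (𝓝 0) := by
        have := tendsto_finsetSum (Finset.univ : Finset (Fin R)) fun _ _ =>
          tendsto_finsetSum (Finset.univ : Finset (Fin d)) fun _ _ => hη.pow 2
        simpa using this
      have h2 := hη.add h1.sqrt
      simpa using h2
    exact (hlim.eventually_lt_const (abs_pos.2 (sub_ne_zero.2 hr))).mono fun x hx _ => ⟨r, hx⟩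
  filter_upwards [hgap] with x hx e p hmatch hp he
  funext i
  by_contra hne
  obtain ⟨r, hr⟩ := hx (p i) i hne
  set σ := (Equiv.ofBijective p hp).symm with hσ
  have hpσ : ∀ i, p (σ i) = i := fun i => (Equiv.ofBijective p hp).apply_symm_apply i
  -- Comparison with the true numbering `p⁻¹` makes the matched total error small. Then `e r i` is
  -- close to both `μ r i` and `μ r (p i)`, against the gap between distinct sources.
  have h1 : ∑ r, ∑ i, (e r i - μ r i) ^ 2 ≤ ∑ _ : Fin R, ∑ _ : Fin d, η x ^ 2 := by
    refine (hmatch σ).trans (Finset.sum_le_sum fun r _ => Finset.sum_le_sum fun i _ => ?_)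
    have := he r (σ i)
    rw [hpσ] at this
    rw [← sq_abs]
    exact pow_le_pow_left₀ (abs_nonneg _) this 2
  have h2 : |e r i - μ r i| ≤ Real.sqrt (∑ _ : Fin R, ∑ _ : Fin d, η x ^ 2) := by
    refine Real.le_sqrt_of_sq_le ?_
    rw [sq_abs]
    refine le_trans ?_ h1
    exact (Finset.single_le_sum (f := fun i => (e r i - μ r i) ^ 2) (fun i _ => sq_nonneg _)
      (Finset.mem_univ i)).trans (Finset.single_le_sum (f := fun r => ∑ i, (e r i - μ r i) ^ 2)
      (fun r _ => Finset.sum_nonneg fun i _ => sq_nonneg _) (Finset.mem_univ r))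
  have h3 : |μ r (p i) - μ r i| ≤ |e r i - μ r (p i)| + |e r i - μ r i| := by
    rw [abs_sub_comm (e r i)]
    exact abs_sub_le _ _ _
  linarith [he r i]

/-- An algorithm which delivers the frequencies `f z` from eigenvalues `z` with first-order errors
`δ` has first-order frequency errors `g δ`, where `g` is the derivative of `f`. -/
theorem hasFirstOrderError_of_expansion {𝕜 : Type*} [RCLike 𝕜] {M L : Fin R → ℕ}
    {μ : Fin R → Fin d → ℝ} (hdist : ∀ i j, (∀ r, μ r i = μ r j) → i = j)
    {X₀ : Matrix (Idx M) (Fin N) ℂ}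
    {alg : Matrix (Idx M) (Fin N) ℂ → (Fin R → Fin d → ℝ) → Prop}
    {l : Fin R → Fin d → Matrix (Idx M) (Fin N) ℂ →ₗ[ℝ] ℝ}
    {f : 𝕜 → ℝ} {g : Fin R → Fin d → 𝕜 →+ ℝ} {lam : Fin R → Fin d → 𝕜}
    {δ : Fin R → Fin d → Matrix (Idx M) (Fin N) ℂ → 𝕜}
    (hfμ : ∀ r i, f (lam r i) = μ r i)
    (hf : ∀ r i, ∃ ε > 0, ∃ C₀, ∀ z, ‖z - lam r i‖ < ε →
      |f z - f (lam r i) - g r i (z - lam r i)| ≤ C₀ * ‖z - lam r i‖ ^ 2)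
    (hg : ∀ r i, ∃ c, ∀ w, |g r i w| ≤ c * ‖w‖)
    (hδ : ∀ r i, δ r i =O[comap (noiseLevel M L) (𝓝 0)] noiseLevel M L)
    (hl : ∀ r i W, l r i W = g r i (δ r i W))
    (halg : ∃ C, ∀ᶠ W in comap (noiseLevel M L) (𝓝 0), (∃ e, alg (X₀ + W) e) ∧
      ∀ e, alg (X₀ + W) e → ∃ (z : Fin R → Fin d → 𝕜) (p : Fin d → Fin d), Function.Bijective p ∧
        (∀ r j, e r j = f (z r j)) ∧
        ∀ r j, ‖z r j - lam r (p j) - δ r (p j) W‖ ≤ C * noiseLevel M L W ^ 2) :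
    HasFirstOrderError M L μ X₀ alg l := by
  obtain ⟨C, hC⟩ := halg
  have hν : Tendsto (noiseLevel (R := R) (N := N) M L) (comap (noiseLevel M L) (𝓝 0)) (𝓝 0) :=
    tendsto_comap
  choose ε hε C₀ hC₀ using hf
  choose c hc using hg
  choose C' hC' using fun r i => first_order_transfer hν (hc r i) (hε r i) (hC₀ r i) (hδ r i) C
  set D := ∑ r, ∑ i, |C' r i| with hD
  have hCD : ∀ r i, C' r i ≤ D := fun r i => (le_abs_self _).trans <|
    (Finset.single_le_sum (f := fun i => |C' r i|) (fun j _ => abs_nonneg _)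
      (Finset.mem_univ i)).trans (Finset.single_le_sum (f := fun r => ∑ i, |C' r i|)
      (fun r _ => Finset.sum_nonneg fun j _ => abs_nonneg _) (Finset.mem_univ r))
  have hlO : ∀ r i, (fun W => l r i W) =O[comap (noiseLevel M L) (𝓝 0)] noiseLevel M L := by
    intro r i
    refine IsBigO.trans (IsBigO.of_bound (c r i) (Eventually.of_forall fun W => ?_)) (hδ r i)
    rw [hl]
    exact hc r i _
  -- Remainder plus linear terms bound the distance of every estimate from its source. The bound
  -- tends to zero, so the matched numbering is eventually the identity.
  have hη : Tendsto (fun W => D * noiseLevel M L W ^ 2 + ∑ r, ∑ i, |l r i W|)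
      (comap (noiseLevel M L) (𝓝 0)) (𝓝 0) := by
    have h1 := (hν.pow 2).const_mul D
    have h2 := tendsto_finsetSum (Finset.univ : Finset (Fin R)) fun r _ =>
      tendsto_finsetSum (Finset.univ : Finset (Fin d)) fun i _ =>
        ((hlO r i).trans_tendsto hν).abs
    have h3 := h1.add h2
    simpa using h3
  have hev : ∀ᶠ W in comap (noiseLevel M L) (𝓝 0), (∃ e, alg (X₀ + W) e) ∧
      ∀ e, alg (X₀ + W) e → IsMatched μ e →
        ∀ r i, |e r i - μ r i - l r i W| ≤ D * noiseLevel M L W ^ 2 := by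
    filter_upwards [hC, eventually_all.2 fun r => eventually_all.2 fun i => hC' r i,
      eventually_matched_eq_id hη hdist] with W hW hW2 hW3
    refine ⟨hW.1, fun e he hm => ?_⟩
    obtain ⟨z, p, hp, hez, hz⟩ := hW.2 e he
    have hb : ∀ r j, |e r j - μ r (p j) - l r (p j) W| ≤ D * noiseLevel M L W ^ 2 := by
      intro r j
      have h := hW2 r (p j) (z r j) (hz r j)
      rw [hfμ, ← hez, ← hl] at h
      exact h.trans (mul_le_mul_of_nonneg_right (hCD _ _) (sq_nonneg _))
    have hid := hW3 e p hm hp fun r j => by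
      have h1 : |l r (p j) W| ≤ ∑ r, ∑ i, |l r i W| :=
        (Finset.single_le_sum (f := fun i => |l r i W|) (fun j _ => abs_nonneg _)
          (Finset.mem_univ (p j))).trans (Finset.single_le_sum (f := fun r => ∑ i, |l r i W|)
          (fun r _ => Finset.sum_nonneg fun j _ => abs_nonneg _) (Finset.mem_univ r))
      calc |e r j - μ r (p j)| = |(e r j - μ r (p j) - l r (p j) W) + l r (p j) W| := by
            rw [sub_add_cancel]
        _ ≤ _ := (abs_add_le _ _).trans (add_le_add (hb r j) h1)
    rw [hid] at hb
    exact hb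
  -- Along `comap (noiseLevel M L) (𝓝 0)`, an eventual property holds for all noise below some
  -- level; the constants are thus uniform in `W`.
  obtain ⟨ε', hε', hball⟩ := (Metric.nhds_basis_ball.comap (noiseLevel M L)).eventually_iff.1 hev
  refine ⟨ε', hε', D, fun W hW => hball ?_⟩
  have h0 : 0 ≤ noiseLevel M L W := Real.sqrt_nonneg _
  simpa [Real.dist_eq, abs_of_nonneg h0] using hW

end Frequencies
end NCEsprit

namespace NCEsprit

open Matrix Asymptotics

/-! ### NC Standard ESPRIT -/

section Standard

variable {R d N : ℕ}

/-- Spatial smoothing of the augmented measurements is real-linear. -/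
noncomputable def ssncLinear {M L : Fin R → ℕ} (hL : ∀ r, 1 ≤ L r ∧ L r ≤ M r) :
    Matrix (Idx M) (Fin N) ℂ →ₗ[ℝ]
      Matrix (Idx (subSize M L) ⊕ Idx (subSize M L)) (Idx L × Fin N) ℂ where
  toFun := ssnc M L
  map_add' X Y := by
    ext p c
    rcases p with p | p
    · simp only [ssnc_inl hL, Matrix.add_apply]
    · simp only [ssnc_inr hL, Matrix.add_apply, map_add]
  map_smul' a X := by
    ext p c
    rcases p with p | p
    · simp only [ssnc_inl hL, Matrix.smul_apply, RingHom.id_apply]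
    · simp only [ssnc_inr hL, Matrix.smul_apply, RingHom.id_apply, Complex.real_smul, map_mul,
        Complex.conj_ofReal]

section

variable {𝕜 : Type} [RCLike 𝕜] {ι κ τ : Type} [Fintype ι] [Fintype κ] [Fintype τ]
  {J₁ J₂ : Matrix τ ι 𝕜} {A : Matrix ι (Fin d) 𝕜} {B : Matrix (Fin d) κ 𝕜} {lam : Fin d → 𝕜}

theorem shiftPerturbation_add (W W' : Matrix ι κ 𝕜) :
    shiftPerturbation J₁ J₂ A B lam (W + W') =
      shiftPerturbation J₁ J₂ A B lam W + shiftPerturbation J₁ J₂ A B lam W' := by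
  simp only [shiftPerturbation, Matrix.add_mul, Matrix.mul_add, Matrix.mul_sub]
  abel

theorem shiftPerturbation_smul (a : ℝ) (W : Matrix ι κ 𝕜) :
    shiftPerturbation J₁ J₂ A B lam (a • W) = a • shiftPerturbation J₁ J₂ A B lam W := by
  simp only [shiftPerturbation, Matrix.smul_mul, Matrix.mul_smul, Matrix.mul_sub, smul_sub]

theorem EntrywiseBigO.shiftPerturbation {α : Type*} {l : Filter α} {ν : α → ℝ}
    {W : α → Matrix ι κ 𝕜} (hW : EntrywiseBigO l W ν) :
    EntrywiseBigO l (fun x => NCEsprit.shiftPerturbation J₁ J₂ A B lam (W x)) ν := by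
  have h1 := hW.mul_one_right (EntrywiseBigO.const (Bᴴ * (B * Bᴴ)⁻¹))
  exact (EntrywiseBigO.const _).mul_one_left ((EntrywiseBigO.const _).mul_one_left
    (((EntrywiseBigO.const J₂).mul_one_left h1).sub
      (((EntrywiseBigO.const J₁).mul_one_left h1).mul_one_right (EntrywiseBigO.const _))))

end

theorem norm_ssnc_le_noiseLevel (M L : Fin R → ℕ) (W : Matrix (Idx M) (Fin N) ℂ)
    (p : Idx (subSize M L) ⊕ Idx (subSize M L)) (c : Idx L × Fin N) :
    ‖ssnc M L W p c‖ ≤ noiseLevel M L W := by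
  refine Real.le_sqrt_of_sq_le ?_
  exact (Finset.single_le_sum (f := fun c => ‖ssnc M L W p c‖ ^ 2) (fun _ _ => sq_nonneg _)
    (Finset.mem_univ c)).trans (Finset.single_le_sum (f := fun p => ∑ c, ‖ssnc M L W p c‖ ^ 2)
    (fun _ _ => Finset.sum_nonneg fun _ _ => sq_nonneg _) (Finset.mem_univ p))

theorem entrywiseBigO_ssnc (M L : Fin R → ℕ) (l : Filter (Matrix (Idx M) (Fin N) ℂ)) :
    EntrywiseBigO l (ssnc M L) (noiseLevel M L) := fun p c =>
  IsBigO.of_bound 1 (Eventually.of_forall fun W => by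
    rw [one_mul]
    exact (norm_ssnc_le_noiseLevel M L W p c).trans (le_abs_self _))

/-- The first-order perturbation of the eigenvalue `exp (j μ_i^{(r)})` due to the noise `W`. -/
noncomputable def eigenvaluePerturbation (M L : Fin R → ℕ) (μ : Fin R → Fin d → ℝ) (δ : Fin R → ℝ)
    (φ : Fin d → ℝ) (S₀ : Matrix (Fin d) (Fin N) ℝ) (r : Fin R) (i : Fin d)
    (W : Matrix (Idx M) (Fin N) ℂ) : ℂ :=
  shiftPerturbation (dbl (shiftSel (subSize M L) r 0)) (dbl (shiftSel (subSize M L) r 1))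
    (ncSteering (subSize M L) μ (sourcePhase μ δ φ)) (smoothedSymbols L μ S₀)
    (fun i => Complex.exp (Complex.I * μ r i)) (ssnc M L W) i i

/-- The first-order error of the `i`-th frequency in the `r`-th mode. -/
noncomputable def frequencyPerturbation {M L : Fin R → ℕ} (hL : ∀ r, 1 ≤ L r ∧ L r ≤ M r)
    (μ : Fin R → Fin d → ℝ) (δ : Fin R → ℝ) (φ : Fin d → ℝ) (S₀ : Matrix (Fin d) (Fin N) ℝ)
    (r : Fin R) (i : Fin d) : Matrix (Idx M) (Fin N) ℂ →ₗ[ℝ] ℝ where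
  toFun W := (eigenvaluePerturbation M L μ δ φ S₀ r i W / Complex.exp (Complex.I * μ r i)).im
  map_add' W W' := by
    have h : ssnc M L (W + W') = ssnc M L W + ssnc M L W' := (ssncLinear hL).map_add W W'
    rw [eigenvaluePerturbation, h, shiftPerturbation_add, Matrix.add_apply, add_div,
      Complex.add_im]
    rfl
  map_smul' a W := by
    have h : ssnc M L (a • W) = a • ssnc M L W := (ssncLinear hL).map_smul a W
    rw [eigenvaluePerturbation, h, shiftPerturbation_smul, Matrix.smul_apply, Complex.real_smul,
      mul_div_assoc, Complex.im_ofReal_mul]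
    rfl

theorem isBigO_eigenvaluePerturbation (M L : Fin R → ℕ) (μ : Fin R → Fin d → ℝ) (δ : Fin R → ℝ)
    (φ : Fin d → ℝ) (S₀ : Matrix (Fin d) (Fin N) ℝ) (r : Fin R) (i : Fin d)
    (l : Filter (Matrix (Idx M) (Fin N) ℂ)) :
    eigenvaluePerturbation M L μ δ φ S₀ r i =O[l] noiseLevel M L :=
  (entrywiseBigO_ssnc M L l).shiftPerturbation i i

section Rank

variable {M L : Fin R → ℕ} {μ : Fin R → Fin d → ℝ} {δ : Fin R → ℝ} {φ : Fin d → ℝ} {S₀ : Matrix (Fin d) (Fin N) ℝ}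

theorem isUnit_gram_ncSteering (hL : ∀ r, 1 ≤ L r ∧ L r ≤ M r)
    (hrank : (ssnc M L (signal M μ δ φ S₀)).rank = d) :
    IsUnit ((ncSteering (subSize M L) μ (sourcePhase μ δ φ))ᴴ *
      ncSteering (subSize M L) μ (sourcePhase μ δ φ)).det := by
  rw [ssnc_signal hL] at hrank
  exact isUnit_gram_of_le_rank (hrank.symm.le.trans (rank_mul_le_left _ _))

theorem isUnit_gram_smoothedSymbols (hL : ∀ r, 1 ≤ L r ∧ L r ≤ M r)
    (hrank : (ssnc M L (signal M μ δ φ S₀)).rank = d) :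
    IsUnit (smoothedSymbols L μ S₀ * (smoothedSymbols L μ S₀)ᴴ).det := by
  open scoped ComplexOrder in
  rw [ssnc_signal hL] at hrank
  have h := isUnit_gram_of_le_rank (A := (smoothedSymbols L μ S₀)ᴴ) (by
    rw [rank_conjTranspose]
    exact hrank.symm.le.trans (rank_mul_le_right _ _))
  rwa [conjTranspose_conjTranspose] at h

theorem isUnit_gram_shiftSel (hL : ∀ r, 1 ≤ L r ∧ L r ≤ M r) {r : Fin R}
    (hshift : (dbl (shiftSel (subSize M L) r 0) * steeringSS M L μ δ φ).rank = d) :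
    IsUnit ((dbl (shiftSel (subSize M L) r 0) *
        ncSteering (subSize M L) μ (sourcePhase μ δ φ))ᴴ *
      (dbl (shiftSel (subSize M L) r 0) *
        ncSteering (subSize M L) μ (sourcePhase μ δ φ))).det := by
  rw [steeringSS_eq hL, ← Matrix.mul_assoc] at hshift
  exact isUnit_gram_of_le_rank (hshift.symm.le.trans (rank_mul_le_left _ _))

end Rank

/-- The generic expansion over `ℂ`, combined with the derivative `w ↦ Im (w / z)` of `arg` at `z =
exp (j μ)`. -/
theorem hasFirstOrderError_standard {M L : Fin R → ℕ} (hL : ∀ r, 1 ≤ L r ∧ L r ≤ M r)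
    {μ : Fin R → Fin d → ℝ} (hμ : ∀ r i, |μ r i| < Real.pi)
    (hdist : ∀ i j, (∀ r, μ r i = μ r j) → i = j)
    {δ : Fin R → ℝ} {φ : Fin d → ℝ} {S₀ : Matrix (Fin d) (Fin N) ℝ}
    (hrank : (ssnc M L (signal M μ δ φ S₀)).rank = d)
    (hshift : ∀ r, (dbl (shiftSel (subSize M L) r 0) * steeringSS M L μ δ φ).rank = d) :
    HasFirstOrderError M L μ (signal M μ δ φ S₀) (NCStandardESPRIT M L)
      (frequencyPerturbation hL μ δ φ S₀) := by
  have hν : Tendsto (noiseLevel (R := R) (N := N) M L) (comap (noiseLevel M L) (𝓝 0)) (𝓝 0) :=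
    tendsto_comap
  have hmain := esprit_expansion (J₁ := fun r => dbl (shiftSel (subSize M L) r 0))
    (J₂ := fun r => dbl (shiftSel (subSize M L) r 1))
    (lam := fun r i => Complex.exp (Complex.I * μ r i)) hν (isUnit_gram_ncSteering hL hrank)
    (isUnit_gram_smoothedSymbols hL hrank) (fun r => isUnit_gram_shiftSel hL (hshift r))
    (fun r => dbl_shiftSel_mul_ncSteering _ μ _ r)
    (fun i j h => hdist i j fun r => exp_I_mul_injective (hμ r i) (hμ r j) (h r))
    (entrywiseBigO_ssnc M L _)
  refine hasFirstOrderError_of_expansion (𝕜 := ℂ) (f := Complex.arg)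
    (g := fun r i => Complex.imAddGroupHom.comp
      (AddMonoidHom.mulRight (Complex.exp (Complex.I * μ r i))⁻¹))
    (lam := fun r i => Complex.exp (Complex.I * μ r i))
    (δ := eigenvaluePerturbation M L μ δ φ S₀) hdist ?_ ?_ ?_
    (fun r i => isBigO_eigenvaluePerturbation M L μ δ φ S₀ r i _) ?_ ?_
  · intro r i
    have h := abs_lt.1 (hμ r i)
    rw [mul_comm, Complex.arg_exp_mul_I, toIocMod_eq_self]
    constructor <;> linarith [h.1, h.2]
  · intro r i
    obtain ⟨ε, hε, h⟩ := abs_arg_sub_le (hμ r i)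
    refine ⟨ε, hε, 1, fun z hz => ?_⟩
    have harg : (Complex.exp (Complex.I * μ r i)).arg = μ r i := by
      have h := abs_lt.1 (hμ r i)
      rw [mul_comm, Complex.arg_exp_mul_I, toIocMod_eq_self]
      constructor <;> linarith [h.1, h.2]
    rw [harg]
    exact h z hz
  · intro r i
    refine ⟨1, fun w => ?_⟩
    refine (Complex.abs_im_le_norm _).trans ?_
    rw [AddMonoidHom.mulRight_apply, norm_mul, norm_inv, mul_comm Complex.I,
      Complex.norm_exp_ofReal_mul_I, inv_one, mul_one, one_mul]
  · intro r i W
    rfl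
  · obtain ⟨C, hC⟩ := hmain
    have hdata : ∀ W, ssnc M L (signal M μ δ φ S₀ + W) =
        ncSteering (subSize M L) μ (sourcePhase μ δ φ) * smoothedSymbols L μ S₀ + ssnc M L W :=
      fun W => by
        rw [← ssnc_signal hL]
        exact (ssncLinear hL).map_add _ _
    refine ⟨C, hC.mono fun W hW => ?_⟩
    rw [← hdata W] at hW
    obtain ⟨⟨U, G, z, hU, hG, hz⟩, hall⟩ := hW
    refine ⟨⟨fun r i => (z r i).arg, U, G, z, hU, hG, hz, fun _ _ => rfl⟩, ?_⟩
    rintro e ⟨U, G, z, hU, hG, hz, he⟩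
    obtain ⟨p, hp, hexp⟩ := hall U G z hU hG hz
    exact ⟨z, p, hp, he, hexp⟩

/-! ### Forward-backward averaging -/

/-- Dominance depends on the data only through the Gram matrix `X Xᴴ`; a factor `c` multiplies the
singular values by `√c`. -/
theorem IsDominantLeftSingular.of_gram {𝕜 ι κ κ' : Type} [RCLike 𝕜] [Fintype ι] [Fintype κ]
    [Fintype κ'] {X : Matrix ι κ 𝕜} {X' : Matrix ι κ' 𝕜} {c : ℝ} (hc : 0 ≤ c)
    (h : X' * X'ᴴ = (c : 𝕜) • (X * Xᴴ)) {U : Matrix ι (Fin d) 𝕜}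
    (hU : IsDominantLeftSingular X U) : IsDominantLeftSingular X' U := by
  obtain ⟨h1, s, hs0, hs, hdom⟩ := hU
  refine ⟨h1, fun i => Real.sqrt c * s i, fun i => mul_nonneg (Real.sqrt_nonneg _) (hs0 i), ?_,
    fun w hw i => ?_⟩
  · rw [h, Matrix.smul_mul, hs, ← Matrix.mul_smul]
    congr 1
    rw [← diagonal_smul]
    congr 1
    ext i
    simp only [Pi.smul_apply, smul_eq_mul, mul_pow, Real.sq_sqrt hc]
    push_cast
    ring
  · have e : ((∑ k, ‖(X'ᴴ *ᵥ w) k‖ ^ 2 : ℝ) : 𝕜) = ((c * ∑ k, ‖(Xᴴ *ᵥ w) k‖ ^ 2 : ℝ) : 𝕜) := by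
      rw [RCLike.ofReal_mul, sum_norm_sq_conjTranspose_mulVec, sum_norm_sq_conjTranspose_mulVec, h,
        smul_mulVec, dotProduct_smul, smul_eq_mul]
    have e' : ∑ k, ‖(X'ᴴ *ᵥ w) k‖ ^ 2 = c * ∑ k, ‖(Xᴴ *ᵥ w) k‖ ^ 2 := by exact_mod_cast e
    rw [e', mul_pow, Real.sq_sqrt hc, mul_assoc]
    exact mul_le_mul_of_nonneg_left (hdom w hw i) hc

theorem mul_exch_apply {ι κ : Type} [Fintype κ] [DecidableEq κ] {ρ : κ → κ} (hρ : ∀ k, ρ (ρ k) = k)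
    (Z : Matrix ι κ ℂ) (i : ι) (k : κ) : (Z * exch ρ) i k = Z i (ρ k) := by
  rw [Matrix.mul_apply, Finset.sum_eq_single (ρ k)]
  · simp [exch, hρ]
  · intro b _ hb
    have : ¬ k = ρ b := by
      rintro rfl
      exact hb (hρ b).symm
    simp [exch, this]
  · simp

/-- Forward-backward averaging of the non-circular data only repeats the data with the snapshots in
reversed order. -/
theorem ssncFBA_eq {M L : Fin R → ℕ} (hL : ∀ r, 1 ≤ L r ∧ L r ≤ M r)
    (X : Matrix (Idx M) (Fin N) ℂ) : ssncFBA M L X =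
      fromCols (ssnc M L X) ((ssnc M L X).submatrix id (Prod.map id Fin.rev)) := by
  unfold ssncFBA fba
  congr 1
  ext p c
  -- The reversal exchanges the two halves and mirrors the subarray, and the conjugation of the
  -- augmentation cancels that of the averaging. Only the snapshot order stays reversed.
  rw [mul_exch_apply fun c : Idx L × Fin N => by simp [Prod.map, revIdx_revIdx], exch_mul_apply]
  rcases p with p | p
  · change starRingEnd ℂ (ssnc M L X (Sum.inr (revIdx p)) (revIdx c.1, c.2.rev)) =
      ssnc M L X (Sum.inl p) (c.1, c.2.rev)
    rw [ssnc_inl hL, ssnc_inr hL, Complex.conj_conj, revIdx_shiftIdx]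
  · change starRingEnd ℂ (ssnc M L X (Sum.inl (revIdx p)) (revIdx c.1, c.2.rev)) =
      ssnc M L X (Sum.inr p) (c.1, c.2.rev)
    rw [ssnc_inl hL, ssnc_inr hL, ← revIdx_shiftIdx hL p c.1, revIdx_revIdx]

theorem mul_submatrix_rev {ι τ : Type} [Fintype ι] {L : Fin R → ℕ}
    (X : Matrix ι (Idx L × Fin N) ℂ) (Y : Matrix (Idx L × Fin N) τ ℂ) :
    X.submatrix id (Prod.map id Fin.rev) * Y.submatrix (Prod.map id Fin.rev) id = X * Y := by
  have h := submatrix_mul_equiv X Y id (Equiv.prodCongr (Equiv.refl (Idx L)) Fin.revPerm)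
    (id : τ → τ)
  rw [submatrix_id_id] at h
  exact h

/-- The appended block is a column permutation of the data and contributes the same Gram matrix once
more. -/
theorem ssncFBA_gram {M L : Fin R → ℕ} (hL : ∀ r, 1 ≤ L r ∧ L r ≤ M r)
    (X : Matrix (Idx M) (Fin N) ℂ) : ssncFBA M L X * (ssncFBA M L X)ᴴ =
      ((2 : ℝ) : ℂ) • (ssnc M L X * (ssnc M L X)ᴴ) := by
  rw [ssncFBA_eq hL, conjTranspose_fromCols_eq_fromRows_conjTranspose, fromCols_mul_fromRows,
    conjTranspose_submatrix, mul_submatrix_rev]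
  push_cast
  rw [two_smul]

/-- Forward-backward averaging has no effect on the signal subspace estimate. -/
theorem ncStandardESPRITwithFBA_iff {M L : Fin R → ℕ} (hL : ∀ r, 1 ≤ L r ∧ L r ≤ M r)
    (X : Matrix (Idx M) (Fin N) ℂ) (e : Fin R → Fin d → ℝ) :
    NCStandardESPRITwithFBA M L X e ↔ NCStandardESPRIT M L X e := by
  have h : ∀ U : Matrix (Idx (subSize M L) ⊕ Idx (subSize M L)) (Fin d) ℂ,
      IsDominantLeftSingular (ssncFBA M L X) U ↔ IsDominantLeftSingular (ssnc M L X) U := fun U =>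
    ⟨fun hU => hU.of_gram (c := 2⁻¹) (by norm_num) (by
      rw [ssncFBA_gram hL, smul_smul]
      push_cast
      norm_num), fun hU => hU.of_gram (by norm_num) (ssncFBA_gram hL X)⟩
  simp only [NCStandardESPRITwithFBA, NCStandardESPRIT, StandardESPRIT, h]

end Standard
end NCEsprit

namespace NCEsprit

open Matrix Asymptotics

/-! ### Complexification and conjugation -/

section Complexification

variable {ι κ τ : Type}

/-- A real matrix as a complex one. -/
def cpx (A : Matrix ι κ ℝ) : Matrix ι κ ℂ := A.map fun x : ℝ => (x : ℂ)

theorem cpx_injective : Function.Injective (cpx : Matrix ι κ ℝ → Matrix ι κ ℂ) :=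
  Matrix.map_injective Complex.ofReal_injective

theorem cpx_mul [Fintype κ] (A : Matrix ι κ ℝ) (B : Matrix κ τ ℝ) : cpx (A * B) = cpx A * cpx B :=
  Matrix.map_mul (f := Complex.ofRealHom)

theorem cpx_sub (A B : Matrix ι κ ℝ) : cpx (A - B) = cpx A - cpx B := by
  ext i j; simp [cpx]

theorem cpx_conjTranspose (A : Matrix ι κ ℝ) : cpx Aᴴ = (cpx A)ᴴ := by
  ext i j; simp [cpx]

theorem cpx_diagonal [DecidableEq ι] (a : ι → ℝ) :
    cpx (diagonal a) = diagonal fun i => (a i : ℂ) :=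
  diagonal_map Complex.ofReal_zero

theorem isUnit_det_of_cpx [Fintype ι] [DecidableEq ι] {A : Matrix ι ι ℝ}
    (h : IsUnit (cpx A).det) : IsUnit A.det := by
  have h1 : (cpx A).det = (A.det : ℂ) := (Complex.ofRealHom.map_det A).symm
  rw [h1] at h
  exact isUnit_iff_ne_zero.2 (by exact_mod_cast h.ne_zero)

theorem cpx_inv [Fintype ι] [DecidableEq ι] {A : Matrix ι ι ℝ} (h : IsUnit A.det) :
    cpx A⁻¹ = (cpx A)⁻¹ := by
  refine (inv_eq_right_inv ?_).symm
  rw [← cpx_mul, mul_nonsing_inv _ h]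
  ext i j
  by_cases hij : i = j
  · subst hij
    simp [cpx]
  · simp [cpx, hij]

theorem cpx_map_re {Z : Matrix ι κ ℂ} (h : conjM Z = Z) : cpx (Z.map Complex.re) = Z := by
  ext i j
  exact Complex.conj_eq_iff_re.1 (congrFun (congrFun h i) j)

theorem conjM_mul [Fintype κ] (A : Matrix ι κ ℂ) (B : Matrix κ τ ℂ) :
    conjM (A * B) = conjM A * conjM B :=
  Matrix.map_mul (f := starRingEnd ℂ)

theorem conjM_conjTranspose (A : Matrix ι κ ℂ) : conjM Aᴴ = (conjM A)ᴴ := by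
  ext i j; simp [conjM]

theorem exch_conjTranspose [DecidableEq ι] {ρ : ι → ι} (hρ : ∀ i, ρ (ρ i) = i) :
    (exch ρ)ᴴ = exch ρ := by
  ext i j
  have h : i = ρ j ↔ j = ρ i := ⟨fun h => by rw [h, hρ], fun h => by rw [h, hρ]⟩
  by_cases hij : j = ρ i
  · simp [exch, hij, hρ]
  · simp [exch, hij, h]

theorem exch_mul_exch [Fintype ι] [DecidableEq ι] {ρ : ι → ι} (hρ : ∀ i, ρ (ρ i) = i) :
    exch ρ * exch ρ = 1 := by
  ext i j
  rw [exch_mul_apply]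
  simp [exch, hρ, Matrix.one_apply, eq_comm]

theorem revSum_revSum {ρ : ι → ι} (hρ : ∀ i, ρ (ρ i) = i) (x : ι ⊕ ι) :
    revSum ρ (revSum ρ x) = x := by
  rcases x with x | x <;> simp [revSum, hρ]

/-! ### The left-`Π`-real matrix -/

theorem leftReal_mul_conjTranspose [Fintype ι] [DecidableEq ι] {ρ : ι → ι} (hρ : ∀ i, ρ (ρ i) = i) :
    leftReal ρ * (leftReal ρ)ᴴ = 1 := by
  have hs : ((Real.sqrt 2 : ℝ) : ℂ)⁻¹ * star (((Real.sqrt 2 : ℝ) : ℂ)⁻¹) = 2⁻¹ := by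
    rw [star_inv₀, RCLike.star_def, Complex.conj_ofReal, ← mul_inv, ← Complex.ofReal_mul,
      Real.mul_self_sqrt (by norm_num)]
    norm_num
  have h2 : (2⁻¹ : ℂ) • ((1 : Matrix ι ι ℂ) + 1) = 1 := by
    rw [← two_smul ℂ (1 : Matrix ι ι ℂ), smul_smul]
    norm_num
  rw [leftReal, conjTranspose_smul, Matrix.smul_mul, Matrix.mul_smul, smul_smul, hs,
    fromBlocks_conjTranspose, fromBlocks_multiply, ← fromBlocks_one]
  have e1 : star Complex.I = -Complex.I := Complex.conj_I
  simp only [conjTranspose_smul, exch_conjTranspose hρ, conjTranspose_one, Matrix.smul_mul,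
    Matrix.mul_smul, exch_mul_exch hρ, smul_smul, star_neg, e1, fromBlocks_smul,
    Matrix.one_mul, Matrix.mul_one, mul_neg, neg_mul, Complex.I_mul_I, neg_neg, one_smul, h2]
  simp

/-- This is left-`Π`-reality. Through it, conjugating a transformed matrix amounts to conjugating
and reversing the original one, so centro-Hermitian matrices become real. -/
theorem conjM_leftReal [Fintype ι] [DecidableEq ι] {ρ : ι → ι} (hρ : ∀ i, ρ (ρ i) = i) :
    conjM (leftReal ρ) = exch (revSum ρ) * leftReal ρ := by
  ext i j
  rw [exch_mul_apply]
  have h1 : ∀ i j : ι, starRingEnd ℂ ((1 : Matrix ι ι ℂ) i j) = (1 : Matrix ι ι ℂ) i j :=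
    fun i j => by by_cases hij : i = j <;> simp [Matrix.one_apply, hij]
  have h2 : ∀ i j : ι, starRingEnd ℂ (exch ρ i j) = exch ρ i j :=
    fun i j => by by_cases hij : j = ρ i <;> simp [exch, hij]
  have h3 : ∀ i j : ι, exch ρ (ρ i) j = (1 : Matrix ι ι ℂ) i j :=
    fun i j => by simp [exch, hρ, Matrix.one_apply, eq_comm]
  have h4 : ∀ i j : ι, (1 : Matrix ι ι ℂ) (ρ i) j = exch ρ i j :=
    fun i j => by simp [exch, Matrix.one_apply, eq_comm]
  rcases i with i | i <;> rcases j with j | j <;>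
    simp [conjM, leftReal, revSum, h1, h2, h3, h4]

theorem conjM_conjTranspose_leftReal_mul [Fintype ι] [DecidableEq ι] {ρ : ι → ι}
    (hρ : ∀ i, ρ (ρ i) = i) (Z : Matrix (ι ⊕ ι) κ ℂ) :
    conjM ((leftReal ρ)ᴴ * Z) = (leftReal ρ)ᴴ * (exch (revSum ρ) * conjM Z) := by
  rw [conjM_mul, conjM_conjTranspose, conjM_leftReal hρ, conjTranspose_mul,
    exch_conjTranspose (revSum_revSum hρ), Matrix.mul_assoc]

theorem conjM_mul_leftReal [Fintype ι] [DecidableEq ι] {ρ : ι → ι}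
    (hρ : ∀ i, ρ (ρ i) = i) (Z : Matrix κ (ι ⊕ ι) ℂ) :
    conjM (Z * leftReal ρ) = conjM Z * exch (revSum ρ) * leftReal ρ := by
  rw [conjM_mul, conjM_leftReal hρ, Matrix.mul_assoc]

/-- The averaged matrix is centro-Hermitian. -/
theorem exch_mul_conjM_fba_mul_exch [Fintype ι] [DecidableEq ι] [Fintype κ] [DecidableEq κ]
    {ρ : ι → ι} {σ : κ → κ} (hρ : ∀ i, ρ (ρ i) = i) (hσ : ∀ k, σ (σ k) = k) (X : Matrix ι κ ℂ) :
    exch ρ * conjM (fba ρ σ X) * exch (revSum σ) = fba ρ σ X := by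
  ext p c
  rw [mul_exch_apply (revSum_revSum hσ), exch_mul_apply]
  rcases c with c | c
  · change starRingEnd ℂ ((exch ρ * conjM X * exch σ) (ρ p) (σ c)) = X p c
    rw [mul_exch_apply hσ, exch_mul_apply, hρ, hσ]
    exact Complex.conj_conj _
  · change starRingEnd ℂ (X (ρ p) (σ c)) = (exch ρ * conjM X * exch σ) p c
    rw [mul_exch_apply hσ, exch_mul_apply]
    rfl

end Complexification

/-! ### The transformed selection matrices -/

section Selection

variable {R d N : ℕ}

theorem dbl_apply_revSum {ι κ : Type} {ρ : ι → ι} {σ : κ → κ} (B : Matrix ι κ ℂ) (p : ι ⊕ ι)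
    (q : κ ⊕ κ) : dbl B (revSum ρ p) (revSum σ q) = dbl (B.submatrix ρ σ) p q := by
  rcases p with p | p <;> rcases q with q | q <;> rfl

theorem revIdx_selIdx {m : Fin R → ℕ} (r : Fin R) (p : Idx (shorten m r)) :
    revIdx (selIdx r 1 (revIdx p)) = selIdx r 0 p := by
  ext s
  have h1 := (p s).2
  have h4 : ((p s).rev : ℕ) = shorten m r s - (p s + 1) := Fin.val_rev _
  simp only [revIdx, selIdx, Fin.val_rev (n := m s), h4]
  by_cases h : s = r
  · subst h
    simp only [shorten, Function.update_self, if_true, Fin.val_one, Fin.val_zero] at h1 ⊢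
    omega
  · simp only [shorten, Function.update_of_ne h, h, if_false] at h1 ⊢
    omega

theorem shiftSel_submatrix_revIdx (m : Fin R → ℕ) (r : Fin R) :
    (shiftSel m r 1).submatrix revIdx revIdx = shiftSel m r 0 := by
  ext p q
  have h1 := kron_sel_apply (P := shorten m r) (M := m) (a := fun s => if s = r then 1 else 0)
    (p := revIdx p) (q := selIdx r 1 (revIdx p)) (fun _ => rfl) (revIdx q)
  -- The zero shift is written `if s = r then 0 else 0` to match the unfolded `shiftSel m r 0`.
  have h0 := kron_sel_apply (P := shorten m r) (M := m) (a := fun s => if s = r then 0 else 0)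
    (p := p) (q := selIdx r 0 p) (fun _ => rfl) q
  refine h1.trans (Eq.trans ?_ h0.symm)
  congr 1
  rw [← revIdx_selIdx, eq_iff_iff]
  constructor
  · intro h
    rw [← h, revIdx_revIdx]
  · intro h
    rw [h, revIdx_revIdx]

theorem conjM_dbl_shiftSel (m : Fin R → ℕ) (r : Fin R) (k : ℕ) :
    conjM (dbl (shiftSel m r k)) = dbl (shiftSel m r k) := by
  ext p q
  rcases p with p | p <;> rcases q with q | q <;>
    simp [conjM, dbl, shiftSel, kron, sel, apply_ite]

/-- Since `Π J₂ Π = J₁`, conjugation exchanges the transformed selections. Hence `K₁ = Qᴴ (J₂ + J₁)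
Q` and `K₂ = -j Qᴴ (J₂ - J₁) Q`. -/
theorem conjM_transSel (m : Fin R → ℕ) (r : Fin R) : conjM (transSel m r) =
    (leftReal (revIdx : Idx (shorten m r) → Idx (shorten m r)))ᴴ * dbl (shiftSel m r 0) *
      leftReal (revIdx : Idx m → Idx m) := by
  rw [transSel, conjM_mul_leftReal revIdx_revIdx, conjM_conjTranspose_leftReal_mul revIdx_revIdx,
    conjM_dbl_shiftSel, Matrix.mul_assoc _ _ (exch _)]
  congr 2
  ext p q
  rw [mul_exch_apply (revSum_revSum revIdx_revIdx), exch_mul_apply, dbl_apply_revSum,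
    shiftSel_submatrix_revIdx]

theorem cpx_realSel₁ (m : Fin R → ℕ) (r : Fin R) : cpx (realSel₁ m r) =
    (leftReal (revIdx : Idx (shorten m r) → Idx (shorten m r)))ᴴ *
      ((dbl (shiftSel m r 1) + dbl (shiftSel m r 0)) * leftReal (revIdx : Idx m → Idx m)) := by
  have h : cpx (realSel₁ m r) = transSel m r + conjM (transSel m r) := by
    ext p q
    simp only [cpx, realSel₁, map_apply, Matrix.smul_apply, Matrix.add_apply, conjM,
      Complex.add_conj, smul_eq_mul]
  rw [h, conjM_transSel, transSel, Matrix.add_mul, Matrix.mul_add, Matrix.mul_assoc,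
    Matrix.mul_assoc]

theorem cpx_realSel₂ (m : Fin R → ℕ) (r : Fin R) : cpx (realSel₂ m r) =
    (leftReal (revIdx : Idx (shorten m r) → Idx (shorten m r)))ᴴ *
      ((-Complex.I) • ((dbl (shiftSel m r 1) - dbl (shiftSel m r 0)) *
        leftReal (revIdx : Idx m → Idx m))) := by
  have h : cpx (realSel₂ m r) = (-Complex.I) • (transSel m r - conjM (transSel m r)) := by
    ext p q
    simp only [cpx, realSel₂, map_apply, Matrix.smul_apply, Matrix.sub_apply, conjM,
      Complex.sub_conj, smul_eq_mul]
    push_cast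
    linear_combination (2 * ((transSel m r p q).im : ℂ)) * Complex.I_mul_I
  rw [h, conjM_transSel, transSel, Matrix.sub_mul, Matrix.mul_smul, Matrix.mul_sub,
    Matrix.mul_assoc, Matrix.mul_assoc]

end Selection
end NCEsprit

namespace NCEsprit

open Matrix Asymptotics

/-! ### The real-valued shift invariance equations -/

section Cayley

variable {d : ℕ} {ι κ κ' τ : Type} [Fintype ι] [DecidableEq ι] [Fintype κ] [Fintype κ'] [Fintype τ]
  {J₁ J₂ : Matrix τ ι ℂ} {A : Matrix ι (Fin d) ℂ} {z : Fin d → ℂ}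
  {Q : Matrix ι ι ℂ} {P : Matrix τ τ ℂ}

theorem sum_sel_mul (hQ : Q * Qᴴ = 1) (h : J₂ * A = J₁ * A * diagonal z) :
    Pᴴ * ((J₂ + J₁) * Q) * (Qᴴ * A) = Pᴴ * (J₁ * A * diagonal fun i => 1 + z i) := by
  have h1 : (J₂ + J₁) * A = J₁ * A * diagonal fun i => 1 + z i := by
    rw [Matrix.add_mul, h]
    ext p i
    simp only [Matrix.add_apply, mul_diagonal]
    ring
  rw [Matrix.mul_assoc, Matrix.mul_assoc (J₂ + J₁), ← Matrix.mul_assoc Q, hQ, Matrix.one_mul, h1]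

/-- Difference and sum of the shifted steering matrices, with the factor `-j`, have the ratio `-j (z
- 1) / (z + 1)`. For `z = exp (j μ)` this Cayley transform is `tan (μ / 2)`. -/
theorem diff_sel_mul (hQ : Q * Qᴴ = 1) (h : J₂ * A = J₁ * A * diagonal z) {a : Fin d → ℂ}
    (ha : ∀ i, -Complex.I * (z i - 1) = (1 + z i) * a i) :
    Pᴴ * ((-Complex.I) • ((J₂ - J₁) * Q)) * (Qᴴ * A) =
      Pᴴ * ((J₂ + J₁) * Q) * (Qᴴ * A) * diagonal a := by
  have h1 : ((-Complex.I) • ((J₂ - J₁) * Q)) * (Qᴴ * A) =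
      J₁ * A * diagonal fun i => -Complex.I * (z i - 1) := by
    rw [Matrix.smul_mul, Matrix.mul_assoc, ← Matrix.mul_assoc Q, hQ, Matrix.one_mul,
      Matrix.sub_mul, h]
    ext p i
    simp only [Matrix.smul_apply, Matrix.sub_apply, mul_diagonal, smul_eq_mul]
    ring
  rw [sum_sel_mul hQ h, Matrix.mul_assoc Pᴴ, h1, Matrix.mul_assoc Pᴴ, Matrix.mul_assoc (J₁ * A),
    diagonal_mul_diagonal]
  simp only [ha]

theorem sum_sel_gram [DecidableEq τ] (hQ : Q * Qᴴ = 1) (hP : P * Pᴴ = 1) (h : J₂ * A = J₁ * A * diagonal z) :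
    (Pᴴ * ((J₂ + J₁) * Q) * (Qᴴ * A))ᴴ * (Pᴴ * ((J₂ + J₁) * Q) * (Qᴴ * A)) =
      (diagonal fun i => 1 + z i)ᴴ * ((J₁ * A)ᴴ * (J₁ * A)) * diagonal fun i => 1 + z i := by
  rw [sum_sel_mul hQ h, conjTranspose_mul, conjTranspose_conjTranspose, Matrix.mul_assoc,
    ← Matrix.mul_assoc P, hP, Matrix.one_mul, conjTranspose_mul]
  simp only [Matrix.mul_assoc]

theorem isUnit_det_diagonal {a : Fin d → ℂ} (ha : ∀ i, a i ≠ 0) : IsUnit (diagonal a).det := by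
  rw [det_diagonal]
  exact isUnit_iff_ne_zero.2 (Finset.prod_ne_zero_iff.2 fun i _ => ha i)

theorem isUnit_sum_sel_gram [DecidableEq τ] (hQ : Q * Qᴴ = 1) (hP : P * Pᴴ = 1)
    (h : J₂ * A = J₁ * A * diagonal z) (hJ : IsUnit ((J₁ * A)ᴴ * (J₁ * A)).det)
    (hz : ∀ i, 1 + z i ≠ 0) :
    IsUnit ((Pᴴ * ((J₂ + J₁) * Q) * (Qᴴ * A))ᴴ * (Pᴴ * ((J₂ + J₁) * Q) * (Qᴴ * A))).det := by
  rw [sum_sel_gram hQ hP h, det_mul, det_mul, det_conjTranspose]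
  exact ((isUnit_det_diagonal hz).star.mul hJ).mul (isUnit_det_diagonal hz)

/-- The first-order perturbations of the eigenvalues `ω = tan (μ / 2)` are those of
`z = exp (j μ)`, transformed by the derivative of the Cayley transform. -/
theorem shiftPerturbation_cayley [DecidableEq τ] (hQ : Q * Qᴴ = 1) (hP : P * Pᴴ = 1)
    (h : J₂ * A = J₁ * A * diagonal z) {a : Fin d → ℂ}
    (hz : ∀ i, 1 + z i ≠ 0) (ha : ∀ i, -Complex.I * (z i - 1) = (1 + z i) * a i)
    {B : Matrix (Fin d) κ ℂ} {W : Matrix ι κ ℂ} {B' : Matrix (Fin d) κ' ℂ} {W' : Matrix ι κ' ℂ}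
    (hW : W' * (B'ᴴ * (B' * B'ᴴ)⁻¹) = Qᴴ * (W * (Bᴴ * (B * Bᴴ)⁻¹))) (i : Fin d) :
    shiftPerturbation (Pᴴ * ((J₂ + J₁) * Q)) (Pᴴ * ((-Complex.I) • ((J₂ - J₁) * Q))) (Qᴴ * A) B' a
        W' i i =
      -2 * Complex.I / (1 + z i) ^ 2 * shiftPerturbation J₁ J₂ A B z W i i := by
  have hD := isUnit_det_diagonal hz
  rw [shiftPerturbation, shiftPerturbation, sum_sel_gram hQ hP h, hW, sum_sel_mul hQ h]
  generalize W * (Bᴴ * (B * Bᴴ)⁻¹) = V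
  set D := diagonal fun i => 1 + z i with hDdef
  generalize J₁ * A = H
  have e1 : Pᴴ * ((J₂ + J₁) * Q) * (Qᴴ * V) = Pᴴ * ((J₂ + J₁) * V) := by
    rw [Matrix.mul_assoc, Matrix.mul_assoc (J₂ + J₁), ← Matrix.mul_assoc Q, hQ, Matrix.one_mul]
  have e2 : Pᴴ * ((-Complex.I) • ((J₂ - J₁) * Q)) * (Qᴴ * V) =
      Pᴴ * ((-Complex.I) • ((J₂ - J₁) * V)) := by
    rw [Matrix.mul_assoc, Matrix.smul_mul, Matrix.mul_assoc (J₂ - J₁), ← Matrix.mul_assoc Q, hQ,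
      Matrix.one_mul]
  have hDh : IsUnit Dᴴ.det := by
    rw [det_conjTranspose]
    exact hD.star
  have hDi : D⁻¹ = diagonal fun i => (1 + z i)⁻¹ := by
    refine inv_eq_right_inv ?_
    rw [hDdef, diagonal_mul_diagonal, ← diagonal_one]
    congr 1
    ext i
    exact mul_inv_cancel₀ (hz i)
  rw [e1, e2, Matrix.mul_assoc Pᴴ _ (diagonal a), ← Matrix.mul_sub, conjTranspose_mul,
    conjTranspose_conjTranspose, Matrix.mul_assoc _ P, ← Matrix.mul_assoc P, hP, Matrix.one_mul,
    conjTranspose_mul, Matrix.mul_inv_rev, Matrix.mul_inv_rev, Matrix.mul_assoc D⁻¹,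
    Matrix.mul_assoc (Hᴴ * H)⁻¹, Matrix.mul_assoc Dᴴ, nonsing_inv_mul_cancel_left _ _ hDh, hDi,
    diagonal_mul]
  have e3 : (Hᴴ * H)⁻¹ * (Hᴴ * ((-Complex.I) • ((J₂ - J₁) * V) - (J₂ + J₁) * V * diagonal a)) =
      (-Complex.I) • ((Hᴴ * H)⁻¹ * (Hᴴ * (J₂ * V)) - (Hᴴ * H)⁻¹ * (Hᴴ * (J₁ * V))) -
        ((Hᴴ * H)⁻¹ * (Hᴴ * (J₂ * V)) + (Hᴴ * H)⁻¹ * (Hᴴ * (J₁ * V))) * diagonal a := by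
    simp only [Matrix.mul_sub, Matrix.sub_mul, Matrix.add_mul, Matrix.mul_add, Matrix.mul_smul,
      Matrix.mul_assoc, smul_sub]
  have e4 : (Hᴴ * H)⁻¹ * (Hᴴ * (J₂ * V - J₁ * V * diagonal z)) =
      (Hᴴ * H)⁻¹ * (Hᴴ * (J₂ * V)) - (Hᴴ * H)⁻¹ * (Hᴴ * (J₁ * V)) * diagonal z := by
    simp only [Matrix.mul_sub, Matrix.mul_assoc]
  rw [e3, e4]
  simp only [Matrix.sub_apply, Matrix.smul_apply, Matrix.add_apply, mul_diagonal, smul_eq_mul]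
  -- Both sides are multiples of `u - v z`, because `-j (u - v) - (u + v) a = -2 j (u - v z) / (1 +
  -- z)`; the second factor `1 / (1 + z)` comes from `D⁻¹`.
  generalize ((Hᴴ * H)⁻¹ * (Hᴴ * (J₂ * V))) i i = u
  generalize ((Hᴴ * H)⁻¹ * (Hᴴ * (J₁ * V))) i i = v
  have hi := hz i
  have hai : a i = -Complex.I * (z i - 1) / (1 + z i) := by
    rw [ha i, mul_div_cancel_left₀ _ hi]
  rw [hai]
  field_simp
  ring

end Cayley

theorem cpx_shiftPerturbation {d : ℕ} {ι κ τ : Type} [Fintype ι] [Fintype κ] [Fintype τ] {J₁ J₂ : Matrix τ ι ℝ} {A : Matrix ι (Fin d) ℝ}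
    {B : Matrix (Fin d) κ ℝ} {a : Fin d → ℝ} {W : Matrix ι κ ℝ}
    (hJ : IsUnit ((J₁ * A)ᴴ * (J₁ * A)).det) (hB : IsUnit (B * Bᴴ).det) :
    cpx (shiftPerturbation J₁ J₂ A B a W) =
      shiftPerturbation (cpx J₁) (cpx J₂) (cpx A) (cpx B) (fun i => (a i : ℂ)) (cpx W) := by
  simp only [shiftPerturbation, cpx_mul, cpx_sub, cpx_inv hJ, cpx_inv hB, cpx_conjTranspose,
    cpx_diagonal]
end NCEsprit

namespace NCEsprit

open Matrix Asymptotics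

/-! ### NC Unitary ESPRIT -/

section Unitary

variable {R d N : ℕ} {M L : Fin R → ℕ}

theorem prodMap_revIdx_rev (c : Idx L × Fin N) :
    Prod.map revIdx Fin.rev (Prod.map revIdx Fin.rev c) = c := by
  simp [Prod.map, revIdx_revIdx]

variable (M L) in
/-- The real-valued data matrix of NC Unitary ESPRIT. -/
noncomputable def realData (X : Matrix (Idx M) (Fin N) ℂ) :
    Matrix (Idx (subSize M L) ⊕ Idx (subSize M L)) ((Idx L × Fin N) ⊕ (Idx L × Fin N)) ℝ :=
  ((leftReal (revIdx : Idx (subSize M L) → Idx (subSize M L)))ᴴ * ssncFBA M L X *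
    leftReal (Prod.map revIdx Fin.rev : Idx L × Fin N → Idx L × Fin N)).map Complex.re

/-- The averaged matrix is centro-Hermitian, so its transform is invariant under conjugation and
taking real parts loses nothing. -/
theorem cpx_realData (X : Matrix (Idx M) (Fin N) ℂ) : cpx (realData M L X) =
    (leftReal (revIdx : Idx (subSize M L) → Idx (subSize M L)))ᴴ * ssncFBA M L X *
      leftReal (Prod.map revIdx Fin.rev : Idx L × Fin N → Idx L × Fin N) := by
  refine cpx_map_re ?_
  rw [conjM_mul_leftReal prodMap_revIdx_rev, conjM_conjTranspose_leftReal_mul revIdx_revIdx,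
    Matrix.mul_assoc (leftReal _)ᴴ, ssncFBA, exch_mul_conjM_fba_mul_exch
      (revSum_revSum revIdx_revIdx) prodMap_revIdx_rev]

theorem ncUnitaryESPRIT_iff (X : Matrix (Idx M) (Fin N) ℂ) (e : Fin R → Fin d → ℝ) :
    NCUnitaryESPRIT M L X e ↔
      ∃ (E : Matrix (Idx (subSize M L) ⊕ Idx (subSize M L)) (Fin d) ℝ)
        (G : Fin R → Matrix (Fin d) (Fin d) ℝ) (om : Fin R → Fin d → ℝ),
        IsDominantLeftSingular (realData M L X) E ∧
        (∀ r, IsLSSolution (realSel₁ (subSize M L) r) (realSel₂ (subSize M L) r) E (G r)) ∧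
        IsJointEigenvalues G om ∧ ∀ r i, e r i = 2 * Real.arctan (om r i) := by
  constructor
  · rintro ⟨Y, E, G, om, hY, h⟩
    have hY' : Y = realData M L X := cpx_injective (hY.trans (cpx_realData X).symm)
    exact ⟨E, G, om, hY' ▸ h⟩
  · rintro ⟨E, G, om, h⟩
    exact ⟨realData M L X, E, G, om, cpx_realData X, h⟩

theorem ssncFBA_add (hL : ∀ r, 1 ≤ L r ∧ L r ≤ M r) (X X' : Matrix (Idx M) (Fin N) ℂ) :
    ssncFBA M L (X + X') = ssncFBA M L X + ssncFBA M L X' := by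
  have h : ssnc M L (X + X') = ssnc M L X + ssnc M L X' := (ssncLinear hL).map_add X X'
  rw [ssncFBA_eq hL, ssncFBA_eq hL, ssncFBA_eq hL, h]
  ext p c
  rcases c with c | c <;> rfl

theorem realData_add (hL : ∀ r, 1 ≤ L r ∧ L r ≤ M r) (X X' : Matrix (Idx M) (Fin N) ℂ) :
    realData M L (X + X') = realData M L X + realData M L X' := by
  ext p c
  simp only [realData, ssncFBA_add hL, Matrix.mul_add, Matrix.add_mul, map_apply,
    Matrix.add_apply, Complex.add_re]

theorem entrywiseBigO_realData (hL : ∀ r, 1 ≤ L r ∧ L r ≤ M r)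
    (l : Filter (Matrix (Idx M) (Fin N) ℂ)) :
    EntrywiseBigO l (realData M L) (noiseLevel M L) := by
  have h : EntrywiseBigO l (ssncFBA M L) (noiseLevel (N := N) M L) := fun p c => by
    simp only [ssncFBA_eq hL]
    rcases c with c | c
    · exact entrywiseBigO_ssnc M L l p c
    · exact entrywiseBigO_ssnc M L l p (Prod.map id Fin.rev c)
  have h' := ((EntrywiseBigO.const (leftReal
    (revIdx : Idx (subSize M L) → Idx (subSize M L)))ᴴ).mul_one_left h).mul_one_right
    (EntrywiseBigO.const (leftReal (Prod.map revIdx Fin.rev : Idx L × Fin N → Idx L × Fin N)))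
  exact fun p c => (IsBigO.of_bound 1 (Eventually.of_forall fun W => by
    rw [one_mul]
    exact Complex.abs_re_le_norm _)).trans (h' p c)

/-- Exchanging the halves swaps each source phase with its conjugate, and reversal conjugates the
centered steering vectors. Hence `Qᴴ A` is real. -/
theorem exch_mul_conjM_ncSteering (m : Fin R → ℕ) (μ : Fin R → Fin d → ℝ) (ξ : Fin d → ℂ) :
    exch (revSum (revIdx : Idx m → Idx m)) * conjM (ncSteering m μ ξ) = ncSteering m μ ξ := by
  ext p i
  rw [exch_mul_apply]
  rcases p with p | p
  · change starRingEnd ℂ (steering m μ (revIdx p) i * starRingEnd ℂ (ξ i)) = steering m μ p i * ξ i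
    rw [map_mul, conj_steering_revIdx, Complex.conj_conj]
  · change starRingEnd ℂ (steering m μ (revIdx p) i * ξ i) =
      steering m μ p i * starRingEnd ℂ (ξ i)
    rw [map_mul, conj_steering_revIdx]

/-- The real-valued steering matrix. -/
noncomputable def realSteering (m : Fin R → ℕ) (μ : Fin R → Fin d → ℝ) (ξ : Fin d → ℂ) :
    Matrix (Idx m ⊕ Idx m) (Fin d) ℝ :=
  ((leftReal (revIdx : Idx m → Idx m))ᴴ * ncSteering m μ ξ).map Complex.re

theorem cpx_realSteering (m : Fin R → ℕ) (μ : Fin R → Fin d → ℝ) (ξ : Fin d → ℂ) :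
    cpx (realSteering m μ ξ) = (leftReal (revIdx : Idx m → Idx m))ᴴ * ncSteering m μ ξ :=
  cpx_map_re (by
    rw [conjM_conjTranspose_leftReal_mul revIdx_revIdx, exch_mul_conjM_ncSteering])

/-- The received symbols after forward-backward averaging. -/
noncomputable def averagedSymbols (L : Fin R → ℕ) (μ : Fin R → Fin d → ℝ)
    (S₀ : Matrix (Fin d) (Fin N) ℝ) : Matrix (Fin d) ((Idx L × Fin N) ⊕ (Idx L × Fin N)) ℂ :=
  fromCols (smoothedSymbols L μ S₀) ((smoothedSymbols L μ S₀).submatrix id (Prod.map id Fin.rev))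

/-- Mirroring the subarrays conjugates their steering factors, and exchanging the two blocks absorbs
the snapshot reversal. Hence the transformed symbols are real. -/
theorem averagedSymbols_mul_exch (L : Fin R → ℕ) (μ : Fin R → Fin d → ℝ)
    (S₀ : Matrix (Fin d) (Fin N) ℝ) : conjM (averagedSymbols L μ S₀) *
      exch (revSum (Prod.map revIdx Fin.rev : Idx L × Fin N → Idx L × Fin N)) =
    averagedSymbols L μ S₀ := by
  ext i c
  rw [mul_exch_apply (revSum_revSum prodMap_revIdx_rev)]
  rcases c with c | c
  · change starRingEnd ℂ (steering L μ (revIdx c.1) i * (S₀ i c.2.rev.rev : ℂ)) =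
      steering L μ c.1 i * (S₀ i c.2 : ℂ)
    rw [map_mul, conj_steering_revIdx, Complex.conj_ofReal, Fin.rev_rev]
  · change starRingEnd ℂ (steering L μ (revIdx c.1) i * (S₀ i c.2.rev : ℂ)) =
      steering L μ c.1 i * (S₀ i c.2.rev : ℂ)
    rw [map_mul, conj_steering_revIdx, Complex.conj_ofReal]

/-- The real-valued symbols. -/
noncomputable def realSymbols (L : Fin R → ℕ) (μ : Fin R → Fin d → ℝ)
    (S₀ : Matrix (Fin d) (Fin N) ℝ) : Matrix (Fin d) ((Idx L × Fin N) ⊕ (Idx L × Fin N)) ℝ :=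
  (averagedSymbols L μ S₀ *
    leftReal (Prod.map revIdx Fin.rev : Idx L × Fin N → Idx L × Fin N)).map Complex.re

theorem cpx_realSymbols (L : Fin R → ℕ) (μ : Fin R → Fin d → ℝ) (S₀ : Matrix (Fin d) (Fin N) ℝ) :
    cpx (realSymbols L μ S₀) = averagedSymbols L μ S₀ *
      leftReal (Prod.map revIdx Fin.rev : Idx L × Fin N → Idx L × Fin N) :=
  cpx_map_re (by rw [conjM_mul_leftReal prodMap_revIdx_rev, averagedSymbols_mul_exch])

/-- Data and symbols are repeated with the same column permutation. The resulting factor `2` cancels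
that of `averagedSymbols_gram` in the product with the pseudo-inverse. -/
theorem ssncFBA_mul_averagedSymbols (hL : ∀ r, 1 ≤ L r ∧ L r ≤ M r) (μ : Fin R → Fin d → ℝ)
    (S₀ : Matrix (Fin d) (Fin N) ℝ) (X : Matrix (Idx M) (Fin N) ℂ) :
    ssncFBA M L X * (averagedSymbols L μ S₀)ᴴ =
      (2 : ℂ) • (ssnc M L X * (smoothedSymbols L μ S₀)ᴴ) := by
  rw [ssncFBA_eq hL, averagedSymbols, conjTranspose_fromCols_eq_fromRows_conjTranspose,
    fromCols_mul_fromRows, conjTranspose_submatrix, mul_submatrix_rev, two_smul]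

theorem averagedSymbols_gram (L : Fin R → ℕ) (μ : Fin R → Fin d → ℝ)
    (S₀ : Matrix (Fin d) (Fin N) ℝ) : averagedSymbols L μ S₀ * (averagedSymbols L μ S₀)ᴴ =
      (2 : ℂ) • (smoothedSymbols L μ S₀ * (smoothedSymbols L μ S₀)ᴴ) := by
  rw [averagedSymbols, conjTranspose_fromCols_eq_fromRows_conjTranspose,
    fromCols_mul_fromRows, conjTranspose_submatrix, mul_submatrix_rev, two_smul]

theorem realData_signal (hL : ∀ r, 1 ≤ L r ∧ L r ≤ M r) (μ : Fin R → Fin d → ℝ) (δ : Fin R → ℝ)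
    (φ : Fin d → ℝ) (S₀ : Matrix (Fin d) (Fin N) ℝ) : realData M L (signal M μ δ φ S₀) =
      realSteering (subSize M L) μ (sourcePhase μ δ φ) * realSymbols L μ S₀ := by
  refine cpx_injective ?_
  have h : ssncFBA M L (signal M μ δ φ S₀) =
      ncSteering (subSize M L) μ (sourcePhase μ δ φ) * averagedSymbols L μ S₀ := by
    rw [ssncFBA_eq hL, ssnc_signal hL, averagedSymbols, mul_fromCols]
    rfl
  rw [cpx_realData, cpx_mul, cpx_realSteering, cpx_realSymbols, h]
  simp only [Matrix.mul_assoc]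

theorem cpx_realSymbols_gram (L : Fin R → ℕ) (μ : Fin R → Fin d → ℝ)
    (S₀ : Matrix (Fin d) (Fin N) ℝ) : cpx (realSymbols L μ S₀) * (cpx (realSymbols L μ S₀))ᴴ =
      (2 : ℂ) • (smoothedSymbols L μ S₀ * (smoothedSymbols L μ S₀)ᴴ) := by
  rw [cpx_realSymbols, conjTranspose_mul, Matrix.mul_assoc, ← Matrix.mul_assoc (leftReal _),
    leftReal_mul_conjTranspose prodMap_revIdx_rev, Matrix.one_mul, averagedSymbols_gram]

/-- The real-valued transformation has no effect on the source-wise perturbation. -/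
theorem cpx_realData_mul_pinv (hL : ∀ r, 1 ≤ L r ∧ L r ≤ M r) (μ : Fin R → Fin d → ℝ)
    (S₀ : Matrix (Fin d) (Fin N) ℝ)
    (hB : IsUnit (smoothedSymbols L μ S₀ * (smoothedSymbols L μ S₀)ᴴ).det)
    (W : Matrix (Idx M) (Fin N) ℂ) :
    cpx (realData M L W) * ((cpx (realSymbols L μ S₀))ᴴ *
      (cpx (realSymbols L μ S₀) * (cpx (realSymbols L μ S₀))ᴴ)⁻¹) =
    (leftReal (revIdx : Idx (subSize M L) → Idx (subSize M L)))ᴴ *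
      (ssnc M L W * ((smoothedSymbols L μ S₀)ᴴ *
        (smoothedSymbols L μ S₀ * (smoothedSymbols L μ S₀)ᴴ)⁻¹)) := by
  have h : cpx (realData M L W) * (cpx (realSymbols L μ S₀))ᴴ =
      (2 : ℂ) • ((leftReal (revIdx : Idx (subSize M L) → Idx (subSize M L)))ᴴ *
        (ssnc M L W * (smoothedSymbols L μ S₀)ᴴ)) := by
    rw [cpx_realData, cpx_realSymbols, conjTranspose_mul, Matrix.mul_assoc,
      ← Matrix.mul_assoc (leftReal (Prod.map _ _)), leftReal_mul_conjTranspose prodMap_revIdx_rev,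
      Matrix.one_mul, Matrix.mul_assoc, ssncFBA_mul_averagedSymbols hL, Matrix.mul_smul]
  have h2 : ((2 : ℂ) • (smoothedSymbols L μ S₀ * (smoothedSymbols L μ S₀)ᴴ))⁻¹ =
      (2 : ℂ)⁻¹ • (smoothedSymbols L μ S₀ * (smoothedSymbols L μ S₀)ᴴ)⁻¹ := by
    refine inv_eq_right_inv ?_
    rw [Matrix.smul_mul, Matrix.mul_smul, smul_smul, mul_nonsing_inv _ hB]
    norm_num
  rw [← Matrix.mul_assoc, h, cpx_realSymbols_gram, h2, Matrix.smul_mul, Matrix.mul_smul,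
    smul_smul, mul_inv_cancel₀ two_ne_zero, one_smul]
  simp only [Matrix.mul_assoc]

/-! #### Half-angle tangents -/

/-- With `c = cos (x / 2)` and `s = sin (x / 2)`, this is `exp (j x) = (c + j s)²` together with `(c
+ j s) (c - j s) = 1`, divided by `c ≠ 0`. -/
theorem exp_eq_cayley_tan {x : ℝ} (hx : |x| < Real.pi) :
    Complex.exp (Complex.I * x) * (1 - Complex.I * Real.tan (x / 2)) =
      1 + Complex.I * Real.tan (x / 2) := by
  have hc : Real.cos (x / 2) ≠ 0 := by
    rw [abs_lt] at hx
    exact (Real.cos_pos_of_mem_Ioo ⟨by linarith [hx.1], by linarith [hx.2]⟩).ne'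
  have hc' : (Real.cos (x / 2) : ℂ) ≠ 0 := by exact_mod_cast hc
  have h1 : (Real.cos (x / 2) : ℂ) ^ 2 + (Real.sin (x / 2) : ℂ) ^ 2 = 1 := by
    exact_mod_cast Real.cos_sq_add_sin_sq (x / 2)
  have h2 : Complex.exp (Complex.I * x) =
      (Real.cos (x / 2) + Real.sin (x / 2) * Complex.I) ^ 2 := by
    have : Complex.I * (x : ℂ) = ((2 : ℕ) : ℂ) * (((x / 2 : ℝ) : ℂ) * Complex.I) := by
      push_cast
      ring
    rw [this, Complex.exp_nat_mul, Complex.exp_mul_I, Complex.ofReal_cos, Complex.ofReal_sin]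
  rw [h2, Real.tan_eq_sin_div_cos]
  rw [Complex.ofReal_div]
  field_simp
  have hI := Complex.I_sq
  generalize (Real.cos (x / 2) : ℂ) = c at *
  generalize (Real.sin (x / 2) : ℂ) = s at *
  linear_combination (c + s * Complex.I) * h1 - (c + s * Complex.I) * s ^ 2 * hI

theorem one_add_exp_ne_zero {x : ℝ} (hx : |x| < Real.pi) :
    1 + Complex.exp (Complex.I * x) ≠ 0 := fun h0 => by
  have h := exp_eq_cayley_tan hx
  have h2 : (2 : ℂ) = 0 := by
    linear_combination (1 - Complex.I * Real.tan (x / 2)) * h0 - h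
  exact two_ne_zero h2

theorem exp_sub_one_eq {x : ℝ} (hx : |x| < Real.pi) :
    -Complex.I * (Complex.exp (Complex.I * x) - 1) =
      (1 + Complex.exp (Complex.I * x)) * (Real.tan (x / 2) : ℝ) := by
  have h := exp_eq_cayley_tan hx
  linear_combination -Complex.I * h -
    (1 + Complex.exp (Complex.I * x)) * (Real.tan (x / 2) : ℝ) * Complex.I_sq

/-- The chain rule for `2 arctan` after the Cayley transform. Since `a` is real, `w / z` is purely
imaginary; the factors match by `(1 + t²) (1 + z)² = 4 z` with `t = tan (x / 2)`. -/
theorem im_div_exp_eq {x a : ℝ} {w : ℂ} (hx : |x| < Real.pi)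
    (h : (a : ℂ) = -2 * Complex.I / (1 + Complex.exp (Complex.I * x)) ^ 2 * w) :
    (w / Complex.exp (Complex.I * x)).im = a * (2 / (1 + Real.tan (x / 2) ^ 2)) := by
  have h1 := exp_eq_cayley_tan hx
  have h2 := one_add_exp_ne_zero hx
  have hz : Complex.exp (Complex.I * x) ≠ 0 := Complex.exp_ne_zero _
  have h3 : (1 : ℂ) + (Real.tan (x / 2) : ℂ) ^ 2 ≠ 0 := by
    have : (1 : ℝ) + Real.tan (x / 2) ^ 2 ≠ 0 := by positivity
    exact_mod_cast this
  have key : w / Complex.exp (Complex.I * x) =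
      ((a * (2 / (1 + Real.tan (x / 2) ^ 2)) : ℝ) : ℂ) * Complex.I := by
    simp only [Complex.ofReal_mul, Complex.ofReal_div, Complex.ofReal_add, Complex.ofReal_pow,
      Complex.ofReal_one, Complex.ofReal_ofNat]
    rw [h]
    generalize Complex.exp (Complex.I * x) = z at *
    generalize (Real.tan (x / 2) : ℂ) = t at *
    have h4 : (1 + t ^ 2) * (1 + z) ^ 2 = 4 * z := by
      have e1 : (1 + z) * (1 - Complex.I * t) = 2 := by linear_combination h1
      have e2 : (1 + z) * (1 + Complex.I * t) = 2 * z := by linear_combination z * e1 - (1 + z) * h1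
      linear_combination (1 + z) * (1 + Complex.I * t) * e1 + 2 * e2 +
        (1 + z) ^ 2 * t ^ 2 * Complex.I_sq
    field_simp
    linear_combination w * h4 + 4 * w * z * Complex.I_sq
  rw [key, Complex.im_ofReal_mul, Complex.I_im, mul_one]

/-! #### The first-order errors -/

/-- The generic expansion over `ℝ`, with eigenvalues `tan (μ / 2)`. Its rank conditions and
first-order terms are computed after complexification, where they reduce to those of NC Standard
ESPRIT. -/
theorem hasFirstOrderError_unitary (hL : ∀ r, 1 ≤ L r ∧ L r ≤ M r)
    {μ : Fin R → Fin d → ℝ} (hμ : ∀ r i, |μ r i| < Real.pi)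
    (hdist : ∀ i j, (∀ r, μ r i = μ r j) → i = j)
    {δ : Fin R → ℝ} {φ : Fin d → ℝ} {S₀ : Matrix (Fin d) (Fin N) ℝ}
    (hrank : (ssnc M L (signal M μ δ φ S₀)).rank = d)
    (hshift : ∀ r, (dbl (shiftSel (subSize M L) r 0) * steeringSS M L μ δ φ).rank = d) :
    HasFirstOrderError M L μ (signal M μ δ φ S₀) (NCUnitaryESPRIT M L)
      (frequencyPerturbation hL μ δ φ S₀) := by
  have hν : Tendsto (noiseLevel (R := R) (N := N) M L) (comap (noiseLevel M L) (𝓝 0)) (𝓝 0) :=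
    tendsto_comap
  have hS := isUnit_gram_smoothedSymbols hL hrank
  have hQ : ∀ m : Fin R → ℕ, leftReal (revIdx : Idx m → Idx m) * (leftReal revIdx)ᴴ = 1 :=
    fun m => leftReal_mul_conjTranspose revIdx_revIdx
  have harctan : ∀ r i, 2 * Real.arctan (Real.tan (μ r i / 2)) = μ r i := fun r i => by
    have h := abs_lt.1 (hμ r i)
    rw [Real.arctan_tan (by linarith [h.1]) (by linarith [h.2])]
    ring
  have hsel : ∀ r, dbl (shiftSel (subSize M L) r 1) *
      ncSteering (subSize M L) μ (sourcePhase μ δ φ) = _ := fun r =>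
    dbl_shiftSel_mul_ncSteering (subSize M L) μ (sourcePhase μ δ φ) r
  have hA : IsUnit ((realSteering (subSize M L) μ (sourcePhase μ δ φ))ᴴ *
      realSteering (subSize M L) μ (sourcePhase μ δ φ)).det := by
    refine isUnit_det_of_cpx ?_
    rw [cpx_mul, cpx_conjTranspose, cpx_realSteering, conjTranspose_mul,
      conjTranspose_conjTranspose, Matrix.mul_assoc, ← Matrix.mul_assoc (leftReal _), hQ,
      Matrix.one_mul]
    exact isUnit_gram_ncSteering hL hrank
  have hB : IsUnit (realSymbols L μ S₀ * (realSymbols L μ S₀)ᴴ).det := by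
    refine isUnit_det_of_cpx ?_
    rw [cpx_mul, cpx_conjTranspose, cpx_realSymbols_gram, det_smul]
    exact (isUnit_iff_ne_zero.2 (pow_ne_zero _ two_ne_zero)).mul hS
  have hJ : ∀ r, IsUnit ((realSel₁ (subSize M L) r *
      realSteering (subSize M L) μ (sourcePhase μ δ φ))ᴴ * (realSel₁ (subSize M L) r *
      realSteering (subSize M L) μ (sourcePhase μ δ φ))).det := fun r => by
    refine isUnit_det_of_cpx ?_
    rw [cpx_mul, cpx_conjTranspose, cpx_mul, cpx_realSteering, cpx_realSel₁]
    exact isUnit_sum_sel_gram (hQ _) (hQ _) (hsel r) (isUnit_gram_shiftSel hL (hshift r))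
      fun i => one_add_exp_ne_zero (hμ r i)
  have hK : ∀ r, realSel₂ (subSize M L) r * realSteering (subSize M L) μ (sourcePhase μ δ φ) =
      realSel₁ (subSize M L) r * realSteering (subSize M L) μ (sourcePhase μ δ φ) *
        diagonal fun i => Real.tan (μ r i / 2) := fun r => by
    refine cpx_injective ?_
    rw [cpx_mul, cpx_mul, cpx_mul, cpx_realSteering, cpx_realSel₁, cpx_realSel₂, cpx_diagonal]
    exact diff_sel_mul (hQ _) (hsel r) fun i => exp_sub_one_eq (hμ r i)
  have hpert : ∀ r i (W : Matrix (Idx M) (Fin N) ℂ),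
      ((shiftPerturbation (realSel₁ (subSize M L) r) (realSel₂ (subSize M L) r)
        (realSteering (subSize M L) μ (sourcePhase μ δ φ)) (realSymbols L μ S₀)
        (fun i => Real.tan (μ r i / 2)) (realData M L W) i i : ℝ) : ℂ) =
      -2 * Complex.I / (1 + Complex.exp (Complex.I * μ r i)) ^ 2 *
        eigenvaluePerturbation M L μ δ φ S₀ r i W := fun r i W => by
    have h := congrFun (congrFun (cpx_shiftPerturbation (J₂ := realSel₂ (subSize M L) r)
      (a := fun i => Real.tan (μ r i / 2)) (W := realData M L W) (hJ r) hB) i) i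
    rw [cpx_realSteering, cpx_realSel₁, cpx_realSel₂] at h
    exact h.trans (shiftPerturbation_cayley (hQ _) (hQ _) (hsel r)
      (fun i => one_add_exp_ne_zero (hμ r i)) (fun i => exp_sub_one_eq (hμ r i))
      (cpx_realData_mul_pinv hL μ S₀ hS W) i)
  have hmain := esprit_expansion (J₁ := fun r => realSel₁ (subSize M L) r)
    (J₂ := fun r => realSel₂ (subSize M L) r)
    (lam := fun r i => Real.tan (μ r i / 2)) hν hA hB hJ hK
    (fun i j h => hdist i j fun r => by rw [← harctan r i, ← harctan r j, h r])
    (entrywiseBigO_realData hL _)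
  refine hasFirstOrderError_of_expansion (𝕜 := ℝ) (f := fun w => 2 * Real.arctan w)
    (g := fun r i => AddMonoidHom.mulRight (2 / (1 + Real.tan (μ r i / 2) ^ 2)))
    (lam := fun r i => Real.tan (μ r i / 2))
    (δ := fun r i W => shiftPerturbation (realSel₁ (subSize M L) r) (realSel₂ (subSize M L) r)
        (realSteering (subSize M L) μ (sourcePhase μ δ φ)) (realSymbols L μ S₀)
        (fun i => Real.tan (μ r i / 2)) (realData M L W) i i) hdist harctan ?_ ?_
    (fun r i => (entrywiseBigO_realData hL _).shiftPerturbation i i) ?_ ?_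
  · intro r i
    refine ⟨1, one_pos, 2 * (2 * |Real.tan (μ r i / 2)| + 1), fun w hw => ?_⟩
    have h := abs_arctan_sub_le (Real.tan (μ r i / 2)) w hw
    have e : 2 * Real.arctan w - 2 * Real.arctan (Real.tan (μ r i / 2)) -
        (w - Real.tan (μ r i / 2)) * (2 / (1 + Real.tan (μ r i / 2) ^ 2)) =
        2 * (Real.arctan w - Real.arctan (Real.tan (μ r i / 2)) -
          (w - Real.tan (μ r i / 2)) / (1 + Real.tan (μ r i / 2) ^ 2)) := by ring
    rw [AddMonoidHom.mulRight_apply, e, abs_mul, abs_two, Real.norm_eq_abs, mul_assoc]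
    exact mul_le_mul_of_nonneg_left h two_pos.le
  · intro r i
    refine ⟨|2 / (1 + Real.tan (μ r i / 2) ^ 2)|, fun w => ?_⟩
    rw [AddMonoidHom.mulRight_apply, abs_mul, Real.norm_eq_abs, mul_comm]
  · intro r i W
    exact im_div_exp_eq (hμ r i) (hpert r i W)
  · obtain ⟨C, hC⟩ := hmain
    refine ⟨C, hC.mono fun W hW => ?_⟩
    rw [← realData_signal hL, ← realData_add hL] at hW
    obtain ⟨⟨E, G, om, hE, hG, hom⟩, hall⟩ := hW
    refine ⟨⟨fun r i => 2 * Real.arctan (om r i), (ncUnitaryESPRIT_iff _ _).2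
      ⟨E, G, om, hE, hG, hom, fun _ _ => rfl⟩⟩, ?_⟩
    intro e he
    obtain ⟨E, G, om, hE, hG, hom, he⟩ := (ncUnitaryESPRIT_iff _ _).1 he
    obtain ⟨p, hp, hexp⟩ := hall E G om hE hG hom
    exact ⟨om, p, hp, he, hexp⟩

end Unitary
end NCEsprit

namespace NCEsprit

open Matrix

/-! ### Mean square errors -/

section MeanSquare

/-- If bounded errors `e σ` are `σ f + O((σ ν)²)` where `σ ν` is small, with `f` and `ν` square
integrable, then `E[(e σ)²] / σ²` tends to `E[f²]`. No measurability of `e σ` is needed. -/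
theorem tendsto_lintegral_sq_div_sq {Ω : Type*} [MeasurableSpace Ω] {P : Measure Ω} {f ν : Ω → ℝ}
    (hf : MemLp f 2 P) (hν : MemLp ν 2 P) (hν0 : ∀ ω, 0 ≤ ν ω) {ε C K : ℝ} (hε : 0 < ε)
    (hC : 0 ≤ C) (hK : 0 ≤ K) {e : ℝ → Ω → ℝ} (he : ∀ σ > 0, ∀ ω, |e σ ω| ≤ K)
    (hexp : ∀ σ > 0, ∀ ω, σ * ν ω < ε → |e σ ω - σ * f ω| ≤ C * (σ * ν ω) ^ 2) :
    Tendsto (fun σ : ℝ => (∫⁻ ω, ENNReal.ofReal (e σ ω ^ 2) ∂P) / ENNReal.ofReal (σ ^ 2))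
      (𝓝[>] 0) (𝓝 (∫⁻ ω, ENNReal.ofReal (f ω ^ 2) ∂P)) := by
  -- The envelope covers both regimes: `C ε ν` controls the quadratic remainder when `σ ν < ε`, and
  -- `(K / ε) ν` the crude bound, as `K ≤ K σ ν / ε` when `σ ν ≥ ε`.
  set G : Ω → ℝ := fun ω => (C * ε + K / ε) * ν ω + |f ω| with hG
  have hGL : MemLp G 2 P := (hν.const_mul _).add hf.abs
  have hGint : Integrable (fun ω => 3 * G ω ^ 2) P := hGL.integrable_sq.const_mul 3
  -- This dominates `|(e / σ)² - f²|`: with `t = min 1 (σ ν / ε)`, the difference of `e / σ` and `f`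
  -- is at most `G t`, and their sum at most `3 G`. It tends to zero pointwise below the integrable
  -- `3 G²`.
  set h : ℝ → Ω → ℝ := fun σ ω => 3 * G ω ^ 2 * min 1 (σ * ν ω / ε) with hh
  have hmeas : ∀ σ, AEStronglyMeasurable (h σ) P := fun σ =>
    hGint.aestronglyMeasurable.mul
      (aestronglyMeasurable_const.inf
        ((hν.aestronglyMeasurable.const_mul σ).mul aestronglyMeasurable_const))
  have hmin0 : ∀ σ > 0, ∀ ω, 0 ≤ min 1 (σ * ν ω / ε) := fun σ hσ ω =>
    le_min zero_le_one (div_nonneg (mul_nonneg hσ.le (hν0 ω)) hε.le)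
  have hh0 : ∀ σ > 0, ∀ ω, 0 ≤ h σ ω := fun σ hσ ω =>
    mul_nonneg (by positivity) (hmin0 σ hσ ω)
  have hle : ∀ σ > 0, ∀ ω, h σ ω ≤ 3 * G ω ^ 2 := fun σ hσ ω =>
    mul_le_of_le_one_right (by positivity) (min_le_left _ _)
  have hlim : Tendsto (fun σ => ∫⁻ ω, ENNReal.ofReal (h σ ω) ∂P) (𝓝[>] 0) (𝓝 0) := by
    have h1 : Tendsto (fun σ => ∫ ω, h σ ω ∂P) (𝓝[>] 0) (𝓝 (∫ _, (0 : ℝ) ∂P)) := by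
      refine tendsto_integral_filter_of_dominated_convergence _
        (Eventually.of_forall hmeas) ?_ hGint ?_
      · filter_upwards [self_mem_nhdsWithin] with σ hσ
        refine Eventually.of_forall fun ω => ?_
        rw [Real.norm_of_nonneg (hh0 σ hσ ω)]
        exact hle σ hσ ω
      · refine Eventually.of_forall fun ω => ?_
        have hc : Continuous fun σ : ℝ => h σ ω := by
          simp only [hh]
          fun_prop
        have := (hc.tendsto 0).mono_left (nhdsWithin_le_nhds (s := Set.Ioi 0))
        simpa [hh] using this
    rw [integral_zero] at h1
    have h2 := ENNReal.tendsto_ofReal h1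
    rw [ENNReal.ofReal_zero] at h2
    refine h2.congr' ?_
    filter_upwards [self_mem_nhdsWithin] with σ hσ
    refine ofReal_integral_eq_lintegral_ofReal ?_ (Eventually.of_forall (hh0 σ hσ))
    exact hGint.mono' (hmeas σ) (Eventually.of_forall fun ω => by
      rw [Real.norm_of_nonneg (hh0 σ hσ ω)]
      exact hle σ hσ ω)
  have hdiff : ∀ σ > 0, ∀ ω, |(e σ ω / σ) ^ 2 - f ω ^ 2| ≤ h σ ω := by
    intro σ hσ ω
    set t := min 1 (σ * ν ω / ε) with ht
    have ht0 : 0 ≤ t := hmin0 σ hσ ω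
    have ht1 : t ≤ 1 := min_le_left _ _
    have hfG : |f ω| ≤ G ω := le_add_of_nonneg_left
      (mul_nonneg (add_nonneg (mul_nonneg hC hε.le) (div_nonneg hK hε.le)) (hν0 ω))
    have hG0 : 0 ≤ G ω := (abs_nonneg _).trans hfG
    have key : |e σ ω / σ - f ω| ≤ G ω * t := by
      rcases lt_or_ge (σ * ν ω) ε with hlt | hge
      · have ht' : t = σ * ν ω / ε := min_eq_right ((div_le_one hε).2 hlt.le)
        have e1 : e σ ω / σ - f ω = (e σ ω - σ * f ω) / σ := by
          field_simp
        rw [e1, abs_div, abs_of_pos hσ, div_le_iff₀ hσ, ht']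
        refine (hexp σ hσ ω hlt).trans ?_
        have e2 : C * (σ * ν ω) ^ 2 = C * ε * ν ω * (σ * ν ω / ε) * σ := by
          field_simp
        rw [e2]
        have hq : 0 ≤ σ * ν ω / ε := div_nonneg (mul_nonneg hσ.le (hν0 ω)) hε.le
        have hle' : C * ε * ν ω ≤ G ω := by
          have h1 : 0 ≤ K / ε * ν ω := mul_nonneg (div_nonneg hK hε.le) (hν0 ω)
          simp only [hG]
          nlinarith [abs_nonneg (f ω)]
        exact mul_le_mul_of_nonneg_right (mul_le_mul_of_nonneg_right hle' hq) hσ.le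
      · have ht' : t = 1 := min_eq_left ((one_le_div hε).2 hge)
        rw [ht', mul_one]
        refine (abs_sub _ _).trans ?_
        have h1 : |e σ ω / σ| ≤ K / ε * ν ω := by
          rw [abs_div, abs_of_pos hσ, div_le_iff₀ hσ]
          refine (he σ hσ ω).trans ?_
          rw [mul_assoc, div_mul_eq_mul_div, le_div_iff₀ hε, mul_comm (ν ω)]
          exact mul_le_mul_of_nonneg_left hge hK
        have h2 : 0 ≤ C * ε * ν ω := mul_nonneg (mul_nonneg hC hε.le) (hν0 ω)
        simp only [hG]
        nlinarith
    have e3 : (e σ ω / σ) ^ 2 - f ω ^ 2 =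
        (e σ ω / σ - f ω) * ((e σ ω / σ - f ω) + 2 * f ω) := by ring
    rw [e3, abs_mul]
    have h4 : |(e σ ω / σ - f ω) + 2 * f ω| ≤ 3 * G ω := by
      refine (abs_add_le _ _).trans ?_
      rw [abs_mul, abs_two]
      nlinarith [mul_le_of_le_one_right hG0 ht1]
    calc _ ≤ G ω * t * (3 * G ω) := mul_le_mul key h4 (abs_nonneg _) (mul_nonneg hG0 ht0)
      _ = h σ ω := by simp only [hh]; ring
  have hscale : ∀ σ > 0, (∫⁻ ω, ENNReal.ofReal (e σ ω ^ 2) ∂P) / ENNReal.ofReal (σ ^ 2) =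
      ∫⁻ ω, ENNReal.ofReal ((e σ ω / σ) ^ 2) ∂P := fun σ hσ => by
    have hσ2 : 0 < σ ^ 2 := by positivity
    rw [ENNReal.div_eq_inv_mul, ← lintegral_const_mul' _ _
      (ENNReal.inv_ne_top.2 (ENNReal.ofReal_pos.2 hσ2).ne')]
    refine lintegral_congr fun ω => ?_
    rw [div_pow, ENNReal.ofReal_div_of_pos hσ2, ENNReal.div_eq_inv_mul]
  -- Additivity of the lower integral needs only one measurable summand, here `h σ`; this is why `e
  -- σ` may be arbitrary.
  have hadd : ∀ σ (x y : Ω → ℝ), (∀ ω, 0 ≤ h σ ω) → (∀ ω, 0 ≤ x ω) → (∀ ω, y ω ≤ x ω + h σ ω) →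
      ∫⁻ ω, ENNReal.ofReal (y ω) ∂P ≤
        ∫⁻ ω, ENNReal.ofReal (x ω) ∂P + ∫⁻ ω, ENNReal.ofReal (h σ ω) ∂P := by
    intro σ x y h0 hx0 hy
    rw [← lintegral_add_right' _ (hmeas σ).aemeasurable.ennreal_ofReal]
    refine lintegral_mono fun ω => ?_
    rw [← ENNReal.ofReal_add (hx0 ω) (h0 ω)]
    exact ENNReal.ofReal_le_ofReal (hy ω)
  have hlow := ENNReal.Tendsto.sub
    (tendsto_const_nhds (x := ∫⁻ ω, ENNReal.ofReal (f ω ^ 2) ∂P)) hlim (Or.inr ENNReal.zero_ne_top)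
  have hup := (tendsto_const_nhds (x := ∫⁻ ω, ENNReal.ofReal (f ω ^ 2) ∂P)).add hlim
  rw [tsub_zero] at hlow
  rw [add_zero] at hup
  refine tendsto_of_tendsto_of_tendsto_of_le_of_le' hlow hup ?_ ?_
  · filter_upwards [self_mem_nhdsWithin] with σ hσ
    rw [hscale σ hσ]
    refine tsub_le_iff_right.2 (hadd σ _ _ (hh0 σ hσ) (fun _ => sq_nonneg _) fun ω => ?_)
    linarith [(abs_le.1 (hdiff σ hσ ω)).1]
  · filter_upwards [self_mem_nhdsWithin] with σ hσ
    rw [hscale σ hσ]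
    refine hadd σ _ _ (hh0 σ hσ) (fun _ => sq_nonneg _) fun ω => ?_
    linarith [(abs_le.1 (hdiff σ hσ ω)).2]

variable {R d N : ℕ} {M L : Fin R → ℕ} {Ω : Type*} [MeasurableSpace Ω] {P : Measure Ω}
  {n : Ω → Matrix (Idx M) (Fin N) ℂ}

theorem memLp_linear (hn : ∀ m t, MemLp (fun ω => n ω m t) 2 P)
    (l : Matrix (Idx M) (Fin N) ℂ →ₗ[ℝ] ℝ) : MemLp (fun ω => l (n ω)) 2 P := by
  have h : (fun ω => l (n ω)) = fun ω => ∑ m, ∑ t, ((n ω m t).re * l (Matrix.single m t 1) +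
      (n ω m t).im * l (Matrix.single m t Complex.I)) := by
    funext ω
    conv_lhs => rw [matrix_eq_sum_single (n ω)]
    simp only [map_sum]
    refine Finset.sum_congr rfl fun m _ => Finset.sum_congr rfl fun t _ => ?_
    have e : Matrix.single m t (n ω m t) =
        (n ω m t).re • Matrix.single m t (1 : ℂ) + (n ω m t).im • Matrix.single m t Complex.I := by
      rw [smul_single, smul_single, ← single_add]
      congr 1
      rw [Complex.real_smul, Complex.real_smul, mul_one, Complex.re_add_im]
    rw [e, map_add, map_smul, map_smul, smul_eq_mul, smul_eq_mul]
  rw [h]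
  exact memLp_finsetSum _ fun m _ => memLp_finsetSum _ fun t _ =>
    ((hn m t).re.mul_const _).add ((hn m t).im.mul_const _)

theorem memLp_noiseLevel (hL : ∀ r, 1 ≤ L r ∧ L r ≤ M r)
    (hn : ∀ m t, MemLp (fun ω => n ω m t) 2 P) : MemLp (fun ω => noiseLevel M L (n ω)) 2 P := by
  have h : ∀ p c, MemLp (fun ω => ssnc M L (n ω) p c) 2 P := by
    intro p c
    rcases p with p | p
    · simp only [ssnc_inl hL]
      exact hn _ _
    · simp only [ssnc_inr hL]
      exact (hn _ _).star
  have hint : Integrable (fun ω => ∑ p, ∑ c, ‖ssnc M L (n ω) p c‖ ^ 2) P :=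
    integrable_finsetSum _ fun p _ => integrable_finsetSum _ fun c _ =>
      (h p c).norm.integrable_sq
  refine (memLp_two_iff_integrable_sq
    (Real.continuous_sqrt.comp_aestronglyMeasurable hint.aestronglyMeasurable)).2 ?_
  refine hint.congr (Eventually.of_forall fun ω => ?_)
  exact (Real.sq_sqrt (Finset.sum_nonneg fun _ _ => Finset.sum_nonneg fun _ _ =>
    sq_nonneg _)).symm

theorem noiseLevel_smul (hL : ∀ r, 1 ≤ L r ∧ L r ≤ M r) {σ : ℝ} (hσ : 0 ≤ σ)
    (W : Matrix (Idx M) (Fin N) ℂ) : noiseLevel M L (σ • W) = σ * noiseLevel M L W := by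
  have h : ssnc M L (σ • W) = σ • ssnc M L W := (ssncLinear hL).map_smul σ W
  simp only [noiseLevel, frob, h, Matrix.smul_apply, norm_smul, mul_pow, ← Finset.mul_sum,
    Real.norm_of_nonneg hσ]
  rw [Real.sqrt_mul (sq_nonneg σ), Real.sqrt_sq hσ]

/-- Noise level and linear terms are homogeneous in `σ`, and every error is at most `2 π`, including
on realizations without output. -/
theorem HasFirstOrderError.hasScaledMSE (hL : ∀ r, 1 ≤ L r ∧ L r ≤ M r) {μ : Fin R → Fin d → ℝ}
    (hμ : ∀ r i, |μ r i| < Real.pi) {X₀ : Matrix (Idx M) (Fin N) ℂ}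
    {alg : Matrix (Idx M) (Fin N) ℂ → (Fin R → Fin d → ℝ) → Prop}
    {l : Fin R → Fin d → Matrix (Idx M) (Fin N) ℂ →ₗ[ℝ] ℝ}
    (h : HasFirstOrderError M L μ X₀ alg l) (hn : ∀ m t, MemLp (fun ω => n ω m t) 2 P) :
    HasScaledMSE μ X₀ alg P n fun r i => ∫⁻ ω, ENNReal.ofReal (l r i (n ω) ^ 2) ∂P := by
  obtain ⟨ε, hε, C, hC⟩ := h
  intro est hest r i
  refine tendsto_lintegral_sq_div_sq (C := |C|) (K := 2 * Real.pi) (memLp_linear hn (l r i))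
    (memLp_noiseLevel hL hn) (fun _ => Real.sqrt_nonneg _) hε (abs_nonneg C)
    (by positivity) ?_ ?_
  · intro σ hσ ω
    refine (abs_sub _ _).trans ?_
    linarith [(hest σ hσ ω).1 r i, hμ r i]
  · intro σ hσ ω hlt
    rw [← noiseLevel_smul hL hσ.le] at hlt ⊢
    obtain ⟨hex, hall⟩ := hC _ hlt
    obtain ⟨halg, hmatch⟩ := (hest σ hσ ω).2 hex
    have h1 := hall _ halg hmatch r i
    rw [map_smul, smul_eq_mul] at h1
    exact h1.trans (mul_le_mul_of_nonneg_right (le_abs_self C) (sq_nonneg _))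

end MeanSquare
end NCEsprit

/-! ### The main theorem. -/

theorem theorem2 {R d N : ℕ} (M L : Fin R → ℕ)
    (hL : ∀ r, 1 ≤ L r ∧ L r ≤ M r)
    (μ : Fin R → Fin d → ℝ) (hμ : ∀ r i, |μ r i| < Real.pi)
    (hdist : ∀ i j, (∀ r, μ r i = μ r j) → i = j)
    (δ : Fin R → ℝ) (φ : Fin d → ℝ) (S₀ : Matrix (Fin d) (Fin N) ℝ)
    (hrank : (ssnc M L (signal M μ δ φ S₀)).rank = d)
    (hshift : ∀ r, (dbl (shiftSel (subSize M L) r 0) * steeringSS M L μ δ φ).rank = d) :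
    ∃ l : Fin R → Fin d → Matrix (Idx M) (Fin N) ℂ →ₗ[ℝ] ℝ,
      (HasFirstOrderError M L μ (signal M μ δ φ S₀) (NCUnitaryESPRIT M L) l ∧
        HasFirstOrderError M L μ (signal M μ δ φ S₀) (NCStandardESPRITwithFBA M L) l ∧
        HasFirstOrderError M L μ (signal M μ δ φ S₀) (NCStandardESPRIT M L) l) ∧
      ∀ (Ω : Type*) [MeasurableSpace Ω] (P : Measure Ω) [IsProbabilityMeasure P]
        (n : Ω → Matrix (Idx M) (Fin N) ℂ), (∀ m t, MemLp (fun ω => n ω m t) 2 P) →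
        ∃ v : Fin R → Fin d → ENNReal,
          (∀ r i, v r i = ∫⁻ ω, ENNReal.ofReal (l r i (n ω) ^ 2) ∂P) ∧ (∀ r i, v r i < ⊤) ∧
          HasScaledMSE μ (signal M μ δ φ S₀) (NCUnitaryESPRIT M L) P n v ∧
          HasScaledMSE μ (signal M μ δ φ S₀) (NCStandardESPRITwithFBA M L) P n v ∧
          HasScaledMSE μ (signal M μ δ φ S₀) (NCStandardESPRIT M L) P n v := by
  have hstd := hasFirstOrderError_standard hL hμ hdist hrank hshift
  have hfba : HasFirstOrderError M L μ (signal M μ δ φ S₀) (NCStandardESPRITwithFBA M L)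
      (frequencyPerturbation hL μ δ φ S₀) := by
    -- As relations between measurements and outputs, the algorithms with and without averaging
    -- coincide.
    have h : NCStandardESPRITwithFBA (d := d) (N := N) M L = NCStandardESPRIT M L :=
      funext fun X => funext fun e => propext (ncStandardESPRITwithFBA_iff hL X e)
    rw [h]
    exact hstd
  have huni := hasFirstOrderError_unitary hL hμ hdist hrank hshift
  refine ⟨frequencyPerturbation hL μ δ φ S₀, ⟨huni, hfba, hstd⟩, ?_⟩
  intro Ω _ P _ n hn
  refine ⟨fun r i => ∫⁻ ω, ENNReal.ofReal (frequencyPerturbation hL μ δ φ S₀ r i (n ω) ^ 2) ∂P,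
    fun _ _ => rfl, fun r i => ?_, huni.hasScaledMSE hL hμ hn, hfba.hasScaledMSE hL hμ hn,
    hstd.hasScaledMSE hL hμ hn⟩
  exact (memLp_linear hn (frequencyPerturbation hL μ δ φ S₀ r i)).integrable_sq.lintegral_lt_top
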